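/- Let $n\ge 2$ and $0\le p\le n$ be integers, $k\in\mathbb R\setminus\{0\}$, $\ell\in\mathbb R$, and let $|\mathbb S^{n-1}|$ be the area of the unit sphere of $\mathbb R^n$. Consider the fourth-order Fuchsian equation, with singular points $0,\frac12,1,\infty$, $$f''''+Q_3f'''+Q_2f''+Q_1f'+Q_0f=0,\qquad(\ast)$$ where $$Q_3=\frac{n+4}{z-1}+\frac{n+4}{z}+\frac4{1-2z},$$ $$Q_2=\frac{N_2(z)}{16z^6-48z^5+52z^4-24z^3+4z^2},\qquad Q_1=\frac{N_1(z)}{4z^5-10z^4+8z^3-2z^2},\qquad Q_0=\frac{N_0(z)}{4z^6-12z^5+13z^4-6z^3+z^2},$$ $$\begin{aligned}N_2={}&16(n^2+2(p+3)n-2p^2+2(\ell+3))z^4+32(2p^2-n^2-2(p+3)n-2(\ell+3))z^3\\&+8(3n^2+5(p+3)n+3n-5p^2+\ell+4(\ell+3)+6)z^2+8(p^2-n^2-(p+3)n-3n-\ell-6)z+n^2+6n+8,\\ N_1={}&2pn^2+n^2-2p^2n+4pn+2\ell n+2n-4p^2+4\ell\\&+4(-2pn^2-n^2+2p^2n-2pn-2\ell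 n-2n+2p^2+2p-2\ell)z\\&+4(2pn^2+n^2-2p^2n+2pn+2\ell n+2n-2p^2-2p+2\ell)z^2,\\ N_0={}&p^4-2np^3+n^2p^2-2\ell p^2+p^2-2np+2n\ell p-2p+\ell^2-2\ell\\&+4(-p^4+2np^3-n^2p^2+2\ell p^2+p^2-2n\ell p-\ell^2)z\\&+4(p^4-2np^3+n^2p^2-2\ell p^2-p^2+2n\ell p+\ell^2)z^2.\end{aligned}$$ Say that a real function $f$ has the Green's-function singularity at $0$ (from one side) if, as $z\to0$ from that side, $$f(z)=\frac{4|z|^{1-n/2}}{k(n-2)|\mathbb S^{n-1}|}+R_n(z)\ \text{ if } n\ge3,\qquad f(z)=-\frac{\log|z|}{4\pi}+R_n(z)\ \text{ if } n=2,$$ where $R_n=O(1)$ for $n=2,3$, $R_n=O(\log|z|)$ for $n=4$, and $R_n=O(|z|^{2-n/2})$ for $n\ge5$. (1) Let $\ell\le0$, and let $S$ be the set of real solutions of $(\ast)$ on $(-\infty,0)$ with the Green's-function singularity at $0^-$. There is a $\Phi_+\in S$ with the fastest possible decay at $-\infty$, that is, $\Phi_+(z)\to0$ as $z\to-\infty$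 and $\Phi_+=O(\Psi)$ as $z\to-\infty$ for every $\Psi\in S$. If $\ell<0$, or if $\ell=0$ and $|n-2p|\ge2$, this $\Phi_+$ is unique. (2) Let $\ell>0$, or $\ell\ge0$ and $p\ne0,n$. There is a unique real solution $\Phi_-$ of $(\ast)$ on $(0,1)$ (of class $C^4$ there, the equation being imposed off $z=\frac12$) which has the Green's-function singularity at $0^+$ and for which $z^{\frac n2-1}\Phi_-(z)$ is analytic on $(0,1]$, the singular points $\frac12$ and $1$ included. Moreover, at the end point $0$ there are functions $a,b$ analytic at $0$ such that, for small $z>0$, $z^{\frac n2-1}\Phi_-=a+z^{\frac n2-1}b$ if $n$ is odd and $z^{\frac n2-1}\Phi_-=a+z^{\frac n2-1}b\log z$ if $n$ is even. -/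

import Mathlib

open Filter Topology Asymptotics MeasureTheory

noncomputable section

/-- The area of the unit sphere of dimension `n - 1` in the Euclidean space of dimension `n`. -/
def sphereArea (n : ℕ) : ℝ :=
  ((volume : Measure (EuclideanSpace ℝ (Fin n))).toSphere Set.univ).toReal

/-- Coefficient of the third derivative. -/
def fuchsQ3 (n z : ℝ) : ℝ :=
  (n + 4) / (z - 1) + (n + 4) / z + 4 / (1 - 2 * z)

/-- Coefficient of the second derivative. -/
def fuchsQ2 (n p ℓ z : ℝ) : ℝ :=
  (16 * (n ^ 2 + 2 * (p + 3) * n - 2 * p ^ 2 + 2 * (ℓ + 3)) * z ^ 4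
    + 32 * (2 * p ^ 2 - n ^ 2 - 2 * (p + 3) * n - 2 * (ℓ + 3)) * z ^ 3
    + 8 * (3 * n ^ 2 + 5 * (p + 3) * n + 3 * n - 5 * p ^ 2 + ℓ + 4 * (ℓ + 3) + 6) * z ^ 2
    + 8 * (p ^ 2 - n ^ 2 - (p + 3) * n - 3 * n - ℓ - 6) * z
    + n ^ 2 + 6 * n + 8)
  / (16 * z ^ 6 - 48 * z ^ 5 + 52 * z ^ 4 - 24 * z ^ 3 + 4 * z ^ 2)

/-- Coefficient of the first derivative. -/
def fuchsQ1 (n p ℓ z : ℝ) : ℝ :=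
  (2 * p * n ^ 2 + n ^ 2 - 2 * p ^ 2 * n + 4 * p * n + 2 * ℓ * n + 2 * n - 4 * p ^ 2 + 4 * ℓ
    + 4 * (-2 * p * n ^ 2 - n ^ 2 + 2 * p ^ 2 * n - 2 * p * n - 2 * ℓ * n - 2 * n
        + 2 * p ^ 2 + 2 * p - 2 * ℓ) * z
    + 4 * (2 * p * n ^ 2 + n ^ 2 - 2 * p ^ 2 * n + 2 * p * n + 2 * ℓ * n + 2 * n
        - 2 * p ^ 2 - 2 * p + 2 * ℓ) * z ^ 2)
  / (4 * z ^ 5 - 10 * z ^ 4 + 8 * z ^ 3 - 2 * z ^ 2)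

/-- Coefficient of the function itself. -/
def fuchsQ0 (n p ℓ z : ℝ) : ℝ :=
  (p ^ 4 - 2 * n * p ^ 3 + n ^ 2 * p ^ 2 - 2 * ℓ * p ^ 2 + p ^ 2 - 2 * n * p + 2 * n * ℓ * p
      - 2 * p + ℓ ^ 2 - 2 * ℓ
    + 4 * (-p ^ 4 + 2 * n * p ^ 3 - n ^ 2 * p ^ 2 + 2 * ℓ * p ^ 2 + p ^ 2 - 2 * n * ℓ * p
        - ℓ ^ 2) * z
    + 4 * (p ^ 4 - 2 * n * p ^ 3 + n ^ 2 * p ^ 2 - 2 * ℓ * p ^ 2 - p ^ 2 + 2 * n * ℓ * p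
        + ℓ ^ 2) * z ^ 2)
  / (4 * z ^ 6 - 12 * z ^ 5 + 13 * z ^ 4 - 6 * z ^ 3 + z ^ 2)

/-- `f` is a real solution, on the open set `U`, of the fourth order Fuchsian equation
`f'''' + Q₃ f''' + Q₂ f'' + Q₁ f' + Q₀ f = 0`: it is of class `C⁴` on `U`, and the equation
holds at all points of `U` other than the finite singular points `0`, `1/2`, `1`. -/
def IsFuchsSolutionOn (n p : ℕ) (ℓ : ℝ) (U : Set ℝ) (f : ℝ → ℝ) : Prop :=
  ContDiffOn ℝ 4 f U ∧
    ∀ z ∈ U, z ≠ 0 → z ≠ 1 / 2 → z ≠ 1 →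
      iteratedDeriv 4 f z + fuchsQ3 n z * iteratedDeriv 3 f z
        + fuchsQ2 n p ℓ z * iteratedDeriv 2 f z + fuchsQ1 n p ℓ z * deriv f z
        + fuchsQ0 n p ℓ z * f z = 0

/-- The leading term at `0` of the radial Green's function:
`4 |z|^(1 - n/2) / (k (n - 2) |S^(n-1)|)` for `n ≥ 3` and `- log |z| / (4 π)` for `n = 2`. -/
def greenLeading (n : ℕ) (k z : ℝ) : ℝ :=
  if n = 2 then -Real.log |z| / (4 * Real.pi)
  else 4 * |z| ^ (1 - (n : ℝ) / 2) / (k * ((n : ℝ) - 2) * sphereArea n)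

/-- The size of the remainder at `0`: `1` for `n = 2, 3`, `log |z|` for `n = 4` and
`|z|^(2 - n/2)` for `n ≥ 5`. -/
def greenRemainder (n : ℕ) (z : ℝ) : ℝ :=
  if n = 4 then Real.log |z| else |z| ^ min 0 (2 - (n : ℝ) / 2)

/-- `f` has the singularity of the Green's function at `0` along the filter `l`
(one of the two one-sided neighbourhood filters of `0`). -/
def HasGreenSingularity (n : ℕ) (k : ℝ) (l : Filter ℝ) (f : ℝ → ℝ) : Prop :=
  (fun z => f z - greenLeading n k z) =O[l] greenRemainder n

/-- The solutions on `(-∞, 0)` with the singularity of the Green's function at `0`. -/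
def greenSolutionsNeg (n p : ℕ) (k ℓ : ℝ) : Set (ℝ → ℝ) :=
  {f | IsFuchsSolutionOn n p ℓ (Set.Iio 0) f ∧ HasGreenSingularity n k (𝓝[<] 0) f}

/-- `Φ` decays as `z → -∞`, and does so at least as fast as every other element of `S`. -/
def DecaysFastestIn (S : Set (ℝ → ℝ)) (Φ : ℝ → ℝ) : Prop :=
  Φ ∈ S ∧ Tendsto Φ atBot (𝓝 0) ∧ ∀ Ψ ∈ S, Φ =O[atBot] Ψ

/-- `Φ` is a solution on `(0, 1)` with the singularity of the Green's function at `0` such that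
`z^(n/2 - 1) Φ(z)` is analytic on `(0, 1]`, the regular singular points `1/2` and `1` included. -/
def IsPhiMinus (n p : ℕ) (k ℓ : ℝ) (Φ : ℝ → ℝ) : Prop :=
  IsFuchsSolutionOn n p ℓ (Set.Ioo 0 1) Φ ∧
    HasGreenSingularity n k (𝓝[>] 0) Φ ∧
    AnalyticOnNhd ℝ (fun z => z ^ ((n : ℝ) / 2 - 1) * Φ z) (Set.Ioc 0 1)

/-- At the end point `0`, `z^(n/2 - 1) Φ(z)` is given by analytic functions of `z`, up to the
power `z^(n/2 - 1)` if `n` is odd, or `z^(n/2 - 1) log z` if `n` is even: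
`z^(n/2 - 1) Φ(z) = a(z) + z^(n/2 - 1) b(z)` for odd `n`, and
`z^(n/2 - 1) Φ(z) = a(z) + z^(n/2 - 1) b(z) log z` for even `n`,
with `a` and `b` analytic at `0`. -/
def HasFrobeniusFormAtZero (n : ℕ) (Φ : ℝ → ℝ) : Prop :=
  ∃ a b : ℝ → ℝ, AnalyticAt ℝ a 0 ∧ AnalyticAt ℝ b 0 ∧
    ∀ᶠ z in 𝓝[>] (0 : ℝ),
      z ^ ((n : ℝ) / 2 - 1) * Φ z =
        a z + z ^ ((n : ℝ) / 2 - 1) * b z * (if Even n then Real.log z else 1)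

end

/-! The fourth-order operator factors. Put α = n/2 and L_λ y = z(1-z)y'' + (α+1)(1-2z)y' - λy. Away
from 0, 1/2, 1, a function f solves (∗) exactly when W = L_μ f/(1-2z) solves L_κ W = 0, with μ =
p(n+1-p)+ℓ and κ = (p+1)(n-p)+ℓ (`fuchs_cleared`, `isFuchsSolutionOn_of_system`,
`exists_system_of_isFuchsSolutionOn`). This leaves two hypergeometric equations with exponents 0 and
-n/2 at 0. They are solved by reduction of order: with the weight |z(1-z)|^(α+1), Wronskians are
constants or primitives of explicit functions.

Near 0 the four-dimensional solution space has three scales: a solution of size x^(-n/2), one with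
the Green's singularity, which comes from a singular W, and a plane of bounded ones. The coefficient
of the Green's singularity is a nonzero multiple of the Wronskian constant of W (`frobenius_green`),
and `coeffs_eq_zero_of_isBigO` separates the scales. Prescribing the singularity therefore fixes two
of the four constants.

On (0,1), where μ, κ > 0, L_λ is invariant under z ↦ 1-z, so one power series with positive
coefficients gives the regular solutions at both ends. Their Wronskian does not vanish, so the
solution regular at 1 is singular at 0. The solutions of (∗) analytic at 1 form a plane spanned by a
pure x^(-n/2) solution v and a solution g normalized to the Green's singularity
(`exists_regular_basis`, `phiMinus_eq_combination`). The condition at 0 then leaves only g.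

On (-∞,0), with x = -z, the decay exponents at infinity are α+1/2 ± A for W and α+1/2 ± B for the
homogeneous equation for f. They are real because ℓ ≤ 0. The solutions g, u regular at 0 are
positive (`exists_isRegularSolution`) and are compared with powers of 1+2x. Let W = gT be the
decaying solution and f = u(L-E) the solution it generates. Every other candidate is, up to
normalization, u(L-E) + u(b-aQ), where uQ is generated by W = g (`IsGreenData.exists_eq_of_isBigO`).
Since T → 0, the derivative of E is negligible against that of Q, so L-E is dominated by b-aQ if a ≠
0, and by a nonzero constant b if E converges to L. This gives minimality
(`IsGreenData.isBigO_quotient`) and, when E converges, uniqueness (`IsGreenData.eq_zero_of_isBigO`).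
Convergence follows from A+B > 1. In the borderline cases ℓ = 0, |n-2p| ≤ 1, where A+B = 1, E may
diverge, but u then decays fast enough to make u(L-E) tend to 0. -/

/-! ### Power series and recurrences of Gauss type. -/

/-- The power series with coefficients `a` converges absolutely on the ball of radius `R`. -/
def AbsSeries (R : ℝ) (a : ℕ → ℝ) : Prop :=
  ∀ r : ℝ, 0 ≤ r → r < R → Summable fun j => |a j| * r ^ j

/-- The sum of the power series with coefficients `a`. -/
noncomputable def ps (a : ℕ → ℝ) (x : ℝ) : ℝ := ∑' j, a j * x ^ j

theorem AbsSeries.summable {R : ℝ} {a : ℕ → ℝ} (h : AbsSeries R a) {x : ℝ} (hx : |x| < R) :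
    Summable fun j => a j * x ^ j := by
  refine Summable.of_norm ?_
  simpa [abs_mul, abs_pow] using h |x| (abs_nonneg x) hx

theorem AbsSeries.hasSum {R : ℝ} {a : ℕ → ℝ} (h : AbsSeries R a) {x : ℝ} (hx : |x| < R) :
    HasSum (fun j => a j * x ^ j) (ps a x) := (h.summable hx).hasSum

/-- The coefficients of the derivative of a power series. -/
def derivCoeff (a : ℕ → ℝ) (j : ℕ) : ℝ := ((j : ℝ) + 1) * a (j + 1)

theorem AbsSeries.deriv {R : ℝ} {a : ℕ → ℝ} (h : AbsSeries R a) :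
    AbsSeries R (derivCoeff a) := by
  intro r hr hrR
  obtain ⟨r', h1, h2⟩ := exists_between hrR
  have hr' : 0 < r' := lt_of_le_of_lt hr h1
  have hs : Summable fun j => |a (j + 1)| * r' ^ (j + 1) :=
    (summable_nat_add_iff 1).2 (h r' hr'.le h2)
  have hq0 : 0 ≤ r / r' := div_nonneg hr hr'.le
  have hq : r / r' < 1 := (div_lt_one hr').2 h1
  have ht : Tendsto (fun j : ℕ => (j : ℝ) * (r / r') ^ j + (r / r') ^ j) atTop (𝓝 (0 + 0)) :=
    (tendsto_self_mul_const_pow_of_lt_one hq0 hq).add (tendsto_pow_atTop_nhds_zero_of_lt_one hq0 hq)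
  have hb : (fun j : ℕ => (j : ℝ) * (r / r') ^ j + (r / r') ^ j) =O[atTop] fun _ => (1 : ℝ) :=
    ht.isBigO_one ℝ
  refine summable_of_isBigO_nat hs ?_
  have := (hb.mul (isBigO_refl (fun j => |a (j + 1)| * r' ^ (j + 1)) atTop)).const_mul_left (1 / r')
  refine (this.congr_left fun j => ?_).trans (isBigO_of_le _ fun j => by simp)
  rw [derivCoeff, abs_mul, abs_of_nonneg (by positivity : (0 : ℝ) ≤ (j : ℝ) + 1), div_pow, pow_succ]
  field_simp

theorem ps_hasDerivAt {R : ℝ} {a : ℕ → ℝ} (h : AbsSeries R a) {x : ℝ} (hx : |x| < R) :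
    HasDerivAt (ps a) (ps (derivCoeff a) x) x := by
  obtain ⟨r, h1, h2⟩ := exists_between hx
  have hr : 0 < r := lt_of_le_of_lt (abs_nonneg x) h1
  have hd := h.deriv
  have hu : Summable fun j : ℕ => (j : ℝ) * |a j| * r ^ (j - 1) := by
    rw [← summable_nat_add_iff 1]
    refine (hd r hr.le h2).congr fun j => ?_
    rw [derivCoeff, abs_mul, abs_of_nonneg (by positivity : (0 : ℝ) ≤ (j : ℝ) + 1)]
    simp
  have key := hasDerivAt_tsum_of_isPreconnected (g := fun j y => a j * y ^ j)
    (g' := fun j y => a j * (j * y ^ (j - 1))) (y₀ := 0) (y := x) hu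
    (Metric.isOpen_ball (x := (0 : ℝ)) (ε := r)) (convex_ball (0 : ℝ) r).isPreconnected
    (fun j y _ => (hasDerivAt_pow j y).const_mul (a j)) (fun j y hy => ?_)
    (by simpa using hr) (h.summable (by simpa using hr.trans h2)) (by simpa using h1)
  · have e : ps (derivCoeff a) x = ∑' j : ℕ, a j * (j * x ^ (j - 1)) := by
      have hs : Summable fun j : ℕ => a j * (j * x ^ (j - 1)) := by
        rw [← summable_nat_add_iff 1]
        refine (hd.summable hx).congr fun j => ?_
        simp [derivCoeff]; ring
      rw [hs.tsum_eq_zero_add]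
      simp only [ps, CharP.cast_eq_zero, zero_mul, mul_zero, zero_add]
      refine tsum_congr fun j => ?_
      simp [derivCoeff]; ring
    rw [e]; exact key
  · have hy' : |y| ≤ r := by
      have : |y| < r := by simpa using hy
      exact this.le
    rw [Real.norm_eq_abs, abs_mul, abs_mul, abs_pow, Nat.abs_cast]
    have := pow_le_pow_left₀ (abs_nonneg y) hy' (j - 1)
    nlinarith [mul_le_mul_of_nonneg_left this (by positivity : 0 ≤ (j : ℝ) * |a j|)]

theorem ps_analyticAt {R : ℝ} {a : ℕ → ℝ} (h : AbsSeries R a) {x : ℝ} (hx : |x| < R) :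
    AnalyticAt ℝ (ps a) x := by
  obtain ⟨r, h1, h2⟩ := exists_between hx
  have hr : 0 < r := lt_of_le_of_lt (abs_nonneg x) h1
  have hb : HasFPowerSeriesOnBall (ps a) (FormalMultilinearSeries.ofScalars ℝ a) 0
      (ENNReal.ofReal r) := by
    refine ⟨?_, by simpa using hr, ?_⟩
    · rw [ENNReal.ofReal]
      refine FormalMultilinearSeries.le_radius_of_summable_norm _ ?_
      refine (h r hr.le h2).congr fun j => ?_
      rw [FormalMultilinearSeries.ofScalars_norm, Real.norm_eq_abs, Real.coe_toNNReal _ hr.le]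
    · intro y hy
      have hy' : |y| < r := by
        simpa [Metric.eball_ofReal] using hy
      have := h.hasSum (hy'.trans h2)
      simpa [FormalMultilinearSeries.ofScalars_apply_eq, smul_eq_mul, mul_comm] using this
  exact hb.analyticAt_of_mem (by simpa [Metric.eball_ofReal] using h1)

theorem exists_ps_of_analyticAt {E : ℝ → ℝ} (hE : AnalyticAt ℝ E 0) :
    ∃ R > 0, ∃ a : ℕ → ℝ, AbsSeries R a ∧ ∀ x, |x| < R → E x = ps a x := by
  obtain ⟨p, r, hp⟩ := hE
  obtain ⟨r', hr'0, hr'⟩ : ∃ r' : NNReal, 0 < r' ∧ (r' : ENNReal) < r := by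
    obtain ⟨r', h1, h2⟩ := ENNReal.lt_iff_exists_nnreal_btwn.1 hp.r_pos
    exact ⟨r', by exact_mod_cast h1, h2⟩
  refine ⟨r', by exact_mod_cast hr'0, p.coeff, ?_, ?_⟩
  · intro s hs hsr
    lift s to NNReal using hs
    have : (s : ENNReal) < p.radius := by
      refine lt_of_lt_of_le ?_ (hr'.le.trans hp.r_le)
      exact_mod_cast hsr
    refine (p.summable_norm_mul_pow this).congr fun j => ?_
    rw [FormalMultilinearSeries.norm_apply_eq_norm_coef, Real.norm_eq_abs]
  · intro x hx
    have hx' : x ∈ Metric.eball (0 : ℝ) r := by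
      rw [Metric.mem_eball, edist_dist, Real.dist_eq, sub_zero]
      refine lt_trans ?_ hr'
      rw [ENNReal.ofReal_lt_iff_lt_toReal (abs_nonneg x) (by simp)]
      simpa using hx
    have := hp.hasSum hx'
    rw [zero_add] at this
    rw [← this.tsum_eq, ps]
    refine tsum_congr fun j => ?_
    rw [FormalMultilinearSeries.apply_eq_pow_smul_coeff]
    simp [mul_comm]

theorem HasSum.mul_shift {f : ℕ → ℝ} (h0 : f 0 = 0) {x S : ℝ}
    (h : HasSum (fun j => f (j + 1) * x ^ j) S) : HasSum (fun j => f j * x ^ j) (x * S) := by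
  rw [← hasSum_nat_add_iff' 1]
  simp only [Finset.range_one, Finset.sum_singleton, h0, zero_mul, sub_zero]
  refine (h.mul_left x).congr_fun ?_
  intro j; simp only [pow_succ]; ring

theorem bounded_of_step {D e : ℕ → ℝ} (he : Summable e) (he0 : ∀ j, 0 ≤ e j) {N : ℕ}
    (h : ∀ j ≥ N, D (j + 1) ≤ D j + e j) : ∀ j ≥ N, D j ≤ D N + ∑' i, e i := by
  have key : ∀ i, D (N + i) ≤ D N + ∑ k ∈ Finset.range i, e (N + k) := by
    intro i
    induction i with
    | zero => simp
    | succ i ih =>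
      rw [Finset.sum_range_succ, ← add_assoc]
      have := h (N + i) (by omega)
      linarith
  intro j hj
  obtain ⟨i, rfl⟩ := Nat.exists_eq_add_of_le hj
  refine (key i).trans ?_
  gcongr
  have h1 : Summable fun k => e (N + k) := he.comp_injective (add_right_injective N)
  calc _ ≤ ∑' k, e (N + k) := h1.sum_le_tsum _ fun k _ => he0 _
    _ ≤ _ := h1.tsum_le_tsum_of_inj (fun k => N + k) (add_right_injective N) (fun c _ => he0 c)
        (fun _ => le_rfl) he

theorem tendsto_recurrence_ratio (c s k : ℝ) :
    Tendsto (fun j : ℕ => |(j : ℝ) ^ 2 + s * j + k| / (((j : ℝ) + 1) * (j + c))) atTop (𝓝 1) := by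
  have h0 : Tendsto (fun j : ℕ => ((j : ℝ))⁻¹) atTop (𝓝 0) := tendsto_inv_atTop_nhds_zero_nat
  have h1 : Tendsto (fun j : ℕ => |1 + s * (j : ℝ)⁻¹ + k * ((j : ℝ)⁻¹ * (j : ℝ)⁻¹)| /
      ((1 + (j : ℝ)⁻¹) * (1 + c * (j : ℝ)⁻¹))) atTop
      (𝓝 (|1 + s * 0 + k * (0 * 0)| / ((1 + 0) * (1 + c * 0)))) := by
    refine Tendsto.div ?_ ?_ (by norm_num)
    · exact ((tendsto_const_nhds.add (h0.const_mul s)).add ((h0.mul h0).const_mul k)).abs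
    · exact (tendsto_const_nhds.add h0).mul (tendsto_const_nhds.add (h0.const_mul c))
  simp only [mul_zero, add_zero, abs_one, mul_one, div_one] at h1
  refine h1.congr' ?_
  filter_upwards [eventually_gt_atTop 0] with j hj
  have hj' : (0 : ℝ) < j := by exact_mod_cast hj
  have e1 : 1 + s * (j : ℝ)⁻¹ + k * ((j : ℝ)⁻¹ * (j : ℝ)⁻¹) = ((j : ℝ) ^ 2 + s * j + k) / j ^ 2 := by
    field_simp
  have e2 : (1 + (j : ℝ)⁻¹) * (1 + c * (j : ℝ)⁻¹) = (((j : ℝ) + 1) * (j + c)) / j ^ 2 := by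
    field_simp
  rw [e1, e2, abs_div, abs_of_pos (by positivity : (0 : ℝ) < (j : ℝ) ^ 2),
    div_div_div_cancel_right₀ (by positivity)]

/-- The ratio of consecutive coefficients of the homogeneous recurrence tends to 1. For r < ρ < 1
the quantities |d j| ρ^j therefore eventually increase by at most the summable |e j| ρ^j. They stay
bounded, and (r/ρ)^j supplies the convergence. -/
theorem AbsSeries.of_recurrence {c s k : ℝ} (hc : 0 < c) {d e : ℕ → ℝ} (he : AbsSeries 1 e)
    (h : ∀ j : ℕ, ((j : ℝ) + 1) * (j + c) * d (j + 1) = ((j : ℝ) ^ 2 + s * j + k) * d j + e j) :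
    AbsSeries 1 d := by
  intro r hr hr1
  obtain ⟨ρ, h1, h2⟩ := exists_between hr1
  have hρ : 0 < ρ := lt_of_le_of_lt hr h1
  have hθ : ∀ᶠ j : ℕ in atTop,
      |(j : ℝ) ^ 2 + s * j + k| / (((j : ℝ) + 1) * (j + c)) < ρ⁻¹ :=
    (tendsto_recurrence_ratio c s k).eventually_lt_const (one_lt_inv_iff₀.2 ⟨hρ, h2⟩)
  obtain ⟨N, hN⟩ := eventually_atTop.1 (hθ.and (eventually_ge_atTop 1))
  have hs : Summable fun j => |e j| * ρ ^ j := he ρ hρ.le h2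
  have step : ∀ j ≥ N, |d (j + 1)| * ρ ^ (j + 1) ≤ |d j| * ρ ^ j + |e j| * ρ ^ j := by
    intro j hj
    obtain ⟨hj1, hj2⟩ := hN j hj
    have hj2' : (1 : ℝ) ≤ j := by exact_mod_cast hj2
    have hpos : 0 < ((j : ℝ) + 1) * (j + c) := by positivity
    have hge : 1 ≤ ((j : ℝ) + 1) * (j + c) := by nlinarith
    have hd : ((j : ℝ) + 1) * (j + c) * |d (j + 1)| ≤ |(j : ℝ) ^ 2 + s * j + k| * |d j| + |e j| := by
      rw [← abs_of_pos hpos, ← abs_mul, h j, ← abs_mul]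
      exact abs_add_le _ _
    rw [div_lt_iff₀ hpos] at hj1
    have hd2 : ((j : ℝ) + 1) * (j + c) * |d (j + 1)| ≤
        ((j : ℝ) + 1) * (j + c) * (ρ⁻¹ * |d j| + |e j|) := by
      have := mul_le_mul_of_nonneg_right hj1.le (abs_nonneg (d j))
      have := mul_le_mul_of_nonneg_right hge (abs_nonneg (e j))
      linarith
    have hd3 := le_of_mul_le_mul_left hd2 hpos
    calc |d (j + 1)| * ρ ^ (j + 1) ≤ (ρ⁻¹ * |d j| + |e j|) * ρ ^ (j + 1) := by gcongr
      _ = |d j| * ρ ^ j + ρ * (|e j| * ρ ^ j) := by rw [pow_succ]; field_simp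
      _ ≤ _ := by
        have : 0 ≤ |e j| * ρ ^ j := by positivity
        nlinarith
  have hb := bounded_of_step (D := fun j => |d j| * ρ ^ j) hs (fun j => by positivity) step
  have hg : Summable fun j : ℕ => (r / ρ) ^ j :=
    summable_geometric_of_lt_one (div_nonneg hr hρ.le) ((div_lt_one hρ).2 h1)
  refine summable_of_isBigO_nat hg ?_
  refine IsBigO.of_bound (|d N| * ρ ^ N + ∑' i, |e i| * ρ ^ i) ?_
  filter_upwards [eventually_ge_atTop N] with j hj
  have := hb j hj
  rw [Real.norm_eq_abs, Real.norm_eq_abs, abs_of_nonneg (by positivity : 0 ≤ |d j| * r ^ j),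
    abs_of_nonneg (by positivity : 0 ≤ (r / ρ) ^ j), div_pow]
  calc |d j| * r ^ j = (|d j| * ρ ^ j) * (r ^ j / ρ ^ j) := by field_simp
    _ ≤ _ := by gcongr

/-- The coefficients determined by a first order inhomogeneous recurrence of Gauss type. -/
noncomputable def gaussCoeff (c s k : ℝ) (e : ℕ → ℝ) (d0 : ℝ) : ℕ → ℝ
  | 0 => d0
  | j + 1 => (((j : ℝ) ^ 2 + s * j + k) * gaussCoeff c s k e d0 j + e j) / (((j : ℝ) + 1) * (j + c))

theorem gaussCoeff_succ {c : ℝ} (hc : 0 < c) (s k : ℝ) (e : ℕ → ℝ) (d0 : ℝ) (j : ℕ) :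
    ((j : ℝ) + 1) * (j + c) * gaussCoeff c s k e d0 (j + 1) =
      ((j : ℝ) ^ 2 + s * j + k) * gaussCoeff c s k e d0 j + e j := by
  rw [gaussCoeff]
  have : 0 < ((j : ℝ) + 1) * (j + c) := by positivity
  field_simp

/-- Positive coefficients keep the solutions and their derivatives from vanishing on [0,1), which
legitimizes every division in the reductions of order. -/
theorem gaussCoeff_pos {c s k : ℝ} (hc : 0 < c) (hs : 0 ≤ s) (hk : 0 < k) (j : ℕ) :
    0 < gaussCoeff c s k 0 1 j := by
  induction j with
  | zero => simp [gaussCoeff]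
  | succ j ih =>
    rw [gaussCoeff]
    simp only [Pi.zero_apply, add_zero]
    have : 0 < (j : ℝ) ^ 2 + s * j + k := by positivity
    positivity

theorem AbsSeries.zero {R : ℝ} : AbsSeries R 0 := fun r _ _ => by simp

theorem ps_gauss_ode {c s k : ℝ} (hc : 0 < c) {e : ℕ → ℝ} (he : AbsSeries 1 e) (d0 : ℝ) {x : ℝ}
    (hx : |x| < 1) {d : ℕ → ℝ} (hd : d = gaussCoeff c s k e d0) :
    x * (1 - x) * ps (derivCoeff (derivCoeff d)) x
      + (c - (s + 1) * x) * ps (derivCoeff d) x - k * ps d x = ps e x := by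
  have hrec := gaussCoeff_succ hc s k e d0
  rw [← hd] at hrec
  have h0 : AbsSeries 1 d := AbsSeries.of_recurrence hc he hrec
  have s0 := h0.hasSum hx
  have s1 := h0.deriv.hasSum hx
  have s2 := h0.deriv.deriv.hasSum hx
  have t1 : HasSum (fun j : ℕ => ((j : ℝ) * d j) * x ^ j) (x * ps (derivCoeff d) x) :=
    HasSum.mul_shift (f := fun j : ℕ => (j : ℝ) * d j) (by simp)
      (s1.congr_fun fun j => by simp [derivCoeff])
  have t2 : HasSum (fun j : ℕ => ((j : ℝ) * ((j : ℝ) + 1) * d (j + 1)) * x ^ j)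
      (x * ps (derivCoeff (derivCoeff d)) x) :=
    HasSum.mul_shift (f := fun j : ℕ => (j : ℝ) * ((j : ℝ) + 1) * d (j + 1)) (by simp)
      (s2.congr_fun fun j => by simp only [derivCoeff]; push_cast; ring)
  have t3 : HasSum (fun j : ℕ => ((j : ℝ) * ((j : ℝ) - 1) * d j) * x ^ j)
      (x * (x * ps (derivCoeff (derivCoeff d)) x)) :=
    HasSum.mul_shift (f := fun j : ℕ => (j : ℝ) * ((j : ℝ) - 1) * d j) (by simp)
      (t2.congr_fun fun j => by push_cast; ring)
  have tot := (((t2.sub t3).add (s1.mul_left c)).sub (t1.mul_left (s + 1))).sub (s0.mul_left k)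
  have := (he.hasSum hx).unique (tot.congr_fun fun j => ?_)
  · rw [this]; ring
  · have := hrec j
    simp only [derivCoeff]
    linear_combination (-x ^ j) * this

theorem ps_zero_arg (a : ℕ → ℝ) : ps a 0 = a 0 := by
  rw [ps, tsum_eq_single 0 (fun j hj => by simp [hj])]; simp

theorem ps_pos {a : ℕ → ℝ} (h : AbsSeries 1 a) (ha : ∀ j, 0 < a j) {x : ℝ} (h0 : 0 ≤ x) (h1 : x < 1) :
    0 < ps a x := by
  have hs := h.summable (x := x) (by rwa [abs_of_nonneg h0])
  exact hs.tsum_pos (fun j => mul_nonneg (ha j).le (pow_nonneg h0 j)) 0 (by simpa using ha 0)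

/-! ### Frobenius expansions at 0 by repeated integration. -/

/-- Division of the `j`-th Taylor coefficient by `γ + j`: solvability at `0` of `x F' + γ F = E`,
up to a resonant monomial. -/
theorem exists_euler {E : ℝ → ℝ} (hE : AnalyticAt ℝ E 0) (γ : ℝ) :
    ∃ F : ℝ → ℝ, AnalyticAt ℝ F 0 ∧ ∃ F' : ℝ → ℝ, AnalyticAt ℝ F' 0 ∧ ∃ e : ℕ → ℝ,
      e 0 = E 0 ∧ (γ ≠ 0 → γ * F 0 = E 0) ∧
      ((∀ j : ℕ, γ + j ≠ 0) → ∀ᶠ x in 𝓝 (0 : ℝ), HasDerivAt F (F' x) x ∧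
        x * F' x + γ * F x = E x) ∧
      (∀ m : ℕ, γ = -m → ∀ᶠ x in 𝓝 (0 : ℝ), HasDerivAt F (F' x) x ∧
        x * F' x + γ * F x = E x - e m * x ^ m) := by
  obtain ⟨R, hR, a, ha, hEa⟩ := exists_ps_of_analyticAt hE
  have hE0 : E 0 = a 0 := by rw [hEa 0 (by simpa using hR), ps_zero_arg]
  -- At a resonance γ = -m the division by zero returns 0, so `b m` vanishes and exactly the
  -- monomial `e m * x ^ m` is left unsolved.
  set b : ℕ → ℝ := fun j => a j / (γ + j) with hb
  have hball : ∀ᶠ x in 𝓝 (0 : ℝ), |x| < R := by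
    have : Tendsto (fun x : ℝ => |x|) (𝓝 0) (𝓝 0) := by simpa using (continuous_abs.tendsto (0 : ℝ))
    exact this.eventually_lt_const hR
  have hbs : AbsSeries R b := by
    intro r hr hrR
    refine summable_of_isBigO_nat (ha r hr hrR) ?_
    refine IsBigO.of_bound 1 ?_
    filter_upwards [eventually_ge_atTop ⌈1 + |γ|⌉₊] with j hj
    have hj' : 1 + |γ| ≤ (j : ℝ) := (Nat.le_ceil _).trans (by exact_mod_cast hj)
    have h1 : 1 ≤ |γ + j| := by
      have := neg_abs_le γ
      rw [abs_of_nonneg] <;> linarith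
    rw [Real.norm_eq_abs, Real.norm_eq_abs, one_mul, abs_mul, abs_mul, abs_abs, abs_abs, hb]
    simp only
    rw [abs_div]
    gcongr
    exact div_le_self (abs_nonneg _) h1
  have key : ∀ x, |x| < R → HasSum (fun j : ℕ => (((j : ℝ) + γ) * b j) * x ^ j)
      (x * ps (derivCoeff b) x + γ * ps b x) := by
    intro x hx
    have t1 : HasSum (fun j : ℕ => ((j : ℝ) * b j) * x ^ j) (x * ps (derivCoeff b) x) :=
      HasSum.mul_shift (f := fun j : ℕ => (j : ℝ) * b j) (by simp)
        ((hbs.deriv.hasSum hx).congr_fun fun j => by simp [derivCoeff])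
    refine (t1.add ((hbs.hasSum hx).mul_left γ)).congr_fun fun j => ?_
    ring
  refine ⟨ps b, ps_analyticAt hbs (by simpa using hR), _,
    ps_analyticAt hbs.deriv (by simpa using hR), a, ?_, ?_, ?_, ?_⟩
  · exact hE0.symm
  · intro hγ
    rw [ps_zero_arg, hb, hE0]
    simp only [CharP.cast_eq_zero, add_zero]
    field_simp
  · intro hj
    filter_upwards [hball] with x hx
    refine ⟨ps_hasDerivAt hbs hx, ?_⟩
    rw [hEa x hx]
    refine (key x hx).unique ((ha.hasSum hx).congr_fun fun j => ?_)
    have := hj j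
    rw [hb]; simp only; field_simp; ring
  · intro m hm
    filter_upwards [hball] with x hx
    refine ⟨ps_hasDerivAt hbs hx, ?_⟩
    rw [hEa x hx]
    have hs : HasSum (fun j => if j = m then a m * x ^ m else 0) (a m * x ^ m) := by
      simpa using hasSum_ite_eq m (a m * x ^ m)
    refine (key x hx).unique (((ha.hasSum hx).sub hs).congr_fun fun j => ?_)
    by_cases hjm : j = m
    · subst hjm; simp [hm]
    · have : γ + j ≠ 0 := by
        rw [hm]; intro h; apply hjm
        have : (j : ℝ) = m := by linarith
        exact_mod_cast this
      rw [if_neg hjm, hb]; simp only; field_simp; ring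

/-- The logarithm for even `n`, and `1` for odd `n`. -/
noncomputable def parityLog (n : ℕ) (x : ℝ) : ℝ := if Even n then Real.log x else 1

theorem exists_const_of_deriv_eq {f g f' : ℝ → ℝ}
    (hf : ∀ᶠ x in 𝓝[>] (0 : ℝ), HasDerivAt f (f' x) x)
    (hg : ∀ᶠ x in 𝓝[>] (0 : ℝ), HasDerivAt g (f' x) x) :
    ∃ D, ∀ᶠ x in 𝓝[>] (0 : ℝ), f x = g x + D := by
  obtain ⟨δ, hδ, h⟩ := mem_nhdsGT_iff_exists_Ioo_subset.1 (hf.and hg)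
  have hδ' : (0 : ℝ) < δ := hδ
  have hd : ∀ x ∈ Set.Ioo 0 δ, HasDerivAt (fun x => f x - g x) 0 x := fun x hx =>
    ((h hx).1.sub (h hx).2).congr_deriv (sub_self _)
  refine ⟨f (δ / 2) - g (δ / 2), ?_⟩
  filter_upwards [Ioo_mem_nhdsGT hδ'] with x hx
  have := isOpen_Ioo.is_const_of_deriv_eq_zero (convex_Ioo 0 δ).isPreconnected
    (fun x hx => (hd x hx).differentiableAt.differentiableWithinAt) (fun x hx => (hd x hx).deriv)
    hx (show δ / 2 ∈ Set.Ioo 0 δ from ⟨by linarith, by linarith⟩)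
  linarith

/-- The ansatz x^γ F turns the integration into the Euler equation x F' + γ F = E. A resonance γ =
-m leaves a multiple of 1/x, which integrates to the logarithm. -/
theorem exists_primitive_rpow {E : ℝ → ℝ} (hE : AnalyticAt ℝ E 0) (γ : ℝ) :
    ∃ F : ℝ → ℝ, AnalyticAt ℝ F 0 ∧ ∃ e : ℝ, (e ≠ 0 → ∃ m : ℕ, γ = -m) ∧
      (γ ≠ 0 → γ * F 0 = E 0) ∧ (γ = 0 → e = E 0) ∧
      ∀ᶠ x in 𝓝[>] (0 : ℝ),
        HasDerivAt (fun x => x ^ γ * F x + e * Real.log x) (x ^ (γ - 1) * E x) x := by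
  obtain ⟨F, hF, F', -, e, he0, hF0, h1, h2⟩ := exists_euler hE γ
  by_cases hm : ∃ m : ℕ, γ = -m
  · obtain ⟨m, hm⟩ := hm
    refine ⟨F, hF, e m, fun _ => ⟨m, hm⟩, hF0, fun h => ?_, ?_⟩
    · have : m = 0 := by rw [hm] at h; simpa using h
      rw [this, he0]
    · filter_upwards [(h2 m hm).filter_mono nhdsWithin_le_nhds, self_mem_nhdsWithin] with x hx hx0
      have hx0' : 0 < x := hx0
      refine (((Real.hasDerivAt_rpow_const (p := γ) (Or.inl hx0'.ne')).mul hx.1).add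
        ((Real.hasDerivAt_log hx0'.ne').const_mul (e m))).congr_deriv ?_
      have e1 : x ^ γ = x ^ (γ - 1) * x := by
        rw [← Real.rpow_add_one hx0'.ne']; ring_nf
      have e2 : x⁻¹ = x ^ (γ - 1) * x ^ m := by
        rw [← Real.rpow_natCast, ← Real.rpow_add hx0', hm, ← Real.rpow_neg_one]; ring_nf
      rw [e1, e2]
      linear_combination x ^ (γ - 1) * hx.2
  · push Not at hm
    refine ⟨F, hF, 0, fun h => absurd rfl h, hF0, fun h => absurd h (by simpa using hm 0), ?_⟩
    filter_upwards [(h1 fun j hj => hm j (by linarith)).filter_mono nhdsWithin_le_nhds,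
      self_mem_nhdsWithin] with x hx hx0
    have hx0' : 0 < x := hx0
    simp only [zero_mul, add_zero]
    refine ((Real.hasDerivAt_rpow_const (p := γ) (Or.inl hx0'.ne')).mul hx.1).congr_deriv ?_
    have e1 : x ^ γ = x ^ (γ - 1) * x := by
      rw [← Real.rpow_add_one hx0'.ne']; ring_nf
    rw [e1]
    linear_combination x ^ (γ - 1) * hx.2

theorem exists_primitive_rpow_pos {E : ℝ → ℝ} (hE : AnalyticAt ℝ E 0) {γ : ℝ} (hγ : 0 < γ) :
    ∃ F : ℝ → ℝ, AnalyticAt ℝ F 0 ∧ γ * F 0 = E 0 ∧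
      ∀ᶠ x in 𝓝[>] (0 : ℝ), HasDerivAt (fun x => x ^ γ * F x) (x ^ (γ - 1) * E x) x := by
  obtain ⟨F, hF, e, he, h0, -, h⟩ := exists_primitive_rpow hE γ
  have : e = 0 := by
    by_contra hne
    obtain ⟨m, hm⟩ := he hne
    have : (0 : ℝ) ≤ m := m.cast_nonneg
    linarith
  subst this
  exact ⟨F, hF, h0 hγ.ne', by simpa using h⟩

/-- For even n this is integration by parts: differentiating the logarithm leaves x^(γ-1) F, which
has a primitive of the same kind. Since γ > 0 there is no resonance. -/
theorem exists_primitive_parityLog (n : ℕ) {E : ℝ → ℝ} (hE : AnalyticAt ℝ E 0) {γ : ℝ}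
    (hγ : 0 < γ) :
    ∃ F H : ℝ → ℝ, AnalyticAt ℝ F 0 ∧ AnalyticAt ℝ H 0 ∧
      ∀ᶠ x in 𝓝[>] (0 : ℝ), HasDerivAt (fun x => x ^ γ * (F x * parityLog n x + H x))
        (x ^ (γ - 1) * (E x * parityLog n x)) x := by
  obtain ⟨F, hF, -, h⟩ := exists_primitive_rpow_pos hE hγ
  by_cases hn : Even n
  · obtain ⟨H, hH, -, h'⟩ := exists_primitive_rpow_pos hF hγ
    refine ⟨F, fun x => -H x, hF, hH.neg, ?_⟩
    filter_upwards [h, h', self_mem_nhdsWithin] with x hx hx' hx0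
    have hx0' : 0 < x := hx0
    simp only [parityLog, hn, if_true]
    refine (((hx.mul (Real.hasDerivAt_log hx0'.ne')).sub hx').congr_deriv ?_).congr_of_eventuallyEq
      (Eventually.of_forall fun y => ?_)
    · have e1 : x ^ γ = x ^ (γ - 1) * x := by
        rw [← Real.rpow_add_one hx0'.ne']; ring_nf
      rw [e1]; field_simp; ring
    · simp only [Pi.mul_apply, Pi.sub_apply]; ring
  · refine ⟨F, 0, hF, analyticAt_const, ?_⟩
    simpa [parityLog, hn] using h

/-- Analytic contributions must fit the two-term normal form. When -β is a natural number m, as for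
even n, X is x^β times the analytic function x^m X. For odd n the factor `parityLog` is 1 and X
itself goes into B. -/
theorem exists_absorb (n : ℕ) {β : ℝ} (hβ : Even n → ∃ m : ℕ, β = -m) {X : ℝ → ℝ}
    (hX : AnalyticAt ℝ X 0) :
    ∃ A B : ℝ → ℝ, AnalyticAt ℝ A 0 ∧ AnalyticAt ℝ B 0 ∧ (β ≠ 0 → A 0 = 0) ∧
      (Even n → B 0 = 0) ∧ ∀ x : ℝ, 0 < x → X x = x ^ β * A x + B x * parityLog n x := by
  by_cases hn : Even n
  · obtain ⟨m, hm⟩ := hβ hn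
    refine ⟨fun x => x ^ m * X x, 0, (analyticAt_id.pow m).mul hX, analyticAt_const, ?_,
      fun _ => rfl, ?_⟩
    · intro hb
      have : m ≠ 0 := by rintro rfl; simp [hm] at hb
      simp [this]
    · intro x hx
      have : x ^ β * x ^ m = 1 := by
        rw [← Real.rpow_natCast, ← Real.rpow_add hx, hm]; simp
      simp only [Pi.zero_apply, zero_mul, add_zero]
      rw [← mul_assoc, this, one_mul]
  · refine ⟨0, X, analyticAt_const, hX, fun _ => rfl, fun h => absurd h hn, ?_⟩
    intro x _
    simp [parityLog, hn]

theorem even_half {n : ℕ} (hn : 2 ≤ n) (h : Even n) : ∃ m : ℕ, (n : ℝ) / 2 = m + 1 := by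
  obtain ⟨r, hr⟩ := h
  refine ⟨r - 1, ?_⟩
  have : 1 ≤ r := by omega
  rw [hr]; push_cast [Nat.cast_sub this]; ring

theorem even_of_half_eq {n : ℕ} {i : ℤ} (h : (n : ℝ) / 2 = i) : Even n := by
  have h' : (n : ℤ) = 2 * i := by
    have : (n : ℝ) = 2 * i := by linarith
    exact_mod_cast this
  have : Even (n : ℤ) := ⟨i, by omega⟩
  exact_mod_cast this

theorem mul_log_eq_parityLog {n : ℕ} {e : ℝ} (h : e ≠ 0 → Even n) (x : ℝ) :
    e * Real.log x = e * (if Even n then 1 else 0) * parityLog n x := by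
  by_cases he : e = 0
  · simp [he]
  · simp [parityLog, h he]

/-- The form at `0` of the solutions of a second order equation with exponents `0`, `-n/2`. -/
theorem frobenius_second_order {n : ℕ} (hn : 2 ≤ n) {ω g W Q : ℝ → ℝ} {c : ℝ}
    (hω : AnalyticAt ℝ ω 0) (hω0 : ω 0 = 1) (hg : AnalyticAt ℝ g 0) (hg0 : g 0 = 1)
    (hQ : ∀ᶠ x in 𝓝[>] (0 : ℝ), HasDerivAt Q (c / (x ^ ((n : ℝ) / 2 + 1) * ω x * g x ^ 2)) x)
    (hW : ∀ᶠ x in 𝓝[>] (0 : ℝ), W x = g x * Q x) :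
    ∃ A B : ℝ → ℝ, AnalyticAt ℝ A 0 ∧ AnalyticAt ℝ B 0 ∧ A 0 = -c / ((n : ℝ) / 2) ∧
      ∀ᶠ x in 𝓝[>] (0 : ℝ), W x = x ^ (-((n : ℝ) / 2)) * A x + B x * parityLog n x := by
  have hn' : (2 : ℝ) ≤ n := by exact_mod_cast hn
  have hα : -((n : ℝ) / 2) ≠ 0 := by linarith
  have hE : AnalyticAt ℝ (fun x => c / (ω x * g x ^ 2)) 0 :=
    analyticAt_const.div (hω.mul (hg.pow 2)) (by simp [hω0, hg0])
  obtain ⟨F, hF, e, he, hF0, -, h⟩ := exists_primitive_rpow hE (-((n : ℝ) / 2))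
  have hQ' : ∀ᶠ x in 𝓝[>] (0 : ℝ),
      HasDerivAt Q (x ^ (-((n : ℝ) / 2) - 1) * (c / (ω x * g x ^ 2))) x := by
    filter_upwards [hQ, self_mem_nhdsWithin] with x hx hx0
    have hx0' : 0 < x := hx0
    refine hx.congr_deriv ?_
    rw [show -((n : ℝ) / 2) - 1 = -((n : ℝ) / 2 + 1) by ring, Real.rpow_neg hx0'.le, div_eq_mul_inv,
      div_eq_mul_inv, mul_assoc (x ^ _), mul_inv]
    ring
  obtain ⟨D, hD⟩ := exists_const_of_deriv_eq hQ' h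
  have heven : Even n → ∃ m : ℕ, -((n : ℝ) / 2) = -m := fun h => by
    obtain ⟨m, hm⟩ := even_half hn h
    exact ⟨m + 1, by rw [hm]; push_cast; ring⟩
  obtain ⟨A₁, B₁, hA₁, hB₁, hA₁0, -, hX⟩ := exists_absorb n heven
    (analyticAt_const (x := (0 : ℝ)) (v := D))
  have he' : e ≠ 0 → Even n := fun h => by
    obtain ⟨m, hm⟩ := he h
    exact even_of_half_eq (i := m) (by push_cast; linarith)
  refine ⟨fun x => g x * (F x + A₁ x),
    fun x => g x * (e * (if Even n then 1 else 0) + B₁ x), hg.mul (hF.add hA₁),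
    hg.mul (analyticAt_const.add hB₁), ?_, ?_⟩
  · have := hF0 hα
    simp only [hω0, hg0, one_pow, mul_one, div_one] at this
    simp only [hg0, hA₁0 hα, add_zero, one_mul]
    rw [eq_div_iff (by linarith)]
    linarith
  · filter_upwards [hD, hW, self_mem_nhdsWithin] with x hx hx1 hx0
    rw [hx1, hx, mul_log_eq_parityLog he' x]
    linear_combination g x * hX x hx0

theorem tendsto_rpow_mul_parityLog (n : ℕ) {γ : ℝ} (hγ : 0 < γ) :
    Tendsto (fun x => x ^ γ * parityLog n x) (𝓝[>] (0 : ℝ)) (𝓝 0) := by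
  by_cases hn : Even n
  · simp only [parityLog, hn, if_true]
    simpa [mul_comm] using tendsto_log_mul_rpow_nhdsGT_zero hγ
  · simp only [parityLog, hn, if_false, mul_one]
    have : ContinuousAt (fun x : ℝ => x ^ γ) 0 := Real.continuousAt_rpow_const _ _ (Or.inr hγ.le)
    have h := this.tendsto
    simp only [Real.zero_rpow hγ.ne'] at h
    exact h.mono_left nhdsWithin_le_nhds

/-- The form at `0` of the primitive of `x^(n/2) κ W`. -/
theorem frobenius_integral {n : ℕ} (hn : 2 ≤ n) {κ W J A B : ℝ → ℝ}
    (hκ : AnalyticAt ℝ κ 0) (hA : AnalyticAt ℝ A 0) (hB : AnalyticAt ℝ B 0)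
    (hW : ∀ᶠ x in 𝓝[>] (0 : ℝ), W x = x ^ (-((n : ℝ) / 2)) * A x + B x * parityLog n x)
    (hJ : ∀ᶠ x in 𝓝[>] (0 : ℝ), HasDerivAt J (x ^ ((n : ℝ) / 2) * κ x * W x) x) :
    ∃ F G H : ℝ → ℝ, AnalyticAt ℝ F 0 ∧ AnalyticAt ℝ G 0 ∧ AnalyticAt ℝ H 0 ∧
      F 0 = κ 0 * A 0 ∧ ∃ D : ℝ, Tendsto J (𝓝[>] 0) (𝓝 D) ∧
      ∀ᶠ x in 𝓝[>] (0 : ℝ),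
        J x = x * F x + x ^ ((n : ℝ) / 2 + 1) * (G x * parityLog n x + H x) + D := by
  have hn' : (2 : ℝ) ≤ n := by exact_mod_cast hn
  obtain ⟨F, hF, hF0, h1⟩ := exists_primitive_rpow_pos (hκ.mul hA) one_pos
  obtain ⟨G, H, hG, hH, h2⟩ := exists_primitive_parityLog n (hκ.mul hB)
    (γ := (n : ℝ) / 2 + 1) (by linarith)
  have h3 : ∀ᶠ x in 𝓝[>] (0 : ℝ), HasDerivAt
      (fun x => x * F x + x ^ ((n : ℝ) / 2 + 1) * (G x * parityLog n x + H x))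
      (x ^ ((n : ℝ) / 2) * κ x * W x) x := by
    filter_upwards [h1, h2, hW, self_mem_nhdsWithin] with x hx1 hx2 hx3 hx0
    have hx0' : 0 < x := hx0
    simp only [Real.rpow_one] at hx1
    refine (hx1.add hx2).congr_deriv ?_
    have e1 : x ^ ((n : ℝ) / 2) * x ^ (-((n : ℝ) / 2)) = 1 := by
      rw [← Real.rpow_add hx0']; simp
    rw [hx3]
    simp only [sub_self, Real.rpow_zero, add_sub_cancel_right, Pi.mul_apply]
    linear_combination (-κ x * A x) * e1
  obtain ⟨D, hD⟩ := exists_const_of_deriv_eq hJ h3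
  refine ⟨F, G, H, hF, hG, hH, by simpa using hF0, D, ?_, hD⟩
  have t0 : Tendsto (fun x : ℝ => x) (𝓝[>] 0) (𝓝 0) := tendsto_nhdsWithin_of_tendsto_nhds tendsto_id
  have tr : Tendsto (fun x : ℝ => x ^ ((n : ℝ) / 2 + 1)) (𝓝[>] 0) (𝓝 0) := by
    have := tendsto_rpow_mul_parityLog 1 (γ := (n : ℝ) / 2 + 1) (by linarith)
    simpa [parityLog] using this
  have tF := hF.continuousAt.tendsto.mono_left (nhdsWithin_le_nhds (s := Set.Ioi (0 : ℝ)))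
  have tG := hG.continuousAt.tendsto.mono_left (nhdsWithin_le_nhds (s := Set.Ioi (0 : ℝ)))
  have tH := hH.continuousAt.tendsto.mono_left (nhdsWithin_le_nhds (s := Set.Ioi (0 : ℝ)))
  have tl := tendsto_rpow_mul_parityLog n (γ := (n : ℝ) / 2 + 1) (by linarith)
  have := (((t0.mul tF).add ((tl.mul tG).add (tr.mul tH)))).add_const D
  simp only [zero_mul, add_zero, zero_add] at this
  refine this.congr' ?_
  filter_upwards [hD] with x hx
  rw [hx]; ring

/-- The form at `0` of the solutions of the fourth order equation without the exponent `-n/2`. -/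
theorem frobenius_fourth_order {n : ℕ} (hn : 2 ≤ n) {ω u f q J F G H : ℝ → ℝ}
    (hω : AnalyticAt ℝ ω 0) (hω0 : ω 0 = 1) (hu : AnalyticAt ℝ u 0) (hu0 : u 0 = 1)
    (hF : AnalyticAt ℝ F 0) (hG : AnalyticAt ℝ G 0) (hH : AnalyticAt ℝ H 0)
    (hJ : ∀ᶠ x in 𝓝[>] (0 : ℝ),
        J x = x * F x + x ^ ((n : ℝ) / 2 + 1) * (G x * parityLog n x + H x))
    (hq : ∀ᶠ x in 𝓝[>] (0 : ℝ), HasDerivAt q (J x / (x ^ ((n : ℝ) / 2 + 1) * ω x * u x ^ 2)) x)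
    (hf : ∀ᶠ x in 𝓝[>] (0 : ℝ), f x = u x * q x) :
    ∃ a b : ℝ → ℝ, AnalyticAt ℝ a 0 ∧ AnalyticAt ℝ b 0 ∧
      (n ≠ 2 → a 0 = F 0 / (1 - (n : ℝ) / 2)) ∧ (n = 2 → b 0 = F 0) ∧
      ∀ᶠ x in 𝓝[>] (0 : ℝ), f x = x ^ (1 - (n : ℝ) / 2) * a x + b x * parityLog n x := by
  have hn' : (2 : ℝ) ≤ n := by exact_mod_cast hn
  have hne : ω 0 * u 0 ^ 2 ≠ 0 := by simp [hω0, hu0]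
  have hωu := hω.mul (hu.pow 2)
  obtain ⟨F₁, hF₁, e, he, hF₁0, hee, h1⟩ :=
    exists_primitive_rpow (hF.div hωu hne) (1 - (n : ℝ) / 2)
  obtain ⟨G₁, H₁, hG₁, hH₁, h2⟩ := exists_primitive_parityLog n (hG.div hωu hne) one_pos
  obtain ⟨F₂, hF₂, -, h3⟩ := exists_primitive_rpow_pos (hH.div hωu hne) one_pos
  have h4 : ∀ᶠ x in 𝓝[>] (0 : ℝ), HasDerivAt
      (fun x => x ^ (1 - (n : ℝ) / 2) * F₁ x + e * Real.log x
        + x ^ (1 : ℝ) * (G₁ x * parityLog n x + H₁ x) + x ^ (1 : ℝ) * F₂ x)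
      (J x / (x ^ ((n : ℝ) / 2 + 1) * ω x * u x ^ 2)) x := by
    have hnz : ∀ᶠ x in 𝓝[>] (0 : ℝ), ω x * u x ^ 2 ≠ 0 :=
      (hωu.continuousAt.eventually_ne hne).filter_mono nhdsWithin_le_nhds
    filter_upwards [h1, h2, h3, hJ, hnz, self_mem_nhdsWithin] with x hx1 hx2 hx3 hx4 hx5 hx0
    have hx0' : 0 < x := hx0
    refine ((hx1.add hx2).add hx3).congr_deriv ?_
    rw [hx4]
    simp only [sub_self, Real.rpow_zero, Pi.div_apply, Pi.mul_apply, Pi.pow_apply]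
    have e1 : x ^ (1 - (n : ℝ) / 2 - 1) = x / x ^ ((n : ℝ) / 2 + 1) := by
      rw [eq_div_iff (Real.rpow_pos_of_pos hx0' _).ne', ← Real.rpow_add hx0']
      ring_nf; simp
    rw [e1]
    have := (Real.rpow_pos_of_pos hx0' ((n : ℝ) / 2 + 1)).ne'
    have h5 : ω x ≠ 0 := left_ne_zero_of_mul hx5
    have h6 : u x ≠ 0 := fun h => hx5 (by simp [h])
    field_simp
    ring
  obtain ⟨D, hD⟩ := exists_const_of_deriv_eq hq h4
  have heven : Even n → ∃ m : ℕ, 1 - (n : ℝ) / 2 = -m := fun h => by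
    obtain ⟨m, hm⟩ := even_half hn h
    exact ⟨m, by rw [hm]; ring⟩
  obtain ⟨A₁, B₁, hA₁, hB₁, hA₁0, hB₁0, hX⟩ := exists_absorb n heven
    (X := fun x => x * (H₁ x + F₂ x) + D)
    ((analyticAt_id.mul (hH₁.add hF₂)).add analyticAt_const)
  have he' : e ≠ 0 → Even n := fun h => by
    obtain ⟨m, hm⟩ := he h
    exact even_of_half_eq (i := m + 1) (by push_cast; linarith)
  refine ⟨fun x => u x * (F₁ x + A₁ x),
    fun x => u x * (e * (if Even n then 1 else 0) + x * G₁ x + B₁ x), hu.mul (hF₁.add hA₁),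
    hu.mul ((analyticAt_const.add (analyticAt_id.mul hG₁)).add hB₁), ?_, ?_, ?_⟩
  · intro h2
    have h2' : (n : ℝ) ≠ 2 := by exact_mod_cast h2
    have hne2 : 1 - (n : ℝ) / 2 ≠ 0 := fun h => h2' (by linarith)
    have := hF₁0 hne2
    simp only [Pi.div_apply, Pi.mul_apply, Pi.pow_apply, hω0, hu0, one_pow, mul_one, div_one] at this
    simp only [hu0, hA₁0 hne2, add_zero, one_mul]
    rw [eq_div_iff hne2]
    linarith
  · intro h2
    have hev : Even n := by rw [h2]; exact even_two
    have := hee (by rw [h2]; norm_num)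
    simp only [Pi.div_apply, Pi.mul_apply, Pi.pow_apply, hω0, hu0, one_pow, mul_one, div_one] at this
    simp [hu0, hB₁0 hev, hev, this]
  · filter_upwards [hD, hf, self_mem_nhdsWithin] with x hx hx1 hx0
    have := hX x hx0
    rw [hx1, hx, mul_log_eq_parityLog he' x, Real.rpow_one]
    linear_combination u x * this

/-! ### The asymptotic scales at 0. -/

/-- The singularity of the Green's function at `0`, normalized. -/
noncomputable def singLead (n : ℕ) (x : ℝ) : ℝ :=
  if n = 2 then -Real.log x else x ^ (1 - (n : ℝ) / 2)

theorem isBigO_rpow_rpow_nhdsGT {s t : ℝ} (h : t ≤ s) :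
    (fun x : ℝ => x ^ s) =O[𝓝[>] 0] fun x => x ^ t := by
  refine IsBigO.of_bound 1 ?_
  filter_upwards [Ioo_mem_nhdsGT (zero_lt_one' ℝ)] with x hx
  rw [Real.norm_of_nonneg (Real.rpow_nonneg hx.1.le _), one_mul,
    Real.norm_of_nonneg (Real.rpow_nonneg hx.1.le _)]
  exact Real.rpow_le_rpow_of_exponent_ge hx.1 hx.2.le h

theorem isBigO_one_log_nhdsGT : (fun _ : ℝ => (1 : ℝ)) =O[𝓝[>] 0] Real.log :=
  ((isLittleO_const_left_of_ne one_ne_zero).2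
    (tendsto_abs_atBot_atTop.comp Real.tendsto_log_nhdsGT_zero)).isBigO

theorem rpow_isBigO_greenRemainder {n : ℕ} (hn : 2 ≤ n) :
    (fun x : ℝ => x ^ (2 - (n : ℝ) / 2)) =O[𝓝[>] 0] greenRemainder n := by
  by_cases h4 : n = 4
  · subst h4
    have : greenRemainder 4 = Real.log := by ext x; simp [greenRemainder]
    rw [this]
    refine isBigO_one_log_nhdsGT.congr_left fun x => ?_
    norm_num
  · refine (isBigO_rpow_rpow_nhdsGT (min_le_right 0 (2 - (n : ℝ) / 2))).congr' EventuallyEq.rfl ?_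
    filter_upwards [self_mem_nhdsWithin] with x hx
    rw [greenRemainder, if_neg h4, abs_of_pos hx]

theorem one_isBigO_greenRemainder (n : ℕ) :
    (fun _ : ℝ => (1 : ℝ)) =O[𝓝[>] 0] greenRemainder n := by
  by_cases h4 : n = 4
  · subst h4
    have : greenRemainder 4 = Real.log := by ext x; simp [greenRemainder]
    rw [this]
    exact isBigO_one_log_nhdsGT
  · refine (isBigO_rpow_rpow_nhdsGT (min_le_left 0 (2 - (n : ℝ) / 2))).congr' ?_ ?_
    · filter_upwards with x using Real.rpow_zero x
    filter_upwards [self_mem_nhdsWithin] with x hx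
    rw [greenRemainder, if_neg h4, abs_of_pos hx]

theorem parityLog_isBigO_greenRemainder {n : ℕ} (hn : 2 < n) :
    parityLog n =O[𝓝[>] 0] greenRemainder n := by
  by_cases he : Even n
  · have e1 : parityLog n = Real.log := by ext x; simp [parityLog, he]
    rw [e1]
    by_cases h4 : n = 4
    · subst h4
      have : greenRemainder 4 = Real.log := by ext x; simp [greenRemainder]
      rw [this]
    · have h5 : 4 < n := by
        obtain ⟨r, hr⟩ := he
        omega
      have h5' : (4 : ℝ) < n := by exact_mod_cast h5
      have := (isLittleO_log_rpow_nhdsGT_zero (r := 2 - (n : ℝ) / 2) (by linarith)).isBigO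
      exact this.trans (rpow_isBigO_greenRemainder hn.le)
  · have e1 : parityLog n = fun _ => 1 := by ext x; simp [parityLog, he]
    rw [e1]
    exact one_isBigO_greenRemainder n

/-- Removing the constant Taylor term of a (of b when n = 2) gains a factor x. This gives x^(2-n/2),
respectively the bounded x log x, and the other term of the expansion is already of remainder size.
-/
theorem sub_singLead_isBigO {n : ℕ} (hn : 2 ≤ n) {f a b : ℝ → ℝ} {C : ℝ} (ha : AnalyticAt ℝ a 0)
    (hb : AnalyticAt ℝ b 0) (ha0 : n ≠ 2 → a 0 = C) (hb0 : n = 2 → b 0 = -C)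
    (hf : ∀ᶠ x in 𝓝[>] (0 : ℝ), f x = x ^ (1 - (n : ℝ) / 2) * a x + b x * parityLog n x) :
    (fun x => f x - C * singLead n x) =O[𝓝[>] 0] greenRemainder n := by
  have hle : 𝓝[>] (0 : ℝ) ≤ 𝓝 0 := nhdsWithin_le_nhds
  have hbO : b =O[𝓝[>] 0] fun _ => (1 : ℝ) := (hb.continuousAt.tendsto.mono_left hle).isBigO_one ℝ
  have haO : a =O[𝓝[>] 0] fun _ => (1 : ℝ) := (ha.continuousAt.tendsto.mono_left hle).isBigO_one ℝ
  by_cases h2 : n = 2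
  · subst h2
    have h1 : (fun x => b x - b 0) =O[𝓝[>] 0] fun x : ℝ => x := by
      simpa using hb.differentiableAt.isBigO_sub.mono hle
    have h3 : (fun x : ℝ => x * parityLog 2 x) =O[𝓝[>] 0] fun _ => (1 : ℝ) := by
      have := (tendsto_rpow_mul_parityLog 2 one_pos).isBigO_one ℝ
      simpa using this
    have h4 : (fun x => (b x - b 0) * parityLog 2 x) =O[𝓝[>] 0] fun _ => (1 : ℝ) :=
      (h1.mul (isBigO_refl _ _)).trans h3
    refine ((haO.add h4).trans (one_isBigO_greenRemainder 2)).congr' ?_ EventuallyEq.rfl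
    filter_upwards [hf] with x hx
    rw [hx, hb0 rfl]
    simp [singLead, parityLog]
    ring
  · have h1 : (fun x => a x - a 0) =O[𝓝[>] 0] fun x : ℝ => x := by
      simpa using ha.differentiableAt.isBigO_sub.mono hle
    have h3 : (fun x => x ^ (1 - (n : ℝ) / 2) * (a x - a 0)) =O[𝓝[>] 0]
        greenRemainder n := by
      refine (((isBigO_refl _ _).mul h1).congr' EventuallyEq.rfl ?_).trans
        (rpow_isBigO_greenRemainder hn)
      filter_upwards [self_mem_nhdsWithin] with x hx
      have hx' : (0 : ℝ) < x := hx
      rw [← Real.rpow_add_one hx'.ne']; ring_nf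
    have h4 : (fun x => b x * parityLog n x) =O[𝓝[>] 0] greenRemainder n := by
      have := hbO.mul (parityLog_isBigO_greenRemainder (n := n) (by omega))
      simpa using this
    refine (h3.add h4).congr' ?_ EventuallyEq.rfl
    filter_upwards [hf] with x hx
    rw [hx, ha0 h2]
    simp [singLead, h2]
    ring

/-- The remainder is negligible with respect to the singularity. -/
theorem greenRemainder_isLittleO {n : ℕ} (hn : 2 ≤ n) :
    greenRemainder n =o[𝓝[>] 0] singLead n := by
  by_cases h2 : n = 2
  · subst h2
    have e1 : greenRemainder 2 = fun _ => 1 := by ext x; simp [greenRemainder]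
    have e2 : singLead 2 = fun x => -Real.log x := by ext x; simp [singLead]
    rw [e1, e2, isLittleO_neg_right, isLittleO_const_left_of_ne one_ne_zero]
    exact tendsto_abs_atBot_atTop.comp Real.tendsto_log_nhdsGT_zero
  · have hn3 : (3 : ℝ) ≤ n := by
      have : 3 ≤ n := by omega
      exact_mod_cast this
    have e2 : singLead n = fun x => x ^ (1 - (n : ℝ) / 2) := by ext x; simp [singLead, h2]
    rw [e2]
    by_cases h4 : n = 4
    · subst h4
      have : greenRemainder 4 = Real.log := by ext x; simp [greenRemainder]
      rw [this]
      exact isLittleO_log_rpow_nhdsGT_zero (by norm_num)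
    · have hlt : 1 - (n : ℝ) / 2 < min 0 (2 - (n : ℝ) / 2) := lt_min (by linarith) (by linarith)
      rw [isLittleO_iff_tendsto']
      · have := tendsto_rpow_mul_parityLog 1
          (γ := min 0 (2 - (n : ℝ) / 2) - (1 - (n : ℝ) / 2)) (by linarith)
        refine this.congr' ?_
        filter_upwards [self_mem_nhdsWithin] with x hx
        have hx' : (0 : ℝ) < x := hx
        rw [greenRemainder, if_neg h4, abs_of_pos hx', Real.rpow_sub hx']
        simp [parityLog]
      · filter_upwards [self_mem_nhdsWithin] with x hx h
        exact absurd h (Real.rpow_pos_of_pos hx _).ne'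

/-! ### Factorization of the fourth-order equation. -/

/-- The pair of second order equations which is equivalent to the fourth order equation, in the
variable `x = ε z` with `ε = 1` or `ε = -1`. -/
structure IsEulerSystemOn (ε c μ κ : ℝ) (U : Set ℝ) (f f₁ W W₁ : ℝ → ℝ) : Prop where
  d0 : ∀ x ∈ U, HasDerivAt f (f₁ x) x
  d1 : ∀ x ∈ U, HasDerivAt f₁
    ((ε * (μ * f x + (1 - 2 * ε * x) * W x) - c * (1 - 2 * ε * x) * f₁ x) / (x * (1 - ε * x))) x
  e0 : ∀ x ∈ U, HasDerivAt W (W₁ x) x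
  e1 : ∀ x ∈ U, HasDerivAt W₁
    ((ε * (κ * W x) - c * (1 - 2 * ε * x) * W₁ x) / (x * (1 - ε * x))) x

theorem contDiffOn_succ_of_hasDerivAt {U : Set ℝ} (hU : IsOpen U) {f f' : ℝ → ℝ} {m : ℕ}
    (h : ∀ x ∈ U, HasDerivAt f (f' x) x) (h' : ContDiffOn ℝ m f' U) :
    ContDiffOn ℝ (m + 1 : ℕ) f U := by
  push_cast
  rw [contDiffOn_succ_iff_deriv_of_isOpen hU]
  refine ⟨fun x hx => (h x hx).differentiableAt.differentiableWithinAt, by simp, ?_⟩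
  exact h'.congr fun x hx => (h x hx).deriv

/-- Bootstrapping: each derivative is a smooth expression in the four functions. The coefficients
are regular at 1/2, so solutions of the system are smooth across that point. -/
theorem IsEulerSystemOn.contDiffOn {ε c μ κ : ℝ} {U : Set ℝ} {f f₁ W W₁ : ℝ → ℝ}
    (h : IsEulerSystemOn ε c μ κ U f f₁ W W₁) (hU : IsOpen U)
    (hne : ∀ x ∈ U, x * (1 - ε * x) ≠ 0) (m : ℕ) :
    ContDiffOn ℝ m f U ∧ ContDiffOn ℝ m f₁ U ∧ ContDiffOn ℝ m W U ∧ ContDiffOn ℝ m W₁ U := by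
  induction m with
  | zero =>
    simp only [CharP.cast_eq_zero, contDiffOn_zero]
    exact ⟨fun x hx => (h.d0 x hx).continuousAt.continuousWithinAt,
      fun x hx => (h.d1 x hx).continuousAt.continuousWithinAt,
      fun x hx => (h.e0 x hx).continuousAt.continuousWithinAt,
      fun x hx => (h.e1 x hx).continuousAt.continuousWithinAt⟩
  | succ m ih =>
    obtain ⟨i0, i1, i2, i3⟩ := ih
    have hs : ContDiffOn ℝ m (fun x : ℝ => 1 - 2 * ε * x) U := by fun_prop
    have hq : ContDiffOn ℝ m (fun x : ℝ => x * (1 - ε * x)) U := by fun_prop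
    refine ⟨contDiffOn_succ_of_hasDerivAt hU h.d0 i1, contDiffOn_succ_of_hasDerivAt hU h.d1 ?_,
      contDiffOn_succ_of_hasDerivAt hU h.e0 i3, contDiffOn_succ_of_hasDerivAt hU h.e1 ?_⟩
    · exact ((contDiffOn_const.mul ((contDiffOn_const.mul i0).add (hs.mul i2))).sub
        ((contDiffOn_const.mul hs).mul i1)).div hq hne
    · exact ((contDiffOn_const.mul (contDiffOn_const.mul i2)).sub
        ((contDiffOn_const.mul hs).mul i3)).div hq hne

theorem hasDerivAt_iteratedDeriv {U : Set ℝ} (hU : IsOpen U) {f : ℝ → ℝ} {m : ℕ}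
    (h : ContDiffOn ℝ m f U) {k : ℕ} (hk : k < m) {x : ℝ} (hx : x ∈ U) :
    HasDerivAt (iteratedDeriv k f) (iteratedDeriv (k + 1) f x) x := by
  have h1 : ContDiffAt ℝ m f x := h.contDiffAt (hU.mem_nhds hx)
  have h2 : DifferentiableAt ℝ (iteratedDeriv k f) x := by
    rw [iteratedDeriv_eq_equiv_comp]
    exact (ContinuousMultilinearMap.piFieldEquiv ℝ (Fin k) ℝ).symm.differentiable.differentiableAt.comp
      x (h1.differentiableAt_iteratedFDeriv (by exact_mod_cast hk))
  rw [iteratedDeriv_succ]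
  exact h2.hasDerivAt

theorem hasDerivAt_unique_on {U : Set ℝ} (hU : IsOpen U) {f g : ℝ → ℝ} (h : ∀ x ∈ U, f x = g x)
    {x a b : ℝ} (hx : x ∈ U) (hf : HasDerivAt f a x) (hg : HasDerivAt g b x) : a = b :=
  hf.unique (hg.congr_of_eventuallyEq (Filter.mem_of_superset (hU.mem_nhds hx) h))

/-- The parameter of the equation for `f`. -/
def eulerMu (n p : ℕ) (ℓ : ℝ) : ℝ := p * (n + 1 - p) + ℓ

/-- The parameter of the equation for `W`. -/
def eulerKappa (n p : ℕ) (ℓ : ℝ) : ℝ := (p + 1) * (n - p) + ℓ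

/-- With q = z(1-z), s = 1-2z and M = L_μ f, the right-hand form is s³ L_κ(M/s), where M, M', M''
are written out in the derivatives of f. It equals q² s² times the left side. -/
theorem fuchs_cleared (n p ℓ z d0 d1 d2 d3 d4 : ℝ) (h0 : z ≠ 0) (h1 : z ≠ 1) (h2 : z ≠ 1 / 2) :
    (d4 + fuchsQ3 n z * d3 + fuchsQ2 n p ℓ z * d2 + fuchsQ1 n p ℓ z * d1 + fuchsQ0 n p ℓ z * d0 = 0)
    ↔
    (1 - 2 * z) * ((1 - 2 * z) *
      ((z * (1 - z)) * ((z * (1 - z)) * d4 + (n / 2 + 1 + 2) * (1 - 2 * z) * d3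
        - (2 * (n / 2 + 1 + 1) + 2 * (n / 2 + 1) + (p * (n + 1 - p) + ℓ)) * d2)
        + (n / 2 + 1) * (1 - 2 * z) * ((z * (1 - z)) * d3 + (n / 2 + 1 + 1) * (1 - 2 * z) * d2
          - (2 * (n / 2 + 1) + (p * (n + 1 - p) + ℓ)) * d1)
        - ((p + 1) * (n - p) + ℓ) * ((z * (1 - z)) * d2 + (n / 2 + 1) * (1 - 2 * z) * d1
          - (p * (n + 1 - p) + ℓ) * d0))
      + (4 * (z * (1 - z))) * ((z * (1 - z)) * d3 + (n / 2 + 1 + 1) * (1 - 2 * z) * d2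
          - (2 * (n / 2 + 1) + (p * (n + 1 - p) + ℓ)) * d1)
      + 2 * (n / 2 + 1) * (1 - 2 * z) * ((z * (1 - z)) * d2 + (n / 2 + 1) * (1 - 2 * z) * d1
          - (p * (n + 1 - p) + ℓ) * d0))
      + 8 * (z * (1 - z)) * ((z * (1 - z)) * d2 + (n / 2 + 1) * (1 - 2 * z) * d1
          - (p * (n + 1 - p) + ℓ) * d0) = 0 := by
  have hz1 : z - 1 ≠ 0 := sub_ne_zero.2 h1
  have hs : 1 - 2 * z ≠ 0 := fun h => h2 (by linarith)
  have e3 : (z * (1 - z)) ^ 2 * (1 - 2 * z) ^ 2 * fuchsQ3 n z =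
      (n + 4) * (z * (1 - z)) * (1 - 2 * z) ^ 3 + 4 * (z * (1 - z)) ^ 2 * (1 - 2 * z) := by
    rw [fuchsQ3, div_add_div _ _ hz1 h0, div_add_div _ _ (mul_ne_zero hz1 h0) hs, mul_div_assoc',
      div_eq_iff (mul_ne_zero (mul_ne_zero hz1 h0) hs)]
    ring
  have e2 : (z * (1 - z)) ^ 2 * (1 - 2 * z) ^ 2 * fuchsQ2 n p ℓ z =
      (16 * (n ^ 2 + 2 * (p + 3) * n - 2 * p ^ 2 + 2 * (ℓ + 3)) * z ^ 4
    + 32 * (2 * p ^ 2 - n ^ 2 - 2 * (p + 3) * n - 2 * (ℓ + 3)) * z ^ 3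
    + 8 * (3 * n ^ 2 + 5 * (p + 3) * n + 3 * n - 5 * p ^ 2 + ℓ + 4 * (ℓ + 3) + 6) * z ^ 2
    + 8 * (p ^ 2 - n ^ 2 - (p + 3) * n - 3 * n - ℓ - 6) * z
    + n ^ 2 + 6 * n + 8) / 4 := by
    rw [fuchsQ2, show 16 * z ^ 6 - 48 * z ^ 5 + 52 * z ^ 4 - 24 * z ^ 3 + 4 * z ^ 2
      = 4 * (z ^ 2 * (z - 1) ^ 2 * (1 - 2 * z) ^ 2) by ring, mul_div_assoc', div_eq_iff (by positivity)]
    ring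
  have e1 : (z * (1 - z)) ^ 2 * (1 - 2 * z) ^ 2 * fuchsQ1 n p ℓ z = -(1 - 2 * z) *
      (2 * p * n ^ 2 + n ^ 2 - 2 * p ^ 2 * n + 4 * p * n + 2 * ℓ * n + 2 * n - 4 * p ^ 2 + 4 * ℓ
    + 4 * (-2 * p * n ^ 2 - n ^ 2 + 2 * p ^ 2 * n - 2 * p * n - 2 * ℓ * n - 2 * n
        + 2 * p ^ 2 + 2 * p - 2 * ℓ) * z
    + 4 * (2 * p * n ^ 2 + n ^ 2 - 2 * p ^ 2 * n + 2 * p * n + 2 * ℓ * n + 2 * n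
        - 2 * p ^ 2 - 2 * p + 2 * ℓ) * z ^ 2) / 2 := by
    rw [fuchsQ1, show 4 * z ^ 5 - 10 * z ^ 4 + 8 * z ^ 3 - 2 * z ^ 2
      = -2 * (z ^ 2 * (z - 1) ^ 2 * (1 - 2 * z)) by ring, mul_div_assoc', div_eq_iff (by positivity)]
    ring
  have e0 : (z * (1 - z)) ^ 2 * (1 - 2 * z) ^ 2 * fuchsQ0 n p ℓ z =
      (p ^ 4 - 2 * n * p ^ 3 + n ^ 2 * p ^ 2 - 2 * ℓ * p ^ 2 + p ^ 2 - 2 * n * p + 2 * n * ℓ * p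
      - 2 * p + ℓ ^ 2 - 2 * ℓ
    + 4 * (-p ^ 4 + 2 * n * p ^ 3 - n ^ 2 * p ^ 2 + 2 * ℓ * p ^ 2 + p ^ 2 - 2 * n * ℓ * p
        - ℓ ^ 2) * z
    + 4 * (p ^ 4 - 2 * n * p ^ 3 + n ^ 2 * p ^ 2 - 2 * ℓ * p ^ 2 - p ^ 2 + 2 * n * ℓ * p
        + ℓ ^ 2) * z ^ 2) := by
    rw [fuchsQ0, show 4 * z ^ 6 - 12 * z ^ 5 + 13 * z ^ 4 - 6 * z ^ 3 + z ^ 2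
      = (z ^ 2 * (z - 1) ^ 2 * (1 - 2 * z) ^ 2) by ring, mul_div_assoc', div_eq_iff (by positivity)]
    ring
  have hne : (z * (1 - z)) ^ 2 * (1 - 2 * z) ^ 2 ≠ 0 := by
    have : 1 - z ≠ 0 := sub_ne_zero.2 (Ne.symm h1)
    positivity
  rw [← mul_eq_zero_iff_left hne]
  refine Eq.congr ?_ rfl
  linear_combination d3 * e3 + d2 * e2 + d1 * e1 + d0 * e0

/-- Differentiating L_μ f = (1-2z)W twice expresses M, M', M'' through W and its derivatives, after
which the cleared equation is a multiple of L_κ W = 0. The point 1/2 may lie in U. -/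
theorem isFuchsSolutionOn_of_system {n p : ℕ} {ℓ : ℝ} {U : Set ℝ} (hU : IsOpen U)
    (h0 : ∀ z ∈ U, z ≠ 0) (h1 : ∀ z ∈ U, z ≠ 1) {f f₁ W W₁ : ℝ → ℝ}
    (h : IsEulerSystemOn 1 (n / 2 + 1) (eulerMu n p ℓ) (eulerKappa n p ℓ) U f f₁ W W₁) :
    IsFuchsSolutionOn n p ℓ U f := by
  have hne : ∀ z ∈ U, z * (1 - 1 * z) ≠ 0 := fun z hz =>
    mul_ne_zero (h0 z hz) (by rw [one_mul]; exact sub_ne_zero.2 (h1 z hz).symm)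
  have hc := (h.contDiffOn hU hne 4).1
  refine ⟨hc, ?_⟩
  intro z hz _ hz2 _
  rw [fuchs_cleared _ _ _ _ _ _ _ _ _ (h0 z hz) (h1 z hz) hz2]
  have D0 : ∀ z ∈ U, HasDerivAt f (iteratedDeriv 1 f z) z := fun z hz => by
    simpa using hasDerivAt_iteratedDeriv hU hc (k := 0) (by norm_num) hz
  have D1 := fun z hz => hasDerivAt_iteratedDeriv hU hc (k := 1) (by norm_num) (x := z) hz
  have D2 := fun z hz => hasDerivAt_iteratedDeriv hU hc (k := 2) (by norm_num) (x := z) hz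
  have D3 := fun z hz => hasDerivAt_iteratedDeriv hU hc (k := 3) (by norm_num) (x := z) hz
  simp only [Nat.reduceAdd] at D1 D2 D3
  have F1 : ∀ z ∈ U, iteratedDeriv 1 f z = f₁ z := fun z hz => (D0 z hz).unique (h.d0 z hz)
  set c : ℝ := n / 2 + 1 with hcdef
  set μ := eulerMu n p ℓ with hμ
  set κ := eulerKappa n p ℓ with hκ
  have ds : ∀ z : ℝ, HasDerivAt (fun z : ℝ => 1 - 2 * z) (-2) z := fun z => by
    simpa using ((hasDerivAt_id z).const_mul 2).const_sub 1
  have dq : ∀ z : ℝ, HasDerivAt (fun z : ℝ => z * (1 - z)) (1 - 2 * z) z := fun z => by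
    refine ((hasDerivAt_id z).mul ((hasDerivAt_id z).const_sub 1)).congr_deriv ?_
    simp; ring
  have E0 : ∀ z ∈ U, (z * (1 - z)) * iteratedDeriv 2 f z + c * ((1 - 2 * z) * iteratedDeriv 1 f z)
      - μ * f z = (1 - 2 * z) * W z := fun z hz => by
    have := hasDerivAt_unique_on hU F1 hz (D1 z hz) (h.d1 z hz)
    have hne' := hne z hz
    have h0' := h0 z hz
    have h1' : 1 - z ≠ 0 := sub_ne_zero.2 (h1 z hz).symm
    rw [this, F1 z hz]
    simp only [one_mul, mul_one]
    rw [mul_div_cancel₀ _ (mul_ne_zero h0' h1')]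
    ring
  have E1 : ∀ z ∈ U, (z * (1 - z)) * iteratedDeriv 3 f z
      + (c + 1) * ((1 - 2 * z) * iteratedDeriv 2 f z)
      - (2 * c + μ) * iteratedDeriv 1 f z = (1 - 2 * z) * W₁ z - 2 * W z := fun z hz => by
    have := hasDerivAt_unique_on hU E0 hz
      ((((dq z).mul (D2 z hz)).add (((ds z).mul (D1 z hz)).const_mul c)).sub
        ((D0 z hz).const_mul μ)) ((ds z).mul (h.e0 z hz))
    linear_combination this
  have E2 := hasDerivAt_unique_on hU E1 hz
      ((((dq z).mul (D3 z hz)).add (((ds z).mul (D2 z hz)).const_mul (c + 1))).sub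
        ((D1 z hz).const_mul (2 * c + μ)))
      (((ds z).mul (h.e1 z hz)).sub ((h.e0 z hz).const_mul 2))
  have hW2 : ∃ W₂, W₂ = (1 * (κ * W z) - c * (1 - 2 * 1 * z) * W₁ z) / (z * (1 - 1 * z)) := ⟨_, rfl⟩
  obtain ⟨W₂, hW₂⟩ := hW2
  rw [← hW₂] at E2
  have hW₂' : z * (1 - z) * W₂ = κ * W z - c * (1 - 2 * z) * W₁ z := by
    have hne' := hne z hz
    rw [hW₂]
    rw [one_mul] at hne' ⊢
    field_simp
  have E0z := E0 z hz
  have E1z := E1 z hz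
  have eμ : (p : ℝ) * (n + 1 - p) + ℓ = μ := rfl
  have eκ : ((p : ℝ) + 1) * (n - p) + ℓ = κ := rfl
  rw [eμ, eκ, ← iteratedDeriv_one]
  have E0z' : z * (1 - z) * iteratedDeriv 2 f z + c * (1 - 2 * z) * iteratedDeriv 1 f z - μ * f z
      = (1 - 2 * z) * W z := by linear_combination E0z
  have E1z' : z * (1 - z) * iteratedDeriv 3 f z + (c + 1) * (1 - 2 * z) * iteratedDeriv 2 f z
      - (2 * c + μ) * iteratedDeriv 1 f z = (1 - 2 * z) * W₁ z - 2 * W z := by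
    linear_combination E1z
  have E2z' : z * (1 - z) * iteratedDeriv 4 f z + (c + 2) * (1 - 2 * z) * iteratedDeriv 3 f z
      - (2 * (c + 1) + 2 * c + μ) * iteratedDeriv 2 f z = (1 - 2 * z) * W₂ - 4 * W₁ z := by
    linear_combination E2
  rw [E0z', E1z', E2z']
  linear_combination (1 - 2 * z) ^ 3 * hW₂'

/-- Here W is obtained by dividing L_μ f by 1-2z, which is why 1/2 has to be avoided. The fourth
function is the derivative of that quotient. -/
theorem exists_system_of_isFuchsSolutionOn {n p : ℕ} {ℓ : ℝ} {U : Set ℝ} (hU : IsOpen U)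
    (h0 : ∀ z ∈ U, z ≠ 0) (h1 : ∀ z ∈ U, z ≠ 1) (h2 : ∀ z ∈ U, z ≠ 1 / 2) {f : ℝ → ℝ}
    (h : IsFuchsSolutionOn n p ℓ U f) :
    IsEulerSystemOn 1 (n / 2 + 1) (eulerMu n p ℓ) (eulerKappa n p ℓ) U f (iteratedDeriv 1 f)
      (fun z => (z * (1 - z) * iteratedDeriv 2 f z
        + (n / 2 + 1) * ((1 - 2 * z) * iteratedDeriv 1 f z) - eulerMu n p ℓ * f z) / (1 - 2 * z))
      (fun z => (z * (1 - z) * iteratedDeriv 3 f z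
        + (n / 2 + 1 + 1) * ((1 - 2 * z) * iteratedDeriv 2 f z)
        - (2 * (n / 2 + 1) + eulerMu n p ℓ) * iteratedDeriv 1 f z
        + 2 * ((z * (1 - z) * iteratedDeriv 2 f z
        + (n / 2 + 1) * ((1 - 2 * z) * iteratedDeriv 1 f z) - eulerMu n p ℓ * f z) / (1 - 2 * z)))
          / (1 - 2 * z)) := by
  obtain ⟨hc, hL⟩ := h
  have D0 : ∀ z ∈ U, HasDerivAt f (iteratedDeriv 1 f z) z := fun z hz => by
    simpa using hasDerivAt_iteratedDeriv (m := 4) hU hc (k := 0) (by norm_num) hz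
  have D1 := fun z hz => hasDerivAt_iteratedDeriv (m := 4) hU hc (k := 1) (by norm_num) (x := z) hz
  have D2 := fun z hz => hasDerivAt_iteratedDeriv (m := 4) hU hc (k := 2) (by norm_num) (x := z) hz
  have D3 := fun z hz => hasDerivAt_iteratedDeriv (m := 4) hU hc (k := 3) (by norm_num) (x := z) hz
  simp only [Nat.reduceAdd] at D1 D2 D3
  set c : ℝ := n / 2 + 1 with hcdef
  set μ := eulerMu n p ℓ with hμ
  set κ := eulerKappa n p ℓ with hκ
  have ds : ∀ z : ℝ, HasDerivAt (fun z : ℝ => 1 - 2 * z) (-2) z := fun z => by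
    simpa using ((hasDerivAt_id z).const_mul 2).const_sub 1
  have dq : ∀ z : ℝ, HasDerivAt (fun z : ℝ => z * (1 - z)) (1 - 2 * z) z := fun z => by
    refine ((hasDerivAt_id z).mul ((hasDerivAt_id z).const_sub 1)).congr_deriv ?_
    simp; ring
  have hs : ∀ z ∈ U, 1 - 2 * z ≠ 0 := fun z hz h => h2 z hz (by linarith)
  have hq : ∀ z ∈ U, z * (1 - z) ≠ 0 := fun z hz =>
    mul_ne_zero (h0 z hz) (sub_ne_zero.2 (h1 z hz).symm)
  have dW : ∀ z ∈ U, HasDerivAt (fun z => (z * (1 - z) * iteratedDeriv 2 f z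
        + c * ((1 - 2 * z) * iteratedDeriv 1 f z) - μ * f z) / (1 - 2 * z))
        ((z * (1 - z) * iteratedDeriv 3 f z
        + (c + 1) * ((1 - 2 * z) * iteratedDeriv 2 f z) - (2 * c + μ) * iteratedDeriv 1 f z
        + 2 * ((z * (1 - z) * iteratedDeriv 2 f z
        + c * ((1 - 2 * z) * iteratedDeriv 1 f z) - μ * f z) / (1 - 2 * z)))
          / (1 - 2 * z)) z := fun z hz => by
    refine (((((dq z).mul (D2 z hz)).add (((ds z).mul (D1 z hz)).const_mul c)).sub
        ((D0 z hz).const_mul μ)).div (ds z) (hs z hz)).congr_deriv ?_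
    have := hs z hz
    simp only [Pi.add_apply, Pi.sub_apply, Pi.mul_apply]
    field_simp
    ring
  refine ⟨D0, ?_, dW, ?_⟩
  · intro z hz
    refine (D1 z hz).congr_deriv ?_
    have := hs z hz
    simp only [one_mul, mul_one]
    rw [eq_div_iff (hq z hz), mul_div_cancel₀ _ (hs z hz)]
    ring
  · intro z hz
    refine ((((((dq z).mul (D3 z hz)).add (((ds z).mul (D2 z hz)).const_mul (c + 1))).sub
        ((D1 z hz).const_mul (2 * c + μ))).add ((dW z hz).const_mul 2)).div (ds z)
        (hs z hz)).congr_deriv ?_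
    have hs' := hs z hz
    have hq' := hq z hz
    have key := (fuchs_cleared _ _ _ _ _ _ _ _ _ (h0 z hz) (h1 z hz) (h2 z hz)).1
      (hL z hz (h0 z hz) (h2 z hz) (h1 z hz))
    have eμ : (p : ℝ) * (n + 1 - p) + ℓ = μ := rfl
    have eκ : ((p : ℝ) + 1) * (n - p) + ℓ = κ := rfl
    rw [eμ, eκ, ← iteratedDeriv_one] at key
    simp only [Pi.add_apply, Pi.sub_apply, Pi.mul_apply, one_mul, mul_one]
    generalize iteratedDeriv 1 f z = d1 at *
    generalize iteratedDeriv 2 f z = d2 at *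
    generalize iteratedDeriv 3 f z = d3 at *
    generalize iteratedDeriv 4 f z = d4 at *
    generalize f z = d0 at *
    rw [← hcdef] at key
    clear_value c μ κ
    have hz0 := h0 z hz
    have hz1 : 1 - z ≠ 0 := sub_ne_zero.2 (h1 z hz).symm
    field_simp
    linear_combination key

theorem IsEulerSystemOn.comp_neg {ε c μ κ : ℝ} {U : Set ℝ} {f f₁ W W₁ : ℝ → ℝ}
    (h : IsEulerSystemOn ε c μ κ U f f₁ W W₁) {V : Set ℝ} (hV : ∀ x ∈ V, -x ∈ U) :
    IsEulerSystemOn (-ε) c μ κ V (fun x => f (-x)) (fun x => -f₁ (-x)) (fun x => W (-x))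
      (fun x => -W₁ (-x)) := by
  have aux : ∀ a x : ℝ, -(a / (-x * (1 - ε * -x)) * -1) = -a / (x * (1 - -ε * x)) := fun a x => by
    rw [show -x * (1 - ε * -x) = -(x * (1 - -ε * x)) by ring, div_neg, neg_div]; ring
  refine ⟨fun x hx => ?_, fun x hx => ?_, fun x hx => ?_, fun x hx => ?_⟩
  · exact ((h.d0 _ (hV x hx)).comp x (hasDerivAt_neg x)).congr_deriv (by ring)
  · refine (((h.d1 _ (hV x hx)).comp x (hasDerivAt_neg x)).neg).congr_deriv ?_
    rw [aux]; congr 1; ring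
  · exact ((h.e0 _ (hV x hx)).comp x (hasDerivAt_neg x)).congr_deriv (by ring)
  · refine (((h.e1 _ (hV x hx)).comp x (hasDerivAt_neg x)).neg).congr_deriv ?_
    rw [aux]; congr 1; ring

/-! ### Wronskians and reduction of order at 0. -/

/-- Powers of `x (1 - ε x)`. -/
noncomputable def eulerWeight (ε a x : ℝ) : ℝ := (x * (1 - ε * x)) ^ a

theorem eulerWeight_pos {ε x : ℝ} (h : 0 < x * (1 - ε * x)) (a : ℝ) : 0 < eulerWeight ε a x :=
  Real.rpow_pos_of_pos h a

theorem eulerWeight_add_one {ε x : ℝ} (h : 0 < x * (1 - ε * x)) (a : ℝ) :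
    eulerWeight ε (a + 1) x = eulerWeight ε a x * (x * (1 - ε * x)) :=
  Real.rpow_add_one h.ne' a

theorem hasDerivAt_eulerWeight {ε x : ℝ} (h : 0 < x * (1 - ε * x)) (a : ℝ) :
    HasDerivAt (eulerWeight ε (a + 1)) ((a + 1) * (1 - 2 * ε * x) * eulerWeight ε a x) x := by
  have hq : HasDerivAt (fun x : ℝ => x * (1 - ε * x)) (1 - 2 * ε * x) x := by
    refine ((hasDerivAt_id x).mul (((hasDerivAt_id x).const_mul ε).const_sub 1)).congr_deriv ?_
    simp only [id]; ring
  refine (hq.rpow_const (p := a + 1) (Or.inl h.ne')).congr_deriv ?_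
  rw [eulerWeight, add_sub_cancel_right]; ring

/-- This is Lagrange's identity: multiplying by (x(1-εx))^α puts the operator in divergence form,
with (x(1-εx))^(α+1) in front of the first derivative. If both functions solve the same homogeneous
equation, the result is zero. -/
theorem hasDerivAt_wronskian {ε α x f₂ g₂ a b : ℝ} {f f₁ g g₁ : ℝ → ℝ} (h : 0 < x * (1 - ε * x))
    (hf : HasDerivAt f (f₁ x) x) (hf₁ : HasDerivAt f₁ f₂ x)
    (hg : HasDerivAt g (g₁ x) x) (hg₁ : HasDerivAt g₁ g₂ x)
    (ha : x * (1 - ε * x) * f₂ + (α + 1) * (1 - 2 * ε * x) * f₁ x = a)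
    (hb : x * (1 - ε * x) * g₂ + (α + 1) * (1 - 2 * ε * x) * g₁ x = b) :
    HasDerivAt (fun x => eulerWeight ε (α + 1) x * (f₁ x * g x - f x * g₁ x))
      (eulerWeight ε α x * (a * g x - f x * b)) x := by
  refine ((hasDerivAt_eulerWeight h α).mul ((hf₁.mul hg).sub (hf.mul hg₁))).congr_deriv ?_
  rw [eulerWeight_add_one h, ← ha, ← hb]
  simp only [Pi.sub_apply, Pi.mul_apply]
  ring

/-- The weight is inserted in numerator and denominator so that the numerator is the weighted
Wronskian, a constant or a known primitive in every application. -/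
theorem hasDerivAt_quotient {ε α x : ℝ} {f f₁ g g₁ : ℝ → ℝ} (h : 0 < x * (1 - ε * x))
    (hf : HasDerivAt f (f₁ x) x) (hg : HasDerivAt g (g₁ x) x) (hg0 : g x ≠ 0) :
    HasDerivAt (fun x => f x / g x)
      (eulerWeight ε (α + 1) x * (f₁ x * g x - f x * g₁ x) / (eulerWeight ε (α + 1) x * g x ^ 2))
      x := by
  refine (hf.div hg hg0).congr_deriv ?_
  have := (eulerWeight_pos h (α + 1)).ne'
  field_simp

theorem eventually_pos_weight (ε : ℝ) : ∀ᶠ x in 𝓝[>] (0 : ℝ), 0 < x ∧ 0 < 1 - ε * x := by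
  have : ContinuousAt (fun x : ℝ => 1 - ε * x) 0 := by fun_prop
  have h : ∀ᶠ x in 𝓝 (0 : ℝ), 0 < 1 - ε * x :=
    this.eventually (lt_mem_nhds (by simp))
  filter_upwards [self_mem_nhdsWithin, h.filter_mono nhdsWithin_le_nhds] with x hx hx'
  exact ⟨hx, hx'⟩

theorem analyticAt_rpow_const {x : ℝ} (hx : x ≠ 0) (a : ℝ) :
    AnalyticAt ℝ (fun x : ℝ => x ^ a) x :=
  (Real.contDiffAt_rpow_const_of_ne (n := ⊤) hx).analyticAt

theorem analyticAt_one_sub_rpow (ε a : ℝ) : AnalyticAt ℝ (fun x : ℝ => (1 - ε * x) ^ a) 0 :=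
  (analyticAt_rpow_const (x := 1 - ε * 0) (by simp) a).comp
    (f := fun x : ℝ => 1 - ε * x) (analyticAt_const.sub (analyticAt_const.mul analyticAt_id))

theorem eulerWeight_eq {ε a x : ℝ} (hx : 0 < x ∧ 0 < 1 - ε * x) :
    eulerWeight ε a x = x ^ a * (1 - ε * x) ^ a :=
  Real.mul_rpow hx.1.le hx.2.le

/-- The form at `0` of a solution of the second order equation, given by reduction of order. -/
theorem frobenius_of_quotient {n : ℕ} (hn : 2 ≤ n) (ε : ℝ) {g W Q : ℝ → ℝ} {c : ℝ}
    (hg : AnalyticAt ℝ g 0) (hg0 : g 0 = 1)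
    (hQ : ∀ᶠ x in 𝓝[>] (0 : ℝ),
      HasDerivAt Q (c / (eulerWeight ε ((n : ℝ) / 2 + 1) x * g x ^ 2)) x)
    (hW : ∀ᶠ x in 𝓝[>] (0 : ℝ), W x = g x * Q x) :
    ∃ A B : ℝ → ℝ, AnalyticAt ℝ A 0 ∧ AnalyticAt ℝ B 0 ∧ A 0 = -c / ((n : ℝ) / 2) ∧
      ∀ᶠ x in 𝓝[>] (0 : ℝ), W x = x ^ (-((n : ℝ) / 2)) * A x + B x * parityLog n x := by
  refine frobenius_second_order hn (analyticAt_one_sub_rpow ε ((n : ℝ) / 2 + 1)) (by simp) hg hg0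
    ?_ hW
  filter_upwards [hQ, eventually_pos_weight ε] with x hx hx'
  rwa [← eulerWeight_eq hx']

theorem tendsto_rpow_mul_of_frobenius {n : ℕ} (hn : 2 ≤ n) {W A B : ℝ → ℝ}
    (hA : AnalyticAt ℝ A 0) (hB : AnalyticAt ℝ B 0)
    (hW : ∀ᶠ x in 𝓝[>] (0 : ℝ), W x = x ^ (-((n : ℝ) / 2)) * A x + B x * parityLog n x) :
    Tendsto (fun x => x ^ ((n : ℝ) / 2) * W x) (𝓝[>] 0) (𝓝 (A 0)) := by
  have hn' : (2 : ℝ) ≤ n := by exact_mod_cast hn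
  have hle : 𝓝[>] (0 : ℝ) ≤ 𝓝 0 := nhdsWithin_le_nhds
  have tA := hA.continuousAt.tendsto.mono_left hle
  have tB := hB.continuousAt.tendsto.mono_left hle
  have := tA.add ((tendsto_rpow_mul_parityLog n (γ := (n : ℝ) / 2) (by linarith)).mul tB)
  rw [zero_mul, add_zero] at this
  refine this.congr' ?_
  filter_upwards [hW, self_mem_nhdsWithin] with x hx hx0
  have e1 : x ^ ((n : ℝ) / 2) * x ^ (-((n : ℝ) / 2)) = 1 := by
    rw [← Real.rpow_add hx0]; simp
  rw [hx]
  linear_combination (-A x) * e1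

theorem tendsto_eulerWeight_mul {n : ℕ} (hn : 2 ≤ n) (ε : ℝ) {W A B : ℝ → ℝ}
    (hA : AnalyticAt ℝ A 0) (hB : AnalyticAt ℝ B 0)
    (hW : ∀ᶠ x in 𝓝[>] (0 : ℝ), W x = x ^ (-((n : ℝ) / 2)) * A x + B x * parityLog n x) :
    Tendsto (fun x => eulerWeight ε ((n : ℝ) / 2) x * W x) (𝓝[>] 0) (𝓝 (A 0)) := by
  have t1 := (analyticAt_one_sub_rpow ε ((n : ℝ) / 2)).continuousAt.tendsto.mono_left
    (nhdsWithin_le_nhds (s := Set.Ioi (0 : ℝ)))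
  have := t1.mul (tendsto_rpow_mul_of_frobenius hn hA hB hW)
  simp only [mul_zero, sub_zero, Real.one_rpow, one_mul] at this
  refine this.congr' ?_
  filter_upwards [eventually_pos_weight ε] with x hx
  rw [eulerWeight_eq hx]; ring

theorem exists_limit_integral {n : ℕ} (hn : 2 ≤ n) (ε : ℝ) {u W J A B : ℝ → ℝ}
    (hA : AnalyticAt ℝ A 0) (hB : AnalyticAt ℝ B 0)
    (hW : ∀ᶠ x in 𝓝[>] (0 : ℝ), W x = x ^ (-((n : ℝ) / 2)) * A x + B x * parityLog n x)
    (hu : AnalyticAt ℝ u 0) (hu0 : u 0 = 1)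
    (hJ : ∀ᶠ x in 𝓝[>] (0 : ℝ), HasDerivAt J
      (eulerWeight ε ((n : ℝ) / 2) x * ((1 - 2 * ε * x) * W x * u x)) x) :
    ∃ F G H : ℝ → ℝ, AnalyticAt ℝ F 0 ∧ AnalyticAt ℝ G 0 ∧ AnalyticAt ℝ H 0 ∧
      F 0 = A 0 ∧ ∃ D : ℝ, Tendsto J (𝓝[>] 0) (𝓝 D) ∧
      ∀ᶠ x in 𝓝[>] (0 : ℝ),
        J x = x * F x + x ^ ((n : ℝ) / 2 + 1) * (G x * parityLog n x + H x) + D := by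
  have hκ : AnalyticAt ℝ (fun x => (1 - ε * x) ^ ((n : ℝ) / 2) * (1 - 2 * ε * x) * u x) 0 :=
    ((analyticAt_one_sub_rpow ε _).mul
      (analyticAt_const.sub (analyticAt_const.mul analyticAt_id))).mul hu
  have hJ' : ∀ᶠ x in 𝓝[>] (0 : ℝ), HasDerivAt J (x ^ ((n : ℝ) / 2) *
      ((1 - ε * x) ^ ((n : ℝ) / 2) * (1 - 2 * ε * x) * u x) * W x) x := by
    filter_upwards [hJ, eventually_pos_weight ε] with x hx hx'
    refine hx.congr_deriv ?_
    rw [eulerWeight_eq hx']; ring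
  obtain ⟨F, G, H, hF, hG, hH, hF0, h⟩ := frobenius_integral hn hκ hA hB hW hJ'
  exact ⟨F, G, H, hF, hG, hH, by simpa [hu0] using hF0, h⟩

/-- The ratio between the leading coefficient of `f` and that of the Wronskian of `W`. -/
noncomputable def leadRatio (n : ℕ) : ℝ :=
  if n = 2 then 1 else 1 / ((n : ℝ) / 2 * ((n : ℝ) / 2 - 1))

theorem leadRatio_pos {n : ℕ} (hn : 2 ≤ n) : 0 < leadRatio n := by
  unfold leadRatio
  split_ifs with h
  · exact one_pos
  · have : (3 : ℝ) ≤ n := by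
      have : 3 ≤ n := by omega
      exact_mod_cast this
    have : 0 < (n : ℝ) / 2 * ((n : ℝ) / 2 - 1) := mul_pos (by linarith) (by linarith)
    positivity

/-- The form at `0` of a solution `f` of the fourth order equation, given by reductions of order,
which does not contain the power `x^(-n/2)`. -/
theorem frobenius_green {n : ℕ} (hn : 2 ≤ n) (ε : ℝ) {g W Q u f q J : ℝ → ℝ} {c : ℝ}
    (hg : AnalyticAt ℝ g 0) (hg0 : g 0 = 1) (hu : AnalyticAt ℝ u 0) (hu0 : u 0 = 1)
    (hQ : ∀ᶠ x in 𝓝[>] (0 : ℝ),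
      HasDerivAt Q (c / (eulerWeight ε ((n : ℝ) / 2 + 1) x * g x ^ 2)) x)
    (hW : ∀ᶠ x in 𝓝[>] (0 : ℝ), W x = g x * Q x)
    (hJ : ∀ᶠ x in 𝓝[>] (0 : ℝ), HasDerivAt J
      (eulerWeight ε ((n : ℝ) / 2) x * ((1 - 2 * ε * x) * W x * u x)) x)
    (hJ0 : Tendsto J (𝓝[>] 0) (𝓝 0))
    (hq : ∀ᶠ x in 𝓝[>] (0 : ℝ),
      HasDerivAt q (J x / (eulerWeight ε ((n : ℝ) / 2 + 1) x * u x ^ 2)) x)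
    (hf : ∀ᶠ x in 𝓝[>] (0 : ℝ), f x = u x * q x) :
    ∃ a b : ℝ → ℝ, AnalyticAt ℝ a 0 ∧ AnalyticAt ℝ b 0 ∧
      (n ≠ 2 → a 0 = leadRatio n * c) ∧ (n = 2 → b 0 = -(leadRatio n * c)) ∧
      ∀ᶠ x in 𝓝[>] (0 : ℝ), f x = x ^ (1 - (n : ℝ) / 2) * a x + b x * parityLog n x := by
  have hn' : (2 : ℝ) ≤ n := by exact_mod_cast hn
  obtain ⟨A, B, hA, hB, hA0, hW'⟩ := frobenius_of_quotient hn ε hg hg0 hQ hW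
  obtain ⟨F, G, H, hF, hG, hH, hF0, D, hD, hJ'⟩ := exists_limit_integral hn ε hA hB hW' hu hu0 hJ
  have hD0 : D = 0 := tendsto_nhds_unique hD hJ0
  subst hD0
  simp only [add_zero] at hJ'
  have hq' : ∀ᶠ x in 𝓝[>] (0 : ℝ), HasDerivAt q
      (J x / (x ^ ((n : ℝ) / 2 + 1) * (1 - ε * x) ^ ((n : ℝ) / 2 + 1) * u x ^ 2)) x := by
    filter_upwards [hq, eventually_pos_weight ε] with x hx hx'
    rwa [← eulerWeight_eq hx']
  obtain ⟨a, b, ha, hb, ha0, hb0, h⟩ := frobenius_fourth_order hn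
    (analyticAt_one_sub_rpow ε ((n : ℝ) / 2 + 1)) (by simp) hu hu0 hF hG hH hJ' hq' hf
  refine ⟨a, b, ha, hb, fun h2 => ?_, fun h2 => ?_, h⟩
  · have h3 : (3 : ℝ) ≤ n := by
      have : 3 ≤ n := by omega
      exact_mod_cast this
    rw [ha0 h2, hF0, hA0, leadRatio, if_neg h2]
    have h1 : 1 - (n : ℝ) / 2 ≠ 0 := by linarith
    have h4 : (n : ℝ) / 2 - 1 ≠ 0 := by linarith
    have h5 : (n : ℝ) / 2 ≠ 0 := by linarith
    rw [show 1 - (n : ℝ) / 2 = -((n : ℝ) / 2 - 1) by ring]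
    field_simp
  · rw [hb0 h2, hF0, hA0, leadRatio, if_pos h2, h2]; norm_num

theorem sphereArea_pos {n : ℕ} (hn : 2 ≤ n) : 0 < sphereArea n := by
  have hne : Nonempty (Fin n) := ⟨⟨0, by omega⟩⟩
  rw [sphereArea, Measure.toSphere_apply_univ]
  refine ENNReal.toReal_pos ?_ ?_
  · refine mul_ne_zero ?_ (Metric.measure_ball_pos volume _ one_pos).ne'
    simp; omega
  · exact ENNReal.mul_ne_top (by simp) measure_ball_lt_top.ne

/-- The coefficient of the normalized singularity in the leading term of the Green's function. -/
noncomputable def greenCoeff (n : ℕ) (k : ℝ) : ℝ :=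
  if n = 2 then 1 / (4 * Real.pi) else 4 / (k * ((n : ℝ) - 2) * sphereArea n)

theorem greenCoeff_ne_zero {n : ℕ} (hn : 2 ≤ n) {k : ℝ} (hk : k ≠ 0) : greenCoeff n k ≠ 0 := by
  unfold greenCoeff
  split_ifs with h
  · have := Real.pi_pos
    positivity
  · have : (3 : ℝ) ≤ n := by
      have : 3 ≤ n := by omega
      exact_mod_cast this
    exact div_ne_zero four_ne_zero
      (mul_ne_zero (mul_ne_zero hk (by linarith)) (sphereArea_pos hn).ne')

theorem greenLeading_eq (n : ℕ) (k : ℝ) {x : ℝ} (hx : 0 < x) :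
    greenLeading n k x = greenCoeff n k * singLead n x := by
  unfold greenLeading greenCoeff singLead
  split_ifs with h
  · rw [abs_of_pos hx]; ring
  · rw [abs_of_pos hx]; ring

theorem hasGreenSingularity_iff (n : ℕ) (k : ℝ) (f : ℝ → ℝ) :
    HasGreenSingularity n k (𝓝[>] 0) f ↔
      (fun x => f x - greenCoeff n k * singLead n x) =O[𝓝[>] 0] greenRemainder n := by
  refine isBigO_congr ?_ EventuallyEq.rfl
  filter_upwards [self_mem_nhdsWithin] with x hx
  rw [greenLeading_eq n k hx]

theorem singLead_isLittleO (n : ℕ) (hn : 2 ≤ n) :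
    singLead n =o[𝓝[>] 0] fun x : ℝ => x ^ (-((n : ℝ) / 2)) := by
  have hn' : (2 : ℝ) ≤ n := by exact_mod_cast hn
  by_cases h2 : n = 2
  · subst h2
    have e2 : singLead 2 = fun x => -Real.log x := by ext x; simp [singLead]
    rw [e2, isLittleO_neg_left]
    exact isLittleO_log_rpow_nhdsGT_zero (by norm_num)
  · have e2 : singLead n = fun x => x ^ (1 - (n : ℝ) / 2) := by ext x; simp [singLead, h2]
    rw [e2, isLittleO_iff_tendsto']
    · have : Tendsto (fun x : ℝ => x) (𝓝[>] 0) (𝓝 0) :=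
        tendsto_nhdsWithin_of_tendsto_nhds tendsto_id
      refine this.congr' ?_
      filter_upwards [self_mem_nhdsWithin] with x hx
      rw [← Real.rpow_sub hx]; ring_nf; simp
    · filter_upwards [self_mem_nhdsWithin] with x hx h
      exact absurd h (Real.rpow_pos_of_pos hx _).ne'

/-- Solutions of the form `a Φ + b v` with remainder-size at `0` vanish if `Φ` has the singularity
of the Green's function and `v` is of size `x^(-n/2)`. -/
theorem coeffs_eq_zero_of_isBigO {n : ℕ} (hn : 2 ≤ n) {C a b A : ℝ} (hC : C ≠ 0) (hA : A ≠ 0)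
    {Φ v : ℝ → ℝ}
    (hΦ : (fun x => Φ x - C * singLead n x) =O[𝓝[>] 0] greenRemainder n)
    (hv : Tendsto (fun x => x ^ ((n : ℝ) / 2) * v x) (𝓝[>] 0) (𝓝 A))
    (h : (fun x => a * Φ x + b * v x) =O[𝓝[>] 0] greenRemainder n) : a = 0 ∧ b = 0 := by
  have hrl := greenRemainder_isLittleO hn
  have hls := singLead_isLittleO n hn
  have hΦl : Φ =O[𝓝[>] 0] singLead n := by
    have := (hΦ.trans hrl.isBigO).add ((isBigO_refl (singLead n) (𝓝[>] 0)).const_mul_left C)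
    simpa using this
  have hb : b = 0 := by
    have h1 : (fun x => b * v x) =o[𝓝[>] 0] fun x : ℝ => x ^ (-((n : ℝ) / 2)) := by
      have := (h.trans hrl.isBigO).sub (hΦl.const_mul_left a)
      exact (this.congr_left fun x => by ring).trans_isLittleO hls
    have h2 : Tendsto (fun x => x ^ ((n : ℝ) / 2) * (b * v x)) (𝓝[>] 0) (𝓝 0) := by
      refine h1.tendsto_div_nhds_zero.congr' ?_
      filter_upwards [self_mem_nhdsWithin] with x hx
      rw [Real.rpow_neg (le_of_lt hx), div_inv_eq_mul, mul_comm]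
    have h3 : Tendsto (fun x => x ^ ((n : ℝ) / 2) * (b * v x)) (𝓝[>] 0) (𝓝 (b * A)) :=
      (hv.const_mul b).congr fun x => by ring
    have := tendsto_nhds_unique h3 h2
    exact (mul_eq_zero.1 this).resolve_right hA
  refine ⟨?_, hb⟩
  subst hb
  simp only [zero_mul, add_zero] at h
  by_contra ha
  have h1 : (fun x => a * C * singLead n x) =O[𝓝[>] 0] greenRemainder n := by
    have := h.sub (hΦ.const_mul_left a)
    exact this.congr_left fun x => by ring
  have h2 : singLead n =o[𝓝[>] 0] singLead n :=
    (((isBigO_const_mul_left_iff (mul_ne_zero ha hC)).1 h1)).trans_isLittleO hrl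
  have h3 := isLittleO_irrefl' (f' := singLead n) (l := 𝓝[>] (0 : ℝ)) ?_
  · exact h3 h2
  · refine (Filter.Eventually.frequently ?_)
    filter_upwards [Ioo_mem_nhdsGT (zero_lt_one' ℝ)] with x hx
    rw [norm_ne_zero_iff, singLead]
    split_ifs
    · exact neg_ne_zero.2 (Real.log_neg hx.1 hx.2).ne
    · exact (Real.rpow_pos_of_pos hx.1 _).ne'

/-! ### Solutions on (0,1) regular at 1. -/

/-- An analytic solution on `(-1, 1)` of the inhomogeneous equation. -/
structure IsGaussSolution (α κ : ℝ) (R F F₁ F₂ : ℝ → ℝ) : Prop where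
  an : ∀ y, |y| < 1 → AnalyticAt ℝ F y
  an₁ : ∀ y, |y| < 1 → AnalyticAt ℝ F₁ y
  d0 : ∀ y, |y| < 1 → HasDerivAt F (F₁ y) y
  d1 : ∀ y, |y| < 1 → HasDerivAt F₁ (F₂ y) y
  ode : ∀ y, |y| < 1 →
    y * (1 - y) * F₂ y + (α + 1) * (1 - 2 * y) * F₁ y = κ * F y + R y

theorem isGaussSolution_ps {α : ℝ} (hα : 0 < α + 1) (κ d0 : ℝ) {e : ℕ → ℝ} (he : AbsSeries 1 e) :
    IsGaussSolution α κ (ps e) (ps (gaussCoeff (α + 1) (2 * α + 1) κ e d0))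
      (ps (derivCoeff (gaussCoeff (α + 1) (2 * α + 1) κ e d0)))
      (ps (derivCoeff (derivCoeff (gaussCoeff (α + 1) (2 * α + 1) κ e d0)))) := by
  have hd : AbsSeries 1 (gaussCoeff (α + 1) (2 * α + 1) κ e d0) :=
    AbsSeries.of_recurrence hα he (gaussCoeff_succ hα _ _ _ _)
  refine ⟨fun y hy => ps_analyticAt hd hy, fun y hy => ps_analyticAt hd.deriv hy,
    fun y hy => ps_hasDerivAt hd hy, fun y hy => ps_hasDerivAt hd.deriv hy, fun y hy => ?_⟩
  have := ps_gauss_ode (s := 2 * α + 1) (k := κ) hα he d0 hy rfl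
  linear_combination this

theorem exists_gaussSolution_pos {α κ : ℝ} (hα : 0 ≤ α) (hκ : 0 < κ) :
    ∃ c : ℕ → ℝ, AbsSeries 1 c ∧ c 0 = 1 ∧ (∀ j, 0 < c j) ∧
      IsGaussSolution α κ 0 (ps c) (ps (derivCoeff c)) (ps (derivCoeff (derivCoeff c))) := by
  have hα' : 0 < α + 1 := by linarith
  refine ⟨gaussCoeff (α + 1) (2 * α + 1) κ 0 1,
    AbsSeries.of_recurrence hα' AbsSeries.zero (gaussCoeff_succ hα' _ _ _ _), rfl,
    fun j => gaussCoeff_pos hα' (by linarith) hκ j, ?_⟩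
  have h := isGaussSolution_ps hα' κ 1 AbsSeries.zero
  have e : ps (0 : ℕ → ℝ) = 0 := by ext; simp [ps]
  rwa [e] at h

theorem AbsSeries.shift {c : ℕ → ℝ} (hc : AbsSeries 1 c) :
    AbsSeries 1 (fun j => if j = 0 then 0 else c (j - 1)) := by
  intro r hr hr1
  rw [← summable_nat_add_iff 1]
  refine ((hc r hr hr1).mul_left r).congr fun j => ?_
  simp only [Nat.add_eq_zero_iff, one_ne_zero, and_false, if_false, add_tsub_cancel_right, pow_succ]
  ring

/-- The forcing is (1-2z)W read in the variable y = 1-z, where 1-2z becomes 2y-1. The starting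
coefficient 0 is an arbitrary choice, since a regular homogeneous solution is added later. -/
theorem exists_gaussSolution_forced {α : ℝ} (hα : 0 ≤ α) (μ : ℝ) {c : ℕ → ℝ}
    (hc : AbsSeries 1 c) :
    ∃ R F F₁ F₂ : ℝ → ℝ, IsGaussSolution α μ R F F₁ F₂ ∧
      ∀ y, |y| < 1 → R y = (2 * y - 1) * ps c y := by
  have hs := hc.shift
  set c' : ℕ → ℝ := fun j => if j = 0 then 0 else c (j - 1) with hc'
  have he : AbsSeries 1 (fun j => 2 * c' j - c j) := by
    intro r hr hr1
    refine Summable.of_nonneg_of_le (fun j => by positivity) (fun j => ?_)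
      (((hs r hr hr1).mul_left 2).add (hc r hr hr1))
    have : |2 * c' j - c j| ≤ 2 * |c' j| + |c j| := by
      refine (abs_sub _ _).trans ?_
      rw [abs_mul, abs_two]
    calc _ ≤ (2 * |c' j| + |c j|) * r ^ j := by gcongr
      _ = _ := by ring
  refine ⟨_, _, _, _, isGaussSolution_ps (by linarith) μ 0 he, fun y hy => ?_⟩
  have h1 : HasSum (fun j => c' j * y ^ j) (y * ps c y) :=
    HasSum.mul_shift (by simp [hc']) ((hc.hasSum hy).congr_fun fun j => by simp [hc'])
  have h2 := (h1.mul_left 2).sub (hc.hasSum hy)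
  have := (he.hasSum hy).unique (h2.congr_fun fun j => by ring)
  rw [this]; ring

/-- The operator is invariant under y = 1-z: the factor 1-2y and the first derivative both change
sign. Expansions at 0 thus become expansions at 1. -/
theorem IsGaussSolution.comp_sub {α κ : ℝ} {R F F₁ F₂ : ℝ → ℝ}
    (h : IsGaussSolution α κ R F F₁ F₂) :
    IsGaussSolution α κ R F F₁ F₂ ∧ ∀ z ∈ Set.Ioo (0 : ℝ) 2,
      AnalyticAt ℝ (fun z => F (1 - z)) z ∧ AnalyticAt ℝ (fun z => -F₁ (1 - z)) z ∧
      HasDerivAt (fun z => F (1 - z)) (-F₁ (1 - z)) z ∧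
      HasDerivAt (fun z => -F₁ (1 - z)) (F₂ (1 - z)) z ∧
      z * (1 - 1 * z) * F₂ (1 - z) + (α + 1) * (1 - 2 * 1 * z) * (-F₁ (1 - z)) =
        κ * F (1 - z) + R (1 - z) := by
  refine ⟨h, fun z hz => ?_⟩
  have hy : |1 - z| < 1 := by rw [abs_lt]; constructor <;> linarith [hz.1, hz.2]
  have hd : HasDerivAt (fun z : ℝ => 1 - z) (-1) z := by
    simpa using (hasDerivAt_id z).const_sub 1
  have ha : AnalyticAt ℝ (fun z : ℝ => 1 - z) z := analyticAt_const.sub analyticAt_id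
  refine ⟨(h.an _ hy).comp (f := fun z : ℝ => 1 - z) ha,
    ((h.an₁ _ hy).comp (f := fun z : ℝ => 1 - z) ha).neg, ?_, ?_, ?_⟩
  · exact ((h.d0 _ hy).comp z hd).congr_deriv (by ring)
  · exact ((h.d1 _ hy).comp z hd).neg.congr_deriv (by ring)
  · rw [← h.ode _ hy]; ring

theorem const_of_hasDerivAt_zero {a b : ℝ} {f : ℝ → ℝ} (h : ∀ x ∈ Set.Ioo a b, HasDerivAt f 0 x)
    {x y : ℝ} (hx : x ∈ Set.Ioo a b) (hy : y ∈ Set.Ioo a b) : f x = f y :=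
  isOpen_Ioo.is_const_of_deriv_eq_zero (convex_Ioo a b).isPreconnected
    (fun x hx => (h x hx).differentiableAt.differentiableWithinAt) (fun x hx => (h x hx).deriv) hx hy

theorem abs_lt_one_of_mem {z : ℝ} (hz : z ∈ Set.Ioo (0 : ℝ) 1) : |z| < 1 := by
  rw [abs_of_pos hz.1]; exact hz.2

theorem weight_arg_pos {z : ℝ} (hz : z ∈ Set.Ioo (0 : ℝ) 1) : 0 < z * (1 - 1 * z) :=
  mul_pos hz.1 (by linarith [hz.2])

/-- The solution of the homogeneous equation which is regular at `1` is singular at `0`. -/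
theorem wronskian_gauss_neg {α κ : ℝ} {c : ℕ → ℝ} (hc : AbsSeries 1 c)
    (hpos : ∀ j, 0 < c j)
    (h : IsGaussSolution α κ 0 (ps c) (ps (derivCoeff c)) (ps (derivCoeff (derivCoeff c)))) :
    ∃ C < 0, ∀ z ∈ Set.Ioo (0 : ℝ) 1, eulerWeight 1 (α + 1) z *
      (-ps (derivCoeff c) (1 - z) * ps c z - ps c (1 - z) * ps (derivCoeff c) z) = C := by
  have hpos' : ∀ j, 0 < derivCoeff c j := fun j => mul_pos (by positivity) (hpos _)
  have hd : ∀ z ∈ Set.Ioo (0 : ℝ) 1, HasDerivAt (fun z => eulerWeight 1 (α + 1) z *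
      (-ps (derivCoeff c) (1 - z) * ps c z - ps c (1 - z) * ps (derivCoeff c) z)) 0 z := by
    intro z hz
    have hz' := abs_lt_one_of_mem hz
    obtain ⟨-, -, d0, d1, e⟩ := h.comp_sub.2 z ⟨hz.1, by linarith [hz.2]⟩
    have := hasDerivAt_wronskian (α := α) (weight_arg_pos hz) d0 d1 (h.d0 z hz') (h.d1 z hz') e
      (b := κ * ps c z) (by have := h.ode z hz'; simp only [Pi.zero_apply] at this; linear_combination this)
    refine this.congr_deriv ?_
    simp only [Pi.zero_apply]; ring
  -- The constant is evaluated at 1/2, where both arguments coincide and the Wronskian is -2 times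
  -- the weight times a product of two positive series.
  refine ⟨_, ?_, fun z hz => const_of_hasDerivAt_zero hd hz
    (show (1 / 2 : ℝ) ∈ Set.Ioo (0 : ℝ) 1 by norm_num)⟩
  have hw := eulerWeight_pos (ε := 1) (x := 1 / 2) (by norm_num) (α + 1)
  have h1 := ps_pos hc hpos (x := 1 / 2) (by norm_num) (by norm_num)
  have h2 := ps_pos hc.deriv hpos' (x := 1 / 2) (by norm_num) (by norm_num)
  have e : (1 : ℝ) - 1 / 2 = 1 / 2 := by norm_num
  simp only [e]
  nlinarith [mul_pos hw (mul_pos h1 h2)]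

theorem gauss_quotient {α κ : ℝ} {c : ℕ → ℝ} (hc : AbsSeries 1 c)
    (hpos : ∀ j, 0 < c j)
    (h : IsGaussSolution α κ 0 (ps c) (ps (derivCoeff c)) (ps (derivCoeff (derivCoeff c)))) :
    ∃ C < 0, ∀ z ∈ Set.Ioo (0 : ℝ) 1, HasDerivAt (fun z => ps c (1 - z) / ps c z)
      (C / (eulerWeight 1 (α + 1) z * ps c z ^ 2)) z := by
  obtain ⟨C, hC, hw⟩ := wronskian_gauss_neg hc hpos h
  refine ⟨C, hC, fun z hz => ?_⟩
  have hz' := abs_lt_one_of_mem hz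
  obtain ⟨-, -, d0, -, -⟩ := h.comp_sub.2 z ⟨hz.1, by linarith [hz.2]⟩
  have := hasDerivAt_quotient (α := α) (f₁ := fun z => -ps (derivCoeff c) (1 - z))
    (weight_arg_pos hz) d0 (h.d0 z hz') (ps_pos hc hpos hz.1.le hz.2).ne'
  rwa [hw z hz] at this

/-- A solution whose Wronskian with a regular solution vanishes at the end point is a multiple. -/
theorem eq_mul_of_wronskian {ε α : ℝ} {a b : ℝ} {f f₁ g g₁ : ℝ → ℝ} {l : Filter ℝ} [l.NeBot]
    (hl : ∀ᶠ x in l, x ∈ Set.Ioo a b)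
    (hp : ∀ x ∈ Set.Ioo a b, 0 < x * (1 - ε * x))
    (hf : ∀ x ∈ Set.Ioo a b, HasDerivAt f (f₁ x) x) (hg : ∀ x ∈ Set.Ioo a b, HasDerivAt g (g₁ x) x)
    (hg0 : ∀ x ∈ Set.Ioo a b, g x ≠ 0)
    (hw : ∀ x ∈ Set.Ioo a b,
      HasDerivAt (fun x => eulerWeight ε (α + 1) x * (f₁ x * g x - f x * g₁ x)) 0 x)
    (h0 : Tendsto (fun x => eulerWeight ε (α + 1) x * (f₁ x * g x - f x * g₁ x)) l (𝓝 0)) :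
    ∃ γ : ℝ, ∀ x ∈ Set.Ioo a b, f x = γ * g x := by
  obtain ⟨x₀, hx₀⟩ := hl.exists
  have hz : ∀ x ∈ Set.Ioo a b, eulerWeight ε (α + 1) x * (f₁ x * g x - f x * g₁ x) = 0 := by
    intro x hx
    refine tendsto_nhds_unique (tendsto_const_nhds.congr' ?_) h0
    filter_upwards [hl] with y hy using const_of_hasDerivAt_zero hw hx hy
  have hq : ∀ x ∈ Set.Ioo a b, HasDerivAt (fun x => f x / g x) 0 x := by
    intro x hx
    have := hasDerivAt_quotient (α := α) (hp x hx) (hf x hx) (hg x hx) (hg0 x hx)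
    rwa [hz x hx, zero_div] at this
  refine ⟨f x₀ / g x₀, fun x hx => ?_⟩
  have := const_of_hasDerivAt_zero hq hx hx₀
  rw [← this, div_mul_cancel₀ _ (hg0 x hx)]

/-- The solutions of the fourth order equation on `(0, 1)` which are regular at `1`, and the
solution among them with the singularity of the Green's function at `0`. -/
theorem exists_regular_basis {n : ℕ} (hn : 2 ≤ n) {μ κ : ℝ} (hμ : 0 < μ) (hκ : 0 < κ) {G : ℝ}
    (hG : G ≠ 0) :
    ∃ v v₁ w w₁ g g₁ : ℝ → ℝ,
      (∀ z ∈ Set.Ioo (0 : ℝ) 2, AnalyticAt ℝ v z ∧ AnalyticAt ℝ v₁ z ∧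
        AnalyticAt ℝ w z ∧ AnalyticAt ℝ w₁ z ∧ AnalyticAt ℝ g z ∧ AnalyticAt ℝ g₁ z) ∧
      (∀ z ∈ Set.Ioo (0 : ℝ) 1, 0 < v z) ∧ (∀ z ∈ Set.Ioo (0 : ℝ) 1, w z ≠ 0) ∧
      IsEulerSystemOn 1 ((n : ℝ) / 2 + 1) μ κ (Set.Ioo 0 1) v v₁ 0 0 ∧
      IsEulerSystemOn 1 ((n : ℝ) / 2 + 1) μ κ (Set.Ioo 0 1) g g₁ w w₁ ∧
      (∃ A ≠ 0, Tendsto (fun x => x ^ ((n : ℝ) / 2) * v x) (𝓝[>] 0) (𝓝 A)) ∧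
      ∃ a b : ℝ → ℝ, AnalyticAt ℝ a 0 ∧ AnalyticAt ℝ b 0 ∧
        (n ≠ 2 → a 0 = G) ∧ (n = 2 → b 0 = -G) ∧
        ∀ᶠ x in 𝓝[>] (0 : ℝ), g x = x ^ (1 - (n : ℝ) / 2) * a x + b x * parityLog n x := by
  have hn' : (2 : ℝ) ≤ n := by exact_mod_cast hn
  set α : ℝ := (n : ℝ) / 2 with hα
  have hα0 : 0 ≤ α := by linarith
  obtain ⟨c, hc, hc0, hcpos, hcs⟩ := exists_gaussSolution_pos hα0 hκ
  obtain ⟨d, hd, hd0, hdpos, hds⟩ := exists_gaussSolution_pos hα0 hμ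
  obtain ⟨R, F, F₁, F₂, hF, hR⟩ := exists_gaussSolution_forced hα0 μ hc
  obtain ⟨C, hC, hQ⟩ := gauss_quotient hc hcpos hcs
  obtain ⟨D, hD, hQd⟩ := gauss_quotient hd hdpos hds
  obtain ⟨D', hD', hwd⟩ := wronskian_gauss_neg hd hdpos hds
  have hev : ∀ᶠ x in 𝓝[>] (0 : ℝ), x ∈ Set.Ioo (0 : ℝ) 1 := Ioo_mem_nhdsGT one_pos
  have anc : AnalyticAt ℝ (ps c) 0 := ps_analyticAt hc (by simp)
  have and : AnalyticAt ℝ (ps d) 0 := ps_analyticAt hd (by simp)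
  have c0 : ps c 0 = 1 := by rw [ps_zero_arg, hc0]
  have d0 : ps d 0 = 1 := by rw [ps_zero_arg, hd0]
  obtain ⟨A, B, hA, hB, -, hWform⟩ := frobenius_of_quotient hn 1 anc c0 (hev.mono hQ)
    (W := fun z => ps c (1 - z)) (by
      filter_upwards [hev] with x hx
      rw [mul_div_cancel₀ _ (ps_pos hc hcpos hx.1.le hx.2).ne'])
  obtain ⟨A', B', hA', hB', hA'0, hvform⟩ := frobenius_of_quotient hn 1 and d0 (hev.mono hQd)
    (W := fun z => ps d (1 - z)) (by
      filter_upwards [hev] with x hx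
      rw [mul_div_cancel₀ _ (ps_pos hd hdpos hx.1.le hx.2).ne'])
  -- The Wronskian of the forced solution with `ps d`. Its limit j₀ at 0 measures the x^(-n/2) part
  -- that must be removed.
  have Jd : ∀ x ∈ Set.Ioo (0 : ℝ) 1, HasDerivAt (fun z => eulerWeight 1 (α + 1) z *
      (-F₁ (1 - z) * ps d z - F (1 - z) * ps (derivCoeff d) z))
      (eulerWeight 1 α x * ((1 - 2 * 1 * x) * ps c (1 - x) * ps d x)) x := by
    intro z hz
    have hz' := abs_lt_one_of_mem hz
    have hz2 : z ∈ Set.Ioo (0 : ℝ) 2 := ⟨hz.1, by linarith [hz.2]⟩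
    obtain ⟨-, -, D0, D1, e⟩ := hF.comp_sub.2 z hz2
    have := hasDerivAt_wronskian (α := α) (weight_arg_pos hz) D0 D1 (hds.d0 z hz') (hds.d1 z hz') e
      (b := μ * ps d z)
      (by have := hds.ode z hz'; simp only [Pi.zero_apply] at this; linear_combination this)
    refine this.congr_deriv ?_
    rw [hR (1 - z) (by rw [abs_lt]; constructor <;> linarith [hz.1, hz.2])]
    ring
  obtain ⟨-, -, -, -, -, -, -, j₀, hj₀, -⟩ := exists_limit_integral hn 1 hA hB hWform and d0
    (hev.mono Jd)
  have hr := leadRatio_pos hn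
  -- γ normalizes the leading coefficient to G. β makes γ j₀ + β D' = 0, so that adding β times the
  -- homogeneous solution cancels the x^(-n/2) term.
  set γ : ℝ := G / (leadRatio n * C) with hγ
  set β : ℝ := -γ * j₀ / D' with hβ
  have sysv : IsEulerSystemOn 1 (α + 1) μ κ (Set.Ioo 0 1) (fun z => ps d (1 - z))
      (fun z => -ps (derivCoeff d) (1 - z)) 0 0 := by
    refine ⟨fun z hz => ?_, fun z hz => ?_, fun z hz => ?_, fun z hz => ?_⟩
    · exact (hds.comp_sub.2 z ⟨hz.1, by linarith [hz.2]⟩).2.2.1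
    · obtain ⟨-, -, -, D1, e⟩ := hds.comp_sub.2 z ⟨hz.1, by linarith [hz.2]⟩
      refine D1.congr_deriv ?_
      rw [eq_div_iff (weight_arg_pos hz).ne']
      simp only [Pi.zero_apply] at e ⊢
      linear_combination e
    · exact hasDerivAt_const z 0
    · exact (hasDerivAt_const z 0).congr_deriv (by simp)
  have sysg : IsEulerSystemOn 1 (α + 1) μ κ (Set.Ioo 0 1)
      (fun z => γ * F (1 - z) + β * ps d (1 - z))
      (fun z => γ * -F₁ (1 - z) + β * -ps (derivCoeff d) (1 - z))
      (fun z => γ * ps c (1 - z)) (fun z => γ * -ps (derivCoeff c) (1 - z)) := by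
    refine ⟨fun z hz => ?_, fun z hz => ?_, fun z hz => ?_, fun z hz => ?_⟩ <;>
      obtain ⟨-, -, D0, D1, e⟩ := hds.comp_sub.2 z ⟨hz.1, by linarith [hz.2]⟩ <;>
      obtain ⟨-, -, D0', D1', e'⟩ := hF.comp_sub.2 z ⟨hz.1, by linarith [hz.2]⟩ <;>
      obtain ⟨-, -, D0'', D1'', e''⟩ := hcs.comp_sub.2 z ⟨hz.1, by linarith [hz.2]⟩
    · exact (D0'.const_mul γ).add (D0.const_mul β)
    · refine ((D1'.const_mul γ).add (D1.const_mul β)).congr_deriv ?_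
      rw [eq_div_iff (weight_arg_pos hz).ne']
      rw [hR (1 - z) (by rw [abs_lt]; constructor <;> linarith [hz.1, hz.2])] at e'
      simp only [Pi.zero_apply] at e
      linear_combination γ * e' + β * e
    · exact D0''.const_mul γ
    · refine (D1''.const_mul γ).congr_deriv ?_
      rw [eq_div_iff (weight_arg_pos hz).ne']
      simp only [Pi.zero_apply] at e''
      linear_combination γ * e''
  have hγ0 : γ ≠ 0 := div_ne_zero hG (mul_ne_zero hr.ne' hC.ne)
  refine ⟨_, _, _, _, _, _, ?_, ?_, ?_, sysv, sysg, ⟨A' 0, ?_, ?_⟩, ?_⟩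
  · intro z hz
    obtain ⟨v0, v1, -⟩ := hds.comp_sub.2 z hz
    obtain ⟨f0, f1, -⟩ := hF.comp_sub.2 z hz
    obtain ⟨w0, w1, -⟩ := hcs.comp_sub.2 z hz
    exact ⟨v0, v1, analyticAt_const.mul w0, analyticAt_const.mul w1,
      (analyticAt_const.mul f0).add (analyticAt_const.mul v0),
      (analyticAt_const.mul f1).add (analyticAt_const.mul v1)⟩
  · exact fun z hz => ps_pos hd hdpos (by linarith [hz.2]) (by linarith [hz.1])
  · exact fun z hz => mul_ne_zero hγ0
      (ps_pos hc hcpos (by linarith [hz.2]) (by linarith [hz.1])).ne'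
  · rw [hA'0]
    exact div_ne_zero (neg_ne_zero.2 hD.ne) (by linarith)
  · exact tendsto_rpow_mul_of_frobenius hn hA' hB' hvform
  · have key := frobenius_green hn 1 (g := ps c) (u := ps d)
      (W := fun z => γ * ps c (1 - z)) (Q := fun z => γ * (ps c (1 - z) / ps c z)) (c := γ * C)
      (f := fun z => γ * F (1 - z) + β * ps d (1 - z))
      (q := fun z => (γ * F (1 - z) + β * ps d (1 - z)) / ps d z)
      (J := fun z => eulerWeight 1 (α + 1) z *
        ((γ * -F₁ (1 - z) + β * -ps (derivCoeff d) (1 - z)) * ps d z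
          - (γ * F (1 - z) + β * ps d (1 - z)) * ps (derivCoeff d) z))
      anc c0 and d0
    obtain ⟨a, b, ha, hb, ha0, hb0, hab⟩ := key (by
        filter_upwards [hev] with x hx
        exact ((hQ x hx).const_mul γ).congr_deriv (by ring)) (by
        filter_upwards [hev] with x hx
        have := (ps_pos hc hcpos hx.1.le hx.2).ne'
        field_simp) (by
        filter_upwards [hev] with x hx
        have h2 : HasDerivAt (fun z => eulerWeight 1 (α + 1) z *
          (-ps (derivCoeff d) (1 - z) * ps d z - ps d (1 - z) * ps (derivCoeff d) z)) 0 x := by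
          refine (hasDerivAt_const x D').congr_of_eventuallyEq ?_
          filter_upwards [Ioo_mem_nhds hx.1 hx.2] with y hy using hwd y hy
        refine ((((Jd x hx).const_mul γ).add (h2.const_mul β)).congr_deriv ?_).congr_of_eventuallyEq
          (Eventually.of_forall fun y => ?_)
        · ring
        · simp only [Pi.add_apply]; ring) (by
        have h1 := (hj₀.const_mul γ).add_const (β * D')
        have h2 : γ * j₀ + β * D' = 0 := by rw [hβ]; have := hD'.ne; field_simp; ring
        rw [h2] at h1
        refine h1.congr' ?_
        filter_upwards [hev] with x hx
        rw [← hwd x hx]; ring) (by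
        filter_upwards [hev] with x hx
        exact hasDerivAt_quotient
          (f₁ := fun z => γ * -F₁ (1 - z) + β * -ps (derivCoeff d) (1 - z)) (weight_arg_pos hx) (sysg.d0 x hx)
          (hds.d0 x (abs_lt_one_of_mem hx)) (ps_pos hd hdpos hx.1.le hx.2).ne') (by
        filter_upwards [hev] with x hx
        rw [mul_div_cancel₀ _ (ps_pos hd hdpos hx.1.le hx.2).ne'])
    refine ⟨a, b, ha, hb, fun h => ?_, fun h => ?_, hab⟩
    · rw [ha0 h, hγ]; have := hC.ne; field_simp
    · rw [hb0 h, hγ]; have := hC.ne; field_simp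

/-! ### Uniqueness on (0,1). -/

theorem tendsto_eulerWeight_one {α : ℝ} (hα : 0 < α + 1) :
    Tendsto (eulerWeight 1 (α + 1)) (𝓝[<] 1) (𝓝 0) := by
  have h : ContinuousAt (eulerWeight 1 (α + 1)) 1 := by
    unfold eulerWeight
    exact ContinuousAt.rpow_const (by fun_prop) (Or.inr hα.le)
  have := h.tendsto.mono_left (nhdsWithin_le_nhds (s := Set.Iio 1))
  simpa [eulerWeight, Real.zero_rpow hα.ne'] using this

/-- Wronskians of functions with continuous derivatives at `1` vanish there. -/
theorem tendsto_wronskian_one {α : ℝ} (hα : 0 < α + 1) {f f₁ g g₁ : ℝ → ℝ}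
    (hf : ContinuousAt f 1) (hf₁ : ContinuousAt f₁ 1) (hg : ContinuousAt g 1)
    (hg₁ : ContinuousAt g₁ 1) :
    Tendsto (fun x => eulerWeight 1 (α + 1) x * (f₁ x * g x - f x * g₁ x)) (𝓝[<] 1) (𝓝 0) := by
  have h : ContinuousAt (fun x => f₁ x * g x - f x * g₁ x) 1 := by fun_prop
  have := (tendsto_eulerWeight_one hα).mul (h.tendsto.mono_left (nhdsWithin_le_nhds (s := Set.Iio 1)))
  simpa using this

theorem mul_div_sub_add {q : ℝ} (hq : 0 < q) (z t : ℝ) : q * ((z - t) / q) + t = z := by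
  rw [mul_div_cancel₀ _ hq.ne']; ring

theorem eulerMu_pos {n p : ℕ} (hp : p ≤ n) {ℓ : ℝ} (h : 0 < ℓ ∨ (0 ≤ ℓ ∧ p ≠ 0 ∧ p ≠ n)) :
    0 < eulerMu n p ℓ := by
  have hp' : (p : ℝ) ≤ n := by exact_mod_cast hp
  have h0 : (0 : ℝ) ≤ p := p.cast_nonneg
  unfold eulerMu
  rcases h with h | ⟨h, h1, -⟩
  · have : 0 ≤ (p : ℝ) * (n + 1 - p) := mul_nonneg h0 (by linarith)
    linarith
  · have : (0 : ℝ) < p := by exact_mod_cast Nat.pos_of_ne_zero h1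
    have : 0 < (p : ℝ) * (n + 1 - p) := mul_pos this (by linarith)
    linarith

theorem eulerKappa_pos {n p : ℕ} (hp : p ≤ n) {ℓ : ℝ} (h : 0 < ℓ ∨ (0 ≤ ℓ ∧ p ≠ 0 ∧ p ≠ n)) :
    0 < eulerKappa n p ℓ := by
  have hp' : (p : ℝ) ≤ n := by exact_mod_cast hp
  have h0 : (0 : ℝ) ≤ p := p.cast_nonneg
  unfold eulerKappa
  rcases h with h | ⟨h, -, h1⟩
  · have : 0 ≤ ((p : ℝ) + 1) * (n - p) := mul_nonneg (by linarith) (by linarith)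
    linarith
  · have : (p : ℝ) < n := by exact_mod_cast lt_of_le_of_ne hp h1
    have : 0 < ((p : ℝ) + 1) * (n - p) := mul_pos (by linarith) (by linarith)
    linarith

theorem IsPhiMinus.analyticOnNhd {n p : ℕ} {k ℓ : ℝ} {Ψ : ℝ → ℝ} (h : IsPhiMinus n p k ℓ Ψ) :
    AnalyticOnNhd ℝ Ψ (Set.Ioc 0 1) := by
  intro z hz
  have h1 := (analyticAt_rpow_const hz.1.ne' (1 - (n : ℝ) / 2)).mul (h.2.2 z hz)
  refine h1.congr ?_
  filter_upwards [lt_mem_nhds hz.1] with y hy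
  simp only [Pi.mul_apply]
  rw [← mul_assoc, ← Real.rpow_add hy]
  ring_nf
  simp

/-- On (1/2,1), W can be formed from Ψ and stays continuous up to 1 with its derivative. The weight
vanishes at 1, hence so does the Wronskian of W and w, and W = a w. The same argument applied to Ψ -
a g gives a multiple of v. The identity theorem carries the relation through 1/2 to all of (0,1]. -/
theorem phiMinus_eq_combination {n p : ℕ} (hn : 2 ≤ n) {k ℓ : ℝ} {v v₁ w w₁ g g₁ Ψ : ℝ → ℝ}
    (han : ∀ z ∈ Set.Ioo (0 : ℝ) 2, AnalyticAt ℝ v z ∧ AnalyticAt ℝ v₁ z ∧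
        AnalyticAt ℝ w z ∧ AnalyticAt ℝ w₁ z ∧ AnalyticAt ℝ g z ∧ AnalyticAt ℝ g₁ z)
    (hv0 : ∀ z ∈ Set.Ioo (0 : ℝ) 1, 0 < v z) (hw0 : ∀ z ∈ Set.Ioo (0 : ℝ) 1, w z ≠ 0)
    (hv : IsEulerSystemOn 1 ((n : ℝ) / 2 + 1) (eulerMu n p ℓ) (eulerKappa n p ℓ)
      (Set.Ioo 0 1) v v₁ 0 0)
    (hg : IsEulerSystemOn 1 ((n : ℝ) / 2 + 1) (eulerMu n p ℓ) (eulerKappa n p ℓ)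
      (Set.Ioo 0 1) g g₁ w w₁)
    (h : IsPhiMinus n p k ℓ Ψ) :
    ∃ a b : ℝ, ∀ z ∈ Set.Ioc (0 : ℝ) 1, Ψ z = a * g z + b * v z := by
  have hn' : (2 : ℝ) ≤ n := by exact_mod_cast hn
  have hα : 0 < (n : ℝ) / 2 + 1 := by linarith
  have hΨ := h.analyticOnNhd
  have hsub : Set.Ioo (1 / 2 : ℝ) 1 ⊆ Set.Ioo 0 1 := Set.Ioo_subset_Ioo_left (by norm_num)
  have hfs : IsFuchsSolutionOn n p ℓ (Set.Ioo (1 / 2) 1) Ψ :=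
    ⟨h.1.1.mono hsub, fun z hz => h.1.2 z (hsub hz)⟩
  have hsys := exists_system_of_isFuchsSolutionOn isOpen_Ioo
    (fun z hz => (hsub hz).1.ne') (fun z hz => (hsub hz).2.ne) (fun z hz => hz.1.ne') hfs
  have hΨ1 : AnalyticAt ℝ Ψ 1 := hΨ 1 ⟨one_pos, le_rfl⟩
  have hit : ∀ k, ContinuousAt (iteratedDeriv k Ψ) 1 := fun k => by
    rw [iteratedDeriv_eq_iterate]
    exact (hΨ1.iterated_deriv k).continuousAt
  have c0 := hΨ1.continuousAt
  have c1 := hit 1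
  have c2 := hit 2
  have c3 := hit 3
  have hs : ContinuousAt (fun z : ℝ => 1 - 2 * z) 1 := by fun_prop
  have hs0 : (1 - 2 * (1 : ℝ)) ≠ 0 := by norm_num
  have hW : ContinuousAt (fun z => (z * (1 - z) * iteratedDeriv 2 Ψ z
        + (n / 2 + 1) * ((1 - 2 * z) * iteratedDeriv 1 Ψ z) - eulerMu n p ℓ * Ψ z) / (1 - 2 * z))
        1 := ContinuousAt.div (by fun_prop) hs hs0
  have hW₁ : ContinuousAt (fun z => (z * (1 - z) * iteratedDeriv 3 Ψ z
        + (n / 2 + 1 + 1) * ((1 - 2 * z) * iteratedDeriv 2 Ψ z)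
        - (2 * (n / 2 + 1) + eulerMu n p ℓ) * iteratedDeriv 1 Ψ z
        + 2 * ((z * (1 - z) * iteratedDeriv 2 Ψ z
        + (n / 2 + 1) * ((1 - 2 * z) * iteratedDeriv 1 Ψ z) - eulerMu n p ℓ * Ψ z) / (1 - 2 * z)))
          / (1 - 2 * z)) 1 := by
    refine ContinuousAt.div ?_ hs hs0
    exact ContinuousAt.add (by fun_prop) (hW.const_mul 2)
  generalize (fun z => (z * (1 - z) * iteratedDeriv 2 Ψ z
        + (n / 2 + 1) * ((1 - 2 * z) * iteratedDeriv 1 Ψ z) - eulerMu n p ℓ * Ψ z) / (1 - 2 * z))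
        = W at *
  generalize (fun z => (z * (1 - z) * iteratedDeriv 3 Ψ z
        + (n / 2 + 1 + 1) * ((1 - 2 * z) * iteratedDeriv 2 Ψ z)
        - (2 * (n / 2 + 1) + eulerMu n p ℓ) * iteratedDeriv 1 Ψ z
        + 2 * ((z * (1 - z) * iteratedDeriv 2 Ψ z
        + (n / 2 + 1) * ((1 - 2 * z) * iteratedDeriv 1 Ψ z) - eulerMu n p ℓ * Ψ z) / (1 - 2 * z)))
          / (1 - 2 * z)) = W₁ at *
  have hl : ∀ᶠ x in 𝓝[<] (1 : ℝ), x ∈ Set.Ioo (1 / 2 : ℝ) 1 := Ioo_mem_nhdsLT (by norm_num)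
  obtain ⟨a1, a2, a3, a4, a5, a6⟩ := han 1 (by norm_num)
  obtain ⟨a, ha⟩ := eq_mul_of_wronskian (ε := 1) (α := (n : ℝ) / 2) (f := W) (f₁ := W₁) (g := w)
    (g₁ := w₁) hl (fun x hx => weight_arg_pos (hsub hx)) hsys.e0 (fun x hx => hg.e0 x (hsub hx))
    (fun x hx => hw0 x (hsub hx))
    (fun x hx => (hasDerivAt_wronskian (weight_arg_pos (hsub hx)) (hsys.e0 x hx) (hsys.e1 x hx)
      (hg.e0 x (hsub hx)) (hg.e1 x (hsub hx)) (mul_div_sub_add (weight_arg_pos (hsub hx)) _ _)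
      (mul_div_sub_add (weight_arg_pos (hsub hx)) _ _)).congr_deriv (by ring))
    (tendsto_wronskian_one hα hW hW₁ a3.continuousAt a4.continuousAt)
  obtain ⟨b, hb⟩ := eq_mul_of_wronskian (ε := 1) (α := (n : ℝ) / 2) (f := fun z => Ψ z - a * g z)
    (f₁ := fun z => iteratedDeriv 1 Ψ z - a * g₁ z) (g := v)
    (g₁ := v₁) hl (fun x hx => weight_arg_pos (hsub hx))
    (fun x hx => (hsys.d0 x hx).sub ((hg.d0 x (hsub hx)).const_mul a))
    (fun x hx => hv.d0 x (hsub hx)) (fun x hx => (hv0 x (hsub hx)).ne')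
    (fun x hx => by
      have hp := weight_arg_pos (hsub hx)
      have e1 := mul_div_sub_add hp (1 * (eulerMu n p ℓ * Ψ x + (1 - 2 * 1 * x) * W x))
        (((n : ℝ) / 2 + 1) * (1 - 2 * 1 * x) * iteratedDeriv 1 Ψ x)
      have e2 := mul_div_sub_add hp (1 * (eulerMu n p ℓ * g x + (1 - 2 * 1 * x) * w x))
        (((n : ℝ) / 2 + 1) * (1 - 2 * 1 * x) * g₁ x)
      have e3 := mul_div_sub_add hp
        (1 * (eulerMu n p ℓ * v x + (1 - 2 * 1 * x) * (0 : ℝ → ℝ) x))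
        (((n : ℝ) / 2 + 1) * (1 - 2 * 1 * x) * v₁ x)
      refine (hasDerivAt_wronskian (α := (n : ℝ) / 2) (f := fun z => Ψ z - a * g z)
        (f₁ := fun z => iteratedDeriv 1 Ψ z - a * g₁ z)
        (a := eulerMu n p ℓ * (Ψ x - a * g x)) (b := eulerMu n p ℓ * v x) hp
        ((hsys.d0 x hx).sub ((hg.d0 x (hsub hx)).const_mul a))
        ((hsys.d1 x hx).sub ((hg.d1 x (hsub hx)).const_mul a))
        (hv.d0 x (hsub hx)) (hv.d1 x (hsub hx)) ?_ ?_).congr_deriv (by ring)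
      · rw [ha x hx] at e1 ⊢
        linear_combination e1 - a * e2
      · simp only [Pi.zero_apply] at e3 ⊢
        linear_combination e3)
    (tendsto_wronskian_one hα (c0.sub (a5.continuousAt.const_mul a))
      (c1.sub (a6.continuousAt.const_mul a)) a1.continuousAt a2.continuousAt)
  refine ⟨a, b, ?_⟩
  have hR : AnalyticOnNhd ℝ (fun z => a * g z + b * v z) (Set.Ioc 0 1) := fun z hz => by
    obtain ⟨b1, -, -, -, b5, -⟩ := han z ⟨hz.1, by linarith [hz.2]⟩
    exact (analyticAt_const.mul b5).add (analyticAt_const.mul b1)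
  refine hΨ.eqOn_of_preconnected_of_eventuallyEq hR (convex_Ioc 0 1).isPreconnected
    (z₀ := 3 / 4) (by norm_num) ?_
  filter_upwards [Ioo_mem_nhds (by norm_num : (1 / 2 : ℝ) < 3 / 4) (by norm_num : (3 / 4 : ℝ) < 1)]
    with z hz
  linarith [hb z hz]

theorem exists_unique_phiMinus {n p : ℕ} (hn : 2 ≤ n) (hp : p ≤ n) {k : ℝ} (hk : k ≠ 0) {ℓ : ℝ}
    (hℓ : 0 < ℓ ∨ (0 ≤ ℓ ∧ p ≠ 0 ∧ p ≠ n)) :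
    ∃ Φ : ℝ → ℝ, IsPhiMinus n p k ℓ Φ ∧ HasFrobeniusFormAtZero n Φ ∧
        ∀ Ψ : ℝ → ℝ, IsPhiMinus n p k ℓ Ψ → Set.EqOn Ψ Φ (Set.Ioc 0 1) := by
  have hC := greenCoeff_ne_zero hn hk
  obtain ⟨v, v₁, w, w₁, g, g₁, han, hv0, hw0, hv, hg, ⟨A, hA, hvA⟩, a, b, ha, hb, ha0, hb0, hab⟩ :=
    exists_regular_basis hn (eulerMu_pos hp hℓ) (eulerKappa_pos hp hℓ) hC
  have hO := sub_singLead_isBigO hn ha hb ha0 hb0 hab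
  refine ⟨g, ⟨?_, ?_, ?_⟩, ⟨a, b, ha, hb, ?_⟩, ?_⟩
  · exact isFuchsSolutionOn_of_system isOpen_Ioo (fun z hz => hz.1.ne') (fun z hz => hz.2.ne) hg
  · exact (hasGreenSingularity_iff n k g).2 hO
  · intro z hz
    exact (analyticAt_rpow_const hz.1.ne' _).mul (han z ⟨hz.1, by linarith [hz.2]⟩).2.2.2.2.1
  · filter_upwards [hab, self_mem_nhdsWithin] with z hz hz0
    have e1 : z ^ ((n : ℝ) / 2 - 1) * z ^ (1 - (n : ℝ) / 2) = 1 := by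
      rw [← Real.rpow_add hz0]; simp
    rw [hz, ← parityLog]
    linear_combination a z * e1
  · intro Ψ hΨ
    obtain ⟨s, t, hst⟩ := phiMinus_eq_combination hn han hv0 hw0 hv hg hΨ
    have hΨO := (hasGreenSingularity_iff n k Ψ).1 hΨ.2.1
    have h1 : (fun x => (s - 1) * g x + t * v x) =O[𝓝[>] 0] greenRemainder n := by
      refine (hΨO.sub hO).congr' ?_ EventuallyEq.rfl
      filter_upwards [Ioo_mem_nhdsGT (zero_lt_one' ℝ)] with x hx
      rw [hst x ⟨hx.1, hx.2.le⟩]; ring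
    obtain ⟨h2, h3⟩ := coeffs_eq_zero_of_isBigO hn hC hA hO hvA h1
    intro z hz
    rw [hst z hz, h3, sub_eq_zero.1 h2]; ring

/-! ### Regular solutions on the half line and power barriers. -/

/-- A positive solution on the half line of `x (1 + x) g'' + (α + 1) (1 + 2 x) g' + κ g = 0`
which is analytic at `0`. -/
structure IsRegularSolution (α κ : ℝ) (g g₁ g₂ : ℝ → ℝ) : Prop where
  an : AnalyticAt ℝ g 0
  one : g 0 = 1
  pos : ∀ x, 0 ≤ x → 0 < g x
  d0 : ∀ x, -(1 / 2) < x → HasDerivAt g (g₁ x) x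
  d1 : ∀ x, -(1 / 2) < x → HasDerivAt g₁ (g₂ x) x
  ode : ∀ x, -(1 / 2) < x →
    x * (1 - -1 * x) * g₂ x + (α + 1) * (1 - 2 * -1 * x) * g₁ x = -(κ * g x)

/-- Pfaff's substitution g = (1+x)^ν F(x/(1+x)) maps x > -1/2 into the unit interval of a Gauss
series. With ν the exponent of faster decay, ν and ν+α are both negative, so the coefficients of F
are positive and g > 0 on the whole half line. -/
theorem exists_isRegularSolution {α A : ℝ} (hα : 0 ≤ α) (hA : 0 ≤ A) :
    ∃ g g₁ g₂ : ℝ → ℝ, IsRegularSolution α ((α + 1 / 2) ^ 2 - A ^ 2) g g₁ g₂ := by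
  set ν : ℝ := -(α + 1 / 2) - A with hν
  have hα' : 0 < α + 1 := by linarith
  set s : ℝ := -2 * ν - α with hs
  set k : ℝ := ν * (ν + α) with hk
  set c : ℕ → ℝ := gaussCoeff (α + 1) s k 0 1 with hc
  have hcs : AbsSeries 1 c :=
    AbsSeries.of_recurrence hα' AbsSeries.zero (gaussCoeff_succ hα' _ _ _ _)
  have hcpos : ∀ j, 0 < c j := fun j => gaussCoeff_pos hα' (by rw [hs, hν]; linarith)
    (by rw [hk, hν]; exact mul_pos_of_neg_of_neg (by linarith) (by linarith)) j
  have hode := fun ζ (hζ : |ζ| < 1) => ps_gauss_ode (s := s) (k := k) hα' AbsSeries.zero 1 hζ hc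
  have e0 : ∀ ζ, ps (0 : ℕ → ℝ) ζ = 0 := fun ζ => by simp [ps]
  have hζ : ∀ x : ℝ, -(1 / 2) < x → |x / (1 + x)| < 1 := fun x hx => by
    have : 0 < 1 + x := by linarith
    rw [abs_div, abs_of_pos this, div_lt_one this, abs_lt]
    constructor <;> linarith
  have hdζ : ∀ x : ℝ, -(1 / 2) < x → HasDerivAt (fun x : ℝ => x / (1 + x)) (1 / (1 + x) ^ 2) x :=
    fun x hx => by
      have : 1 + x ≠ 0 := by linarith
      refine ((hasDerivAt_id x).div ((hasDerivAt_id x).const_add 1) this).congr_deriv ?_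
      simp only [id]; field_simp; ring
  have hdy : ∀ x : ℝ, -(1 / 2) < x →
      HasDerivAt (fun x : ℝ => (1 + x) ^ ν) (ν * ((1 + x) ^ ν / (1 + x))) x := fun x hx => by
    have h0 : 1 + x ≠ 0 := by linarith
    refine (((hasDerivAt_id x).const_add 1).rpow_const (p := ν) (Or.inl h0)).congr_deriv ?_
    simp only [id]; rw [Real.rpow_sub_one h0]; ring
  have hd1y : ∀ x : ℝ, HasDerivAt (fun x : ℝ => 1 + x) 1 x := fun x => (hasDerivAt_id x).const_add 1
  refine ⟨fun x => (1 + x) ^ ν * ps c (x / (1 + x)),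
    fun x => (1 + x) ^ ν * (ν * ps c (x / (1 + x)) / (1 + x)
      + ps (derivCoeff c) (x / (1 + x)) / (1 + x) ^ 2),
    fun x => (1 + x) ^ ν * (ν * (ν - 1) * ps c (x / (1 + x)) / (1 + x) ^ 2
      + 2 * (ν - 1) * ps (derivCoeff c) (x / (1 + x)) / (1 + x) ^ 3
      + ps (derivCoeff (derivCoeff c)) (x / (1 + x)) / (1 + x) ^ 4), ?_, ?_, ?_, ?_, ?_, ?_⟩
  · have h1 : AnalyticAt ℝ (fun x : ℝ => (1 + x) ^ ν) 0 := by
      have := analyticAt_one_sub_rpow (-1) ν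
      simpa using this
    have h2 : AnalyticAt ℝ (fun x : ℝ => x / (1 + x)) 0 :=
      analyticAt_id.div (analyticAt_const.add analyticAt_id) (by simp)
    refine h1.mul (AnalyticAt.comp (g := ps c) (f := fun x : ℝ => x / (1 + x)) ?_ h2)
    exact ps_analyticAt hcs (by simp)
  · simp [ps_zero_arg, hc, gaussCoeff]
  · intro x hx
    have h1 : 0 < 1 + x := by linarith
    exact mul_pos (Real.rpow_pos_of_pos h1 _) (ps_pos hcs hcpos (by positivity)
      ((div_lt_one h1).2 (by linarith)))
  · intro x hx
    have h1 : 1 + x ≠ 0 := by linarith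
    refine ((hdy x hx).mul ((ps_hasDerivAt hcs (hζ x hx)).comp x (hdζ x hx))).congr_deriv ?_
    simp only [Function.comp]
    field_simp
  · intro x hx
    have h1 : 1 + x ≠ 0 := by linarith
    have p0 := (ps_hasDerivAt hcs (hζ x hx)).comp x (hdζ x hx)
    have p1 := (ps_hasDerivAt hcs.deriv (hζ x hx)).comp x (hdζ x hx)
    refine ((hdy x hx).mul (((p0.const_mul ν).div (hd1y x) h1).add
      (p1.div ((hd1y x).pow 2) (pow_ne_zero 2 h1)))).congr_deriv ?_
    simp only [Function.comp, Pi.add_apply, Pi.div_apply, Pi.pow_apply]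
    field_simp
    push_cast
    ring
  · intro x hx
    have h1 : 1 + x ≠ 0 := by linarith
    have := hode _ (hζ x hx)
    rw [e0] at this
    have e2 : x / (1 + x) * (1 - x / (1 + x)) = x / (1 + x) ^ 2 := by field_simp; ring
    rw [e2] at this
    set F := ps c (x / (1 + x))
    set F₁ := ps (derivCoeff c) (x / (1 + x))
    set F₂ := ps (derivCoeff (derivCoeff c)) (x / (1 + x))
    have e3 : x * F₂ + (α + 1 - (s + 1) * (x / (1 + x))) * F₁ * (1 + x) ^ 2 - k * F * (1 + x) ^ 2
        = 0 := by
      field_simp at this ⊢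
      linear_combination this
    have e4 : (s + 1) * (x / (1 + x)) * (1 + x) ^ 2 = (s + 1) * x * (1 + x) := by field_simp
    have e5 : x * F₂ + ((α + 1) * (1 + x) ^ 2 - (s + 1) * x * (1 + x)) * F₁
        - k * F * (1 + x) ^ 2 = 0 := by
      linear_combination e3 + F₁ * e4
    have eα : (α + 1 / 2) ^ 2 - A ^ 2 = -ν ^ 2 - (2 * α + 1) * ν := by rw [hν]; ring
    rw [eα]
    generalize (1 + x) ^ ν = y
    rw [hs, hk] at e5
    clear_value ν
    have e7 := congrArg (fun Z => y / (1 + x) ^ 3 * Z) e5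
    simp only [mul_zero] at e7
    rw [← sub_eq_zero, ← e7]
    field_simp
    ring

theorem neg_weight_arg_pos {x : ℝ} (hx : 0 < x) : 0 < x * (1 - -1 * x) :=
  mul_pos hx (by linarith)

theorem hasDerivAt_one_add_two_mul_rpow (ν : ℝ) {x : ℝ} (hx : -(1 / 2) < x) :
    HasDerivAt (fun x : ℝ => (1 + 2 * x) ^ ν) (2 * ν * (1 + 2 * x) ^ (ν - 1)) x := by
  have h : HasDerivAt (fun x : ℝ => 1 + 2 * x) 2 x := by
    simpa using ((hasDerivAt_id x).const_mul 2).const_add 1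
  refine (h.rpow_const (p := ν) (Or.inl (by linarith))).congr_deriv ?_
  ring

/-- The function (1+2x)^ν solves the equation up to an explicit factor, because (1+2x)² = 1 +
4x(1+x). -/
theorem barrier_identity (α κ ν : ℝ) {x : ℝ} (hx : 0 ≤ x) :
    x * (1 - -1 * x) * (2 * ν * (2 * (ν - 1) * (1 + 2 * x) ^ (ν - 1 - 1)))
        + (α + 1) * (1 - 2 * -1 * x) * (2 * ν * (1 + 2 * x) ^ (ν - 1)) + κ * (1 + 2 * x) ^ ν
      = (1 + 2 * x) ^ ν * (ν * (ν - 1) * (1 - 1 / (1 + 2 * x) ^ 2) + 2 * (α + 1) * ν + κ) := by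
  have h : 1 + 2 * x ≠ 0 := by linarith
  rw [Real.rpow_sub_one h, Real.rpow_sub_one h]
  field_simp
  ring

theorem continuous_eulerWeight {a : ℝ} (ha : 0 ≤ a) (ε : ℝ) : Continuous (eulerWeight ε a) :=
  Continuous.rpow_const (by fun_prop) fun _ => Or.inr ha

section comparison

variable {α κ : ℝ} {g g₁ g₂ : ℝ → ℝ}

theorem IsRegularSolution.continuousOn (hg : IsRegularSolution α κ g g₁ g₂) :
    ContinuousOn g (Set.Ici 0) := fun x hx =>
  (hg.d0 x (by have : (0 : ℝ) ≤ x := hx; linarith)).continuousAt.continuousWithinAt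

/-- By Lagrange's identity the derivative of the Wronskian is a positive weight times -g times the
operator applied to b, hence positive. -/
theorem IsRegularSolution.wronskian_strictMonoOn (hg : IsRegularSolution α κ g g₁ g₂) (hα : 0 ≤ α)
    {b b₁ b₂ : ℝ → ℝ} (hb : ∀ x, -(1 / 2) < x → HasDerivAt b (b₁ x) x)
    (hb₁ : ∀ x, -(1 / 2) < x → HasDerivAt b₁ (b₂ x) x)
    (h : ∀ x, 0 < x →
      x * (1 - -1 * x) * b₂ x + (α + 1) * (1 - 2 * -1 * x) * b₁ x + κ * b x < 0) :
    StrictMonoOn (fun x => eulerWeight (-1) (α + 1) x * (g₁ x * b x - g x * b₁ x)) (Set.Ici 0) := by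
  refine strictMonoOn_of_deriv_pos (convex_Ici 0) ?_ ?_
  · intro x hx
    have hx' : -(1 / 2) < x := by have : (0 : ℝ) ≤ x := hx; linarith
    exact ((continuous_eulerWeight (by linarith) (-1)).continuousAt.mul
      (((hg.d1 x hx').continuousAt.mul (hb x hx').continuousAt).sub
        ((hg.d0 x hx').continuousAt.mul (hb₁ x hx').continuousAt))).continuousWithinAt
  · intro x hx
    rw [interior_Ici] at hx
    have hx0 : 0 < x := hx
    have hx' : -(1 / 2) < x := by linarith
    rw [(hasDerivAt_wronskian (neg_weight_arg_pos hx0) (hg.d0 x hx') (hg.d1 x hx') (hb x hx')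
      (hb₁ x hx') (hg.ode x hx') rfl).deriv]
    refine mul_pos (eulerWeight_pos (neg_weight_arg_pos hx0) _) ?_
    nlinarith [mul_neg_of_pos_of_neg (hg.pos x hx0.le) (h x hx0)]

/-- The Wronskian of a regular solution and a power of `1 + 2 x`. -/
noncomputable def barrierWronskian (α ν : ℝ) (g g₁ : ℝ → ℝ) (x : ℝ) : ℝ :=
  eulerWeight (-1) (α + 1) x * (g₁ x * (1 + 2 * x) ^ ν - g x * (2 * ν * (1 + 2 * x) ^ (ν - 1)))

theorem barrierWronskian_zero (hα : 0 ≤ α) (ν : ℝ) : barrierWronskian α ν g g₁ 0 = 0 := by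
  have : eulerWeight (-1) (α + 1) 0 = 0 := by
    rw [eulerWeight, zero_mul, Real.zero_rpow (by linarith)]
  rw [barrierWronskian, this, zero_mul]

theorem IsRegularSolution.hasDerivAt_div_barrier (hg : IsRegularSolution α κ g g₁ g₂) (ν : ℝ)
    {x : ℝ} (hx : 0 < x) :
    HasDerivAt (fun x => g x / (1 + 2 * x) ^ ν)
      (barrierWronskian α ν g g₁ x / (eulerWeight (-1) (α + 1) x * ((1 + 2 * x) ^ ν) ^ 2)) x :=
  hasDerivAt_quotient (g₁ := fun x => 2 * ν * (1 + 2 * x) ^ (ν - 1)) (neg_weight_arg_pos hx)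
    (hg.d0 x (by linarith)) (hasDerivAt_one_add_two_mul_rpow ν (by linarith))
    (Real.rpow_pos_of_pos (by linarith) _).ne'

theorem IsRegularSolution.continuousOn_div_barrier (hg : IsRegularSolution α κ g g₁ g₂) (ν : ℝ) :
    ContinuousOn (fun x => g x / (1 + 2 * x) ^ ν) (Set.Ici 0) := by
  refine hg.continuousOn.div (fun x hx => ?_) fun x hx => ?_ <;> have hx' : (0 : ℝ) ≤ x := hx
  · exact (hasDerivAt_one_add_two_mul_rpow ν (by linarith)).continuousAt.continuousWithinAt
  · exact (Real.rpow_pos_of_pos (by linarith) _).ne'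

theorem hasDerivAt_deriv_barrier (ν : ℝ) {x : ℝ} (hx : -(1 / 2) < x) :
    HasDerivAt (fun x : ℝ => 2 * ν * (1 + 2 * x) ^ (ν - 1))
      (2 * ν * (2 * (ν - 1) * (1 + 2 * x) ^ (ν - 1 - 1))) x :=
  (hasDerivAt_one_add_two_mul_rpow (ν - 1) hx).const_mul (2 * ν)

/-- The bracket in `barrier_identity` is (ν+α+1/2)² - A² minus the positive quantity ν(ν-1)/(1+2x)²,
hence negative. The Wronskian increases from 0, which makes g/(1+2x)^ν increasing. -/
theorem IsRegularSolution.barrier {A ν : ℝ}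
    (hg : IsRegularSolution α ((α + 1 / 2) ^ 2 - A ^ 2) g g₁ g₂) (hα : 0 ≤ α) (hν : ν < 0)
    (h : (ν + (α + 1 / 2)) ^ 2 ≤ A ^ 2) :
    StrictMonoOn (barrierWronskian α ν g g₁) (Set.Ici 0) := by
  refine hg.wronskian_strictMonoOn hα (fun x hx => hasDerivAt_one_add_two_mul_rpow ν hx)
    (fun x hx => hasDerivAt_deriv_barrier ν hx) fun x hx => ?_
  rw [barrier_identity _ _ _ hx.le]
  refine mul_neg_of_pos_of_neg (Real.rpow_pos_of_pos (by linarith) _) ?_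
  have : 0 < ν * (ν - 1) * (1 / (1 + 2 * x) ^ 2) :=
    mul_pos (mul_pos_of_neg_of_neg hν (by linarith)) (by positivity)
  nlinarith

theorem IsRegularSolution.barrierWronskian_pos {A ν : ℝ}
    (hg : IsRegularSolution α ((α + 1 / 2) ^ 2 - A ^ 2) g g₁ g₂) (hα : 0 ≤ α) (hν : ν < 0)
    (h : (ν + (α + 1 / 2)) ^ 2 ≤ A ^ 2) {x : ℝ} (hx : 0 < x) : 0 < barrierWronskian α ν g g₁ x := by
  have := hg.barrier hα hν h Set.self_mem_Ici hx.le hx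
  rwa [barrierWronskian_zero hα] at this

theorem IsRegularSolution.monotoneOn_div_barrier {A ν : ℝ}
    (hg : IsRegularSolution α ((α + 1 / 2) ^ 2 - A ^ 2) g g₁ g₂) (hα : 0 ≤ α) (hν : ν < 0)
    (h : (ν + (α + 1 / 2)) ^ 2 ≤ A ^ 2) :
    MonotoneOn (fun x => g x / (1 + 2 * x) ^ ν) (Set.Ici 0) := by
  refine monotoneOn_of_deriv_nonneg (convex_Ici 0) (hg.continuousOn_div_barrier ν) ?_ ?_
  · intro x hx
    rw [interior_Ici] at hx
    exact (hg.hasDerivAt_div_barrier ν hx).differentiableAt.differentiableWithinAt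
  · intro x hx
    rw [interior_Ici] at hx
    rw [(hg.hasDerivAt_div_barrier ν hx).deriv]
    have := hg.barrierWronskian_pos hα hν h hx
    have := eulerWeight_pos (neg_weight_arg_pos hx) (α + 1)
    positivity

theorem IsRegularSolution.barrier_le {A ν : ℝ}
    (hg : IsRegularSolution α ((α + 1 / 2) ^ 2 - A ^ 2) g g₁ g₂) (hα : 0 ≤ α) (hν : ν < 0)
    (h : (ν + (α + 1 / 2)) ^ 2 ≤ A ^ 2) {x : ℝ} (hx : 0 ≤ x) : (1 + 2 * x) ^ ν ≤ g x := by
  have := hg.monotoneOn_div_barrier hα hν h Set.self_mem_Ici hx hx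
  have h0 : (0 : ℝ) < (1 + 2 * x) ^ ν := Real.rpow_pos_of_pos (by linarith) _
  simp only [hg.one, mul_zero, add_zero, Real.one_rpow, div_one] at this
  rwa [le_div_iff₀ h0, one_mul] at this

/-- For ν = -1/2 and κ ≥ α+1 the sign in `barrier_identity` is reversed, so the quotient of g by the
power decreases from 1. This upper bound serves only the borderline exponents. -/
theorem IsRegularSolution.le_barrier (hg : IsRegularSolution α κ g g₁ g₂) (hα : 0 ≤ α)
    (hκ : α + 1 ≤ κ) {x : ℝ} (hx : 0 ≤ x) : g x ≤ (1 + 2 * x) ^ (-(1 / 2) : ℝ) := by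
  set ν : ℝ := -(1 / 2) with hν
  -- The negative of the power is used, to turn the positive sign into the negative one required.
  have hm := hg.wronskian_strictMonoOn hα
    (fun x hx => (hasDerivAt_one_add_two_mul_rpow ν hx).neg)
    (fun x hx => (hasDerivAt_deriv_barrier ν hx).neg) fun x hx => by
      have e := barrier_identity α κ ν hx.le
      have h1 : 0 < (1 + 2 * x) ^ ν := Real.rpow_pos_of_pos (by linarith) _
      have h2 : 1 / (1 + 2 * x) ^ 2 < 1 := by
        rw [div_lt_one (by positivity)]; nlinarith
      have h3 : 0 < (1 + 2 * x) ^ ν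
          * (ν * (ν - 1) * (1 - 1 / (1 + 2 * x) ^ 2) + 2 * (α + 1) * ν + κ) := by
        refine mul_pos h1 ?_
        rw [hν]; nlinarith
      refine lt_of_eq_of_lt ?_ (neg_neg_of_pos h3)
      simp only [Pi.neg_apply]
      linear_combination -e
  have hw : ∀ x, 0 < x → barrierWronskian α ν g g₁ x ≤ 0 := fun x hx => by
    have h1 := hm Set.self_mem_Ici hx.le hx
    have h2 : eulerWeight (-1) (α + 1) 0 = 0 := by
      rw [eulerWeight, zero_mul, Real.zero_rpow (by linarith)]
    simp only [h2, zero_mul, Pi.neg_apply] at h1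
    rw [barrierWronskian]
    nlinarith
  have hanti : AntitoneOn (fun x => g x / (1 + 2 * x) ^ ν) (Set.Ici 0) := by
    refine antitoneOn_of_deriv_nonpos (convex_Ici 0) (hg.continuousOn_div_barrier ν) ?_ ?_
    · intro x hx
      rw [interior_Ici] at hx
      exact (hg.hasDerivAt_div_barrier ν hx).differentiableAt.differentiableWithinAt
    · intro x hx
      rw [interior_Ici] at hx
      rw [(hg.hasDerivAt_div_barrier ν hx).deriv]
      have := eulerWeight_pos (neg_weight_arg_pos hx) (α + 1)
      exact div_nonpos_of_nonpos_of_nonneg (hw x hx) (by positivity)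
  have := hanti Set.self_mem_Ici hx hx
  have h0 : (0 : ℝ) < (1 + 2 * x) ^ ν := Real.rpow_pos_of_pos (by linarith) _
  simp only [hg.one, mul_zero, add_zero, Real.one_rpow, div_one] at this
  rwa [div_le_iff₀ h0, one_mul] at this

end comparison

/-! ### Reduction of order and decay at infinity. -/

/-- Primitives of continuous functions on the positive half line. -/
theorem exists_primitive_Ioi {f : ℝ → ℝ} (hf : ContinuousOn f (Set.Ioi 0)) :
    ∃ F : ℝ → ℝ, ∀ x, 0 < x → HasDerivAt F (f x) x := by
  refine ⟨fun x => ∫ t in (1 : ℝ)..x, f t, fun x hx => ?_⟩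
  have hsub : Set.uIcc 1 x ⊆ Set.Ioi 0 := fun t ht => lt_of_lt_of_le (lt_min one_pos hx) ht.1
  exact intervalIntegral.integral_hasDerivAt_right
    ((hf.mono hsub).intervalIntegrable)
    (hf.stronglyMeasurableAtFilter isOpen_Ioi x hx) (hf.continuousAt (Ioi_mem_nhds hx))

/-- Reduction of order: if `g` solves the homogeneous equation and `φ' = j / (w g²)` with
`j' = V R g` then `g φ` solves the equation with right hand side `R`. -/
theorem hasDerivAt_reduction {ε α κ x R g₂ : ℝ} {g g₁ φ j : ℝ → ℝ} (h : 0 < x * (1 - ε * x))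
    (hg : HasDerivAt g (g₁ x) x) (hg₁ : HasDerivAt g₁ g₂ x)
    (ho : x * (1 - ε * x) * g₂ + (α + 1) * (1 - 2 * ε * x) * g₁ x = -(κ * g x)) (hg0 : g x ≠ 0)
    (hφ : HasDerivAt φ (j x / (eulerWeight ε (α + 1) x * g x ^ 2)) x)
    (hj : HasDerivAt j (eulerWeight ε α x * (R * g x)) x) :
    HasDerivAt (fun x => g x * φ x) (g₁ x * φ x + j x / (eulerWeight ε (α + 1) x * g x)) x ∧
    HasDerivAt (fun x => g₁ x * φ x + j x / (eulerWeight ε (α + 1) x * g x))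
      ((-(κ * (g x * φ x)) + R - (α + 1) * (1 - 2 * ε * x)
        * (g₁ x * φ x + j x / (eulerWeight ε (α + 1) x * g x))) / (x * (1 - ε * x))) x := by
  have hV := (eulerWeight_pos h α).ne'
  have hw := (eulerWeight_pos h (α + 1)).ne'
  constructor
  · refine (hg.mul hφ).congr_deriv ?_
    field_simp
  · refine ((hg₁.mul hφ).add (hj.div ((hasDerivAt_eulerWeight h α).mul hg)
      (mul_ne_zero hw hg0))).congr_deriv ?_
    rw [eq_div_iff h.ne']
    have e : g₂ = (-(κ * g x) - (α + 1) * (1 - 2 * ε * x) * g₁ x) / (x * (1 - ε * x)) := by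
      rw [eq_div_iff h.ne']; linear_combination ho
    rw [e]
    simp only [Pi.mul_apply]
    rw [eulerWeight_add_one h]
    generalize x * (1 - ε * x) = q at h
    have hq := h.ne'
    generalize 1 - 2 * ε * x = s
    field_simp
    ring

theorem exists_tendsto_of_monotoneOn {P : ℝ → ℝ} (h : MonotoneOn P (Set.Ioi 0)) {x₀ M : ℝ}
    (hx₀ : 0 < x₀) (hM : ∀ x, x₀ ≤ x → P x ≤ M) : ∃ L, Tendsto P atTop (𝓝 L) := by
  have hm : Monotone fun x => P (max x x₀) := fun x y hxy =>
    h (lt_max_of_lt_right hx₀) (lt_max_of_lt_right hx₀) (max_le_max_right _ hxy)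
  have hb : BddAbove (Set.range fun x => P (max x x₀)) :=
    ⟨M, by rintro _ ⟨x, rfl⟩; exact hM _ (le_max_right _ _)⟩
  refine ⟨_, (tendsto_atTop_ciSup hm hb).congr' ?_⟩
  filter_upwards [eventually_ge_atTop x₀] with x hx
  rw [max_eq_left hx]

theorem le_of_tendsto_of_monotoneOn {P : ℝ → ℝ} {L : ℝ} (h : MonotoneOn P (Set.Ioi 0))
    (hL : Tendsto P atTop (𝓝 L)) {x : ℝ} (hx : 0 < x) : P x ≤ L := by
  refine ge_of_tendsto hL ?_
  filter_upwards [eventually_ge_atTop x] with y hy using h hx (hx.trans_le hy) hy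

theorem monotoneOn_Ioi_of_hasDerivAt {f f' : ℝ → ℝ} (h : ∀ x, 0 < x → HasDerivAt f (f' x) x)
    (h0 : ∀ x, 0 < x → 0 ≤ f' x) : MonotoneOn f (Set.Ioi 0) := by
  refine monotoneOn_of_deriv_nonneg (convex_Ioi 0)
    (fun x hx => (h x hx).continuousAt.continuousWithinAt) ?_ ?_ <;> rw [interior_Ioi] <;>
    intro x hx
  · exact (h x hx).differentiableAt.differentiableWithinAt
  · rw [(h x hx).deriv]; exact h0 x hx

theorem strictMonoOn_Ioi_of_hasDerivAt {f f' : ℝ → ℝ} (h : ∀ x, 0 < x → HasDerivAt f (f' x) x)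
    (h0 : ∀ x, 0 < x → 0 < f' x) : StrictMonoOn f (Set.Ioi 0) := by
  refine strictMonoOn_of_deriv_pos (convex_Ioi 0)
    (fun x hx => (h x hx).continuousAt.continuousWithinAt) ?_
  rw [interior_Ioi]
  intro x hx
  rw [(h x hx).deriv]; exact h0 x hx

/-- Comparison of the growth of two functions by means of their derivatives. -/
theorem sub_le_sub_of_hasDerivAt_le {f f' g g' : ℝ → ℝ} {a b : ℝ} (hab : a ≤ b)
    (hf : ∀ x ∈ Set.Icc a b, HasDerivAt f (f' x) x) (hg : ∀ x ∈ Set.Icc a b, HasDerivAt g (g' x) x)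
    (h : ∀ x ∈ Set.Icc a b, f' x ≤ g' x) : f b - f a ≤ g b - g a := by
  have hm : MonotoneOn (fun x => g x - f x) (Set.Icc a b) := by
    refine monotoneOn_of_deriv_nonneg (convex_Icc a b)
      (fun x hx => ((hg x hx).sub (hf x hx)).continuousAt.continuousWithinAt) ?_ ?_ <;>
      intro x hx <;> have hx' := interior_subset hx <;> have hd := (hg x hx').sub (hf x hx')
    · exact hd.differentiableAt.differentiableWithinAt
    · have e : deriv (fun x => g x - f x) x = g' x - f' x := hd.deriv
      rw [e]; linarith [h x hx']
  have := hm (Set.left_mem_Icc.2 hab) (Set.right_mem_Icc.2 hab) hab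
  simp only at this
  linarith

section decay

variable {α κ : ℝ} {g g₁ g₂ : ℝ → ℝ}

theorem continuousOn_eulerWeight_neg (a : ℝ) : ContinuousOn (eulerWeight (-1) a) (Set.Ioi 0) :=
  ContinuousOn.rpow_const (by fun_prop) fun _ hx => Or.inl (neg_weight_arg_pos hx).ne'

theorem IsRegularSolution.weight_pos (hg : IsRegularSolution α κ g g₁ g₂) {x : ℝ} (hx : 0 < x) :
    0 < eulerWeight (-1) (α + 1) x * g x ^ 2 :=
  mul_pos (eulerWeight_pos (neg_weight_arg_pos hx) _) (pow_pos (hg.pos x hx.le) 2)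

theorem IsRegularSolution.continuousOn_div (hg : IsRegularSolution α κ g g₁ g₂) {j : ℝ → ℝ}
    (hj : ContinuousOn j (Set.Ioi 0)) :
    ContinuousOn (fun x => j x / (eulerWeight (-1) (α + 1) x * g x ^ 2)) (Set.Ioi 0) :=
  hj.div ((continuousOn_eulerWeight_neg _).mul
    ((hg.continuousOn.mono Set.Ioi_subset_Ici_self).pow 2)) fun _ hx => (hg.weight_pos hx).ne'

/-- The reduction of order which gives the solution of fastest decay at infinity. -/
theorem IsRegularSolution.exists_decaying {A : ℝ}
    (hg : IsRegularSolution α ((α + 1 / 2) ^ 2 - A ^ 2) g g₁ g₂) (hα : 0 ≤ α) :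
    ∃ T : ℝ → ℝ,
      (∀ x, 0 < x → HasDerivAt T (-1 / (eulerWeight (-1) (α + 1) x * g x ^ 2)) x) ∧
      (∀ x, 0 < x → 0 < T x) ∧ Tendsto T atTop (𝓝 0) ∧
      ∀ ν, ν < 0 → (ν + (α + 1 / 2)) ^ 2 ≤ A ^ 2 → ∀ x, 0 < x →
        g x * T x ≤ (1 + 2 * x) ^ ν / barrierWronskian α ν g g₁ x := by
  obtain ⟨P, hP⟩ := exists_primitive_Ioi (hg.continuousOn_div (continuousOn_const (c := (1 : ℝ))))
  have hsm := strictMonoOn_Ioi_of_hasDerivAt hP fun x hx => div_pos one_pos (hg.weight_pos hx)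
  -- With b = (1+2t)^ν and G the Wronskian, (-b/g)' = G/(w g²). Since G increases, 1/(w g²) is at
  -- most (-b/g)'/G(x) for t ≥ x, and integration bounds the increment of P.
  have key : ∀ ν, ν < 0 → (ν + (α + 1 / 2)) ^ 2 ≤ A ^ 2 → ∀ x, 0 < x → ∀ y, x ≤ y →
      P y ≤ P x + (1 + 2 * x) ^ ν / g x / barrierWronskian α ν g g₁ x := by
    intro ν hν h x hx y hxy
    set G := barrierWronskian α ν g g₁ with hG
    have hGx := hg.barrierWronskian_pos hα hν h hx
    have hb : ∀ t, 0 < t → (0 : ℝ) < (1 + 2 * t) ^ ν := fun t ht =>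
      Real.rpow_pos_of_pos (by linarith) _
    have hd : ∀ t, 0 < t → HasDerivAt (fun t => -((1 + 2 * t) ^ ν / g t) / G x)
        (G t / (eulerWeight (-1) (α + 1) t * g t ^ 2) / G x) t := fun t ht => by
      have h1 := (hg.hasDerivAt_div_barrier ν ht).inv
        (div_pos (hg.pos t ht.le) (hb t ht)).ne'
      have h2 : HasDerivAt (fun t => -((1 + 2 * t) ^ ν / g t) / G x) _ t :=
        ((h1.neg).congr_of_eventuallyEq (f₁ := fun t => -((1 + 2 * t) ^ ν / g t))
          (Eventually.of_forall fun s => by simp [inv_div])).div_const (G x)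
      refine h2.congr_deriv ?_
      have := (hb t ht).ne'
      have := (hg.pos t ht.le).ne'
      have := (eulerWeight_pos (neg_weight_arg_pos ht) (α + 1)).ne'
      rw [← hG]
      field_simp
    have := sub_le_sub_of_hasDerivAt_le hxy (fun t ht => hP t (hx.trans_le ht.1))
      (fun t ht => hd t (hx.trans_le ht.1)) fun t ht => by
        have ht0 := hx.trans_le ht.1
        have hGt : G x ≤ G t := (hg.barrier hα hν h).monotoneOn hx.le ht0.le ht.1
        rw [le_div_iff₀ hGx, one_div_mul_eq_div]
        exact div_le_div_of_nonneg_right hGt (hg.weight_pos ht0).le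
    have h3 : 0 ≤ (1 + 2 * y) ^ ν / g y / G x := by
      have hy := hx.trans_le hxy
      exact (div_pos (div_pos (hb y hy) (hg.pos y hy.le)) hGx).le
    simp only [neg_div] at this
    linarith
  -- The exponent -(α+1/2) is admissible whatever A is, since its squared distance to the centre is
  -- 0.
  obtain ⟨L, hL⟩ := exists_tendsto_of_monotoneOn hsm.monotoneOn one_pos
    (key (-(α + 1 / 2)) (by linarith) (by simpa using sq_nonneg A) 1 one_pos)
  refine ⟨fun x => L - P x, fun x hx => ?_, fun x hx => ?_, ?_, fun ν hν h x hx => ?_⟩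
  · refine ((hP x hx).const_sub L).congr_deriv ?_
    rw [neg_div]
  · have h1 := le_of_tendsto_of_monotoneOn hsm.monotoneOn hL (x := x + 1) (by linarith)
    have h2 := hsm hx (show (0 : ℝ) < x + 1 by linarith) (by linarith : x < x + 1)
    simp only
    linarith
  · simpa using hL.const_sub L
  · have h1 : L ≤ P x + (1 + 2 * x) ^ ν / g x / barrierWronskian α ν g g₁ x := by
      refine le_of_tendsto hL ?_
      filter_upwards [eventually_ge_atTop x] with y hy using key ν hν h x hx y hy
    have hgx := hg.pos x hx.le
    have h2 : g x * ((1 + 2 * x) ^ ν / g x / barrierWronskian α ν g g₁ x)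
        = (1 + 2 * x) ^ ν / barrierWronskian α ν g g₁ x := by field_simp
    rw [← h2]
    exact mul_le_mul_of_nonneg_left (by linarith) hgx.le

end decay

/-! ### Growth estimates for the decaying Green's solution. -/

/-- The functions from which a solution with the singularity of the Green's function is built:
the regular solutions `g` and `u` of the two second order equations, the quotient `T` by `g` of the
solution of fastest decay of the first of them, and the integral `J` of the Wronskian of `u` and the
solution of the second equation with right hand side `(1 + 2 x) g T`. -/
structure IsGreenData (n : ℕ) (A B : ℝ) (g g₁ g₂ u u₁ u₂ T J : ℝ → ℝ) : Prop where
  hg : IsRegularSolution ((n : ℝ) / 2) (((n : ℝ) / 2 + 1 / 2) ^ 2 - A ^ 2) g g₁ g₂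
  hu : IsRegularSolution ((n : ℝ) / 2) (((n : ℝ) / 2 + 1 / 2) ^ 2 - B ^ 2) u u₁ u₂
  dT : ∀ x, 0 < x → HasDerivAt T (-1 / (eulerWeight (-1) ((n : ℝ) / 2 + 1) x * g x ^ 2)) x
  posT : ∀ x, 0 < x → 0 < T x
  limT : Tendsto T atTop (𝓝 0)
  boundT : ∀ ν, ν < 0 → (ν + ((n : ℝ) / 2 + 1 / 2)) ^ 2 ≤ A ^ 2 → ∀ x, 0 < x →
    g x * T x ≤ (1 + 2 * x) ^ ν / barrierWronskian ((n : ℝ) / 2) ν g g₁ x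
  dJ : ∀ x, 0 < x → HasDerivAt J
    (eulerWeight (-1) ((n : ℝ) / 2) x * ((1 - 2 * -1 * x) * (g x * T x) * u x)) x
  limJ : Tendsto J (𝓝[>] 0) (𝓝 0)

theorem eventually_pos_nhdsGT : ∀ᶠ x in 𝓝[>] (0 : ℝ), 0 < x := self_mem_nhdsWithin

theorem exists_isGreenData {n : ℕ} (hn : 2 ≤ n) {A B : ℝ} (hA : 0 ≤ A) (hB : 0 ≤ B) :
    ∃ g g₁ g₂ u u₁ u₂ T J, IsGreenData n A B g g₁ g₂ u u₁ u₂ T J := by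
  have hα : (0 : ℝ) ≤ (n : ℝ) / 2 := by positivity
  obtain ⟨g, g₁, g₂, hg⟩ := exists_isRegularSolution hα hA
  obtain ⟨u, u₁, u₂, hu⟩ := exists_isRegularSolution hα hB
  obtain ⟨T, dT, pT, lT, bT⟩ := hg.exists_decaying hα
  have hTc : ContinuousOn T (Set.Ioi 0) := fun x hx => (dT x hx).continuousAt.continuousWithinAt
  have hc : ContinuousOn (fun x => eulerWeight (-1) ((n : ℝ) / 2) x
      * ((1 - 2 * -1 * x) * (g x * T x) * u x)) (Set.Ioi 0) :=
    (continuousOn_eulerWeight_neg _).mul (((Continuous.continuousOn (by fun_prop)).mul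
      ((hg.continuousOn.mono Set.Ioi_subset_Ici_self).mul hTc)).mul
        (hu.continuousOn.mono Set.Ioi_subset_Ici_self))
  obtain ⟨J, hJ⟩ := exists_primitive_Ioi hc
  obtain ⟨P, Q, hP, hQ, -, hW⟩ := frobenius_of_quotient hn (-1) hg.an hg.one
    (eventually_pos_nhdsGT.mono fun x hx => dT x hx)
    (Eventually.of_forall fun x => (rfl : g x * T x = g x * T x))
  obtain ⟨-, -, -, -, -, -, -, D, hD, -⟩ := exists_limit_integral (J := J) hn (-1) hP hQ hW hu.an
    hu.one (eventually_pos_nhdsGT.mono fun x hx => hJ x hx)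
  exact ⟨g, g₁, g₂, u, u₁, u₂, T, fun x => J x - D, hg, hu, dT, pT, lT, bT,
    fun x hx => (hJ x hx).sub_const D, by simpa using hD.sub_const D⟩

theorem tendsto_one_add_two_mul_rpow_atTop {s : ℝ} (hs : s < 0) :
    Tendsto (fun x : ℝ => (1 + 2 * x) ^ s) atTop (𝓝 0) := by
  have h1 : Tendsto (fun x : ℝ => 1 + 2 * x) atTop atTop :=
    tendsto_atTop_add_const_left _ _ (tendsto_id.const_mul_atTop two_pos)
  have h2 := (tendsto_rpow_neg_atTop (y := -s) (by linarith)).comp h1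
  simpa [Function.comp_def] using h2

theorem eulerWeight_neg_le {a x : ℝ} (ha : 0 ≤ a) (hx : 0 < x) :
    eulerWeight (-1) a x ≤ (1 + 2 * x) ^ (2 * a) := by
  have h : 0 < 1 + 2 * x := by linarith
  rw [Real.rpow_mul h.le, Real.rpow_two]
  exact Real.rpow_le_rpow (neg_weight_arg_pos hx).le (by nlinarith) ha

/-- The constant 2/9 is the value of x(1+x)/(1+2x)² at x = 1, and this ratio increases with x. -/
theorem le_eulerWeight_neg {a x : ℝ} (ha : 0 ≤ a) (hx : 1 ≤ x) :
    (2 / 9) ^ a * (1 + 2 * x) ^ (2 * a) ≤ eulerWeight (-1) a x := by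
  have h : 0 < 1 + 2 * x := by linarith
  rw [Real.rpow_mul h.le, Real.rpow_two, ← Real.mul_rpow (by norm_num) (by positivity)]
  exact Real.rpow_le_rpow (by positivity) (by nlinarith) ha

namespace IsGreenData

variable {n : ℕ} {A B : ℝ} {g g₁ g₂ u u₁ u₂ T J : ℝ → ℝ}

theorem dJ_pos (h : IsGreenData n A B g g₁ g₂ u u₁ u₂ T J) {x : ℝ} (hx : 0 < x) :
    0 < eulerWeight (-1) ((n : ℝ) / 2) x * ((1 - 2 * -1 * x) * (g x * T x) * u x) :=
  mul_pos (eulerWeight_pos (neg_weight_arg_pos hx) _) (mul_pos (mul_pos (by linarith)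
    (mul_pos (h.hg.pos x hx.le) (h.posT x hx))) (h.hu.pos x hx.le))

theorem J_pos (h : IsGreenData n A B g g₁ g₂ u u₁ u₂ T J) {x : ℝ} (hx : 0 < x) : 0 < J x := by
  have hm := strictMonoOn_Ioi_of_hasDerivAt h.dJ fun x hx => h.dJ_pos hx
  have h1 : 0 ≤ J (x / 2) := by
    refine le_of_tendsto h.limJ ?_
    filter_upwards [Ioo_mem_nhdsGT (half_pos hx)] with y hy
      using hm.monotoneOn hy.1 (half_pos hx) hy.2.le
  exact h1.trans_lt (hm (half_pos hx) hx (half_lt_self hx))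

/-- Near 0 the weight cancels the x^(-n/2) of gT. Beyond δ the bound on gT with ν = -(α+1/2)-A'
gives the power 2α+1+ν. The truncation A' ≤ α+1/2 keeps the resulting exponent nonnegative, so that
a single power covers both ranges. -/
theorem wronskian_le (h : IsGreenData n A B g g₁ g₂ u u₁ u₂ T J) (hn : 2 ≤ n) {A' : ℝ}
    (hA0 : 0 ≤ A') (hA : A' ≤ A) (hAN : A' ≤ (n : ℝ) / 2 + 1 / 2) :
    ∃ C : ℝ, 0 < C ∧ ∀ x, 0 < x →
      eulerWeight (-1) ((n : ℝ) / 2) x * ((1 - 2 * -1 * x) * (g x * T x))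
        ≤ C * (1 + 2 * x) ^ ((n : ℝ) / 2 + 1 / 2 - A') := by
  have hα : (0 : ℝ) ≤ (n : ℝ) / 2 := by positivity
  obtain ⟨P, Q, hP, hQ, -, hW⟩ := frobenius_of_quotient hn (-1) h.hg.an h.hg.one
    (eventually_pos_nhdsGT.mono fun x hx => h.dT x hx)
    (Eventually.of_forall fun x => (rfl : g x * T x = g x * T x))
  have h1 : Tendsto (fun x : ℝ => (1 - 2 * -1 * x)) (𝓝[>] 0) (𝓝 1) := by
    have : Continuous fun x : ℝ => (1 - 2 * -1 * x) := by fun_prop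
    simpa using (this.tendsto 0).mono_left (nhdsWithin_le_nhds (s := Set.Ioi (0 : ℝ)))
  have h2 := h1.mul (tendsto_eulerWeight_mul hn (-1) hP hQ hW)
  rw [one_mul] at h2
  have h3 := h2.eventually (gt_mem_nhds (show P 0 < |P 0| + 1 by linarith [le_abs_self (P 0)]))
  obtain ⟨δ, hδ, hδ'⟩ := mem_nhdsGT_iff_exists_Ioo_subset.1 h3
  have hδ0 : (0 : ℝ) < δ := hδ
  set ν : ℝ := -((n : ℝ) / 2 + 1 / 2) - A' with hν
  have hν0 : ν < 0 := by linarith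
  have hνA : (ν + ((n : ℝ) / 2 + 1 / 2)) ^ 2 ≤ A ^ 2 := by
    have : ν + ((n : ℝ) / 2 + 1 / 2) = -A' := by rw [hν]; ring
    rw [this]; nlinarith
  have hG := h.hg.barrierWronskian_pos hα hν0 hνA hδ0
  refine ⟨max (|P 0| + 1) (1 / barrierWronskian ((n : ℝ) / 2) ν g g₁ δ),
    lt_max_of_lt_left (by positivity), fun x hx => ?_⟩
  have hx1 : 1 ≤ 1 + 2 * x := by linarith
  rcases lt_or_ge x δ with hxδ | hxδ
  · have h4 := hδ' ⟨hx, hxδ⟩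
    have h5 : (1 : ℝ) ≤ (1 + 2 * x) ^ ((n : ℝ) / 2 + 1 / 2 - A') :=
      Real.one_le_rpow hx1 (by linarith)
    have h6 : eulerWeight (-1) ((n : ℝ) / 2) x * ((1 - 2 * -1 * x) * (g x * T x))
        ≤ |P 0| + 1 := by
      have : (1 - 2 * -1 * x) * (eulerWeight (-1) ((n : ℝ) / 2) x * (g x * T x)) < |P 0| + 1 := h4
      linarith
    have h7 := le_max_left (|P 0| + 1) (1 / barrierWronskian ((n : ℝ) / 2) ν g g₁ δ)
    have h8 : 0 < |P 0| + 1 := by positivity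
    nlinarith [mul_le_mul h7 h5 zero_le_one (h8.le.trans h7)]
  · have h4 := h.boundT ν hν0 hνA x hx
    have hGx := (h.hg.barrier hα hν0 hνA).monotoneOn hδ0.le hx.le hxδ
    have hb : (0 : ℝ) < (1 + 2 * x) ^ ν := Real.rpow_pos_of_pos (by linarith) _
    have h5 : g x * T x ≤ (1 + 2 * x) ^ ν * (1 / barrierWronskian ((n : ℝ) / 2) ν g g₁ δ) := by
      refine h4.trans ?_
      rw [mul_one_div]
      exact div_le_div_of_nonneg_left hb.le hG hGx
    have h6 : g x * T x ≤ (1 + 2 * x) ^ ν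
        * max (|P 0| + 1) (1 / barrierWronskian ((n : ℝ) / 2) ν g g₁ δ) :=
      h5.trans (mul_le_mul_of_nonneg_left (le_max_right _ _) hb.le)
    have hV := eulerWeight_neg_le hα hx
    have hpos : 0 ≤ (1 - 2 * -1 * x) * (g x * T x) :=
      mul_nonneg (by linarith) (mul_pos (h.hg.pos x hx.le) (h.posT x hx)).le
    have e : (1 + 2 * x) ^ ((n : ℝ) / 2 + 1 / 2 - A')
        = (1 + 2 * x) ^ (2 * ((n : ℝ) / 2)) * ((1 + 2 * x) * (1 + 2 * x) ^ ν) := by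
      have hs : 0 < 1 + 2 * x := by linarith
      rw [show (1 + 2 * x) * (1 + 2 * x) ^ ν = (1 + 2 * x) ^ (1 + ν) by
        rw [Real.rpow_add hs, Real.rpow_one], ← Real.rpow_add hs, hν]
      congr 1; ring
    rw [e]
    calc eulerWeight (-1) ((n : ℝ) / 2) x * ((1 - 2 * -1 * x) * (g x * T x))
        ≤ (1 + 2 * x) ^ (2 * ((n : ℝ) / 2)) * ((1 - 2 * -1 * x) * (g x * T x)) :=
          mul_le_mul_of_nonneg_right hV hpos
      _ ≤ (1 + 2 * x) ^ (2 * ((n : ℝ) / 2)) * ((1 - 2 * -1 * x) * ((1 + 2 * x) ^ ν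
        * max (|P 0| + 1) (1 / barrierWronskian ((n : ℝ) / 2) ν g g₁ δ))) := by
          refine mul_le_mul_of_nonneg_left (mul_le_mul_of_nonneg_left h6 (by linarith)) ?_
          positivity
      _ = _ := by ring

theorem sq_barrier {α B B' : ℝ} (h0 : 0 ≤ B') (h1 : B' ≤ B) :
    (-(α + 1 / 2) + B' + (α + 1 / 2)) ^ 2 ≤ B ^ 2 := by
  have : -(α + 1 / 2) + B' + (α + 1 / 2) = B' := by ring
  rw [this]; nlinarith

/-- The ratio of u to its barrier increases, so on (0,y] it can be replaced by its value at y and a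
pure power is integrated. The condition A' < B'+1 makes the primitive a positive power, so its lower
end point can be discarded. -/
theorem J_le (h : IsGreenData n A B g g₁ g₂ u u₁ u₂ T J) (hn : 2 ≤ n) {A' B' : ℝ}
    (hA0 : 0 ≤ A') (hA : A' ≤ A) (hAN : A' ≤ (n : ℝ) / 2 + 1 / 2)
    (hB0 : 0 ≤ B') (hB : B' ≤ B) (hBN : B' < (n : ℝ) / 2 + 1 / 2) (hr : -1 < B' - A') :
    ∃ C : ℝ, 0 < C ∧ ∀ y, 0 < y →
      J y ≤ C * (u y / (1 + 2 * y) ^ (-((n : ℝ) / 2 + 1 / 2) + B'))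
        * (1 + 2 * y) ^ (B' - A' + 1) := by
  have hα : (0 : ℝ) ≤ (n : ℝ) / 2 := by positivity
  obtain ⟨C, hC, hCb⟩ := h.wronskian_le hn hA0 hA hAN
  set ν : ℝ := -((n : ℝ) / 2 + 1 / 2) + B' with hν
  have hm := h.hu.monotoneOn_div_barrier hα (ν := ν) (by linarith) (sq_barrier hB0 hB)
  have hr1 : 0 < B' - A' + 1 := by linarith
  refine ⟨C / (2 * (B' - A' + 1)), by positivity, fun y hy => ?_⟩
  set H : ℝ := u y / (1 + 2 * y) ^ ν with hH
  have hHpos : 0 < H := div_pos (h.hu.pos y hy.le) (Real.rpow_pos_of_pos (by linarith) _)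
  have key : ∀ s, 0 < s → s ≤ y → J y - J s ≤ C / (2 * (B' - A' + 1)) * H
      * (1 + 2 * y) ^ (B' - A' + 1) := fun s hs hsy => by
    have hd : ∀ t, 0 < t → HasDerivAt
        (fun t : ℝ => C / (2 * (B' - A' + 1)) * H * (1 + 2 * t) ^ (B' - A' + 1))
        (C * H * (1 + 2 * t) ^ (B' - A')) t := fun t ht => by
      refine ((hasDerivAt_one_add_two_mul_rpow (B' - A' + 1) (by linarith)).const_mul
        _).congr_deriv ?_
      rw [add_sub_cancel_right]
      field_simp
    have h1 := sub_le_sub_of_hasDerivAt_le hsy (fun t ht => h.dJ t (hs.trans_le ht.1))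
      (fun t ht => hd t (hs.trans_le ht.1)) fun t ht => by
        have ht0 := hs.trans_le ht.1
        have h2 : u t / (1 + 2 * t) ^ ν ≤ H := hm ht0.le hy.le ht.2
        have hb : (0 : ℝ) < (1 + 2 * t) ^ ν := Real.rpow_pos_of_pos (by linarith) _
        rw [div_le_iff₀ hb] at h2
        have e : (1 + 2 * t) ^ (B' - A')
            = (1 + 2 * t) ^ ((n : ℝ) / 2 + 1 / 2 - A') * (1 + 2 * t) ^ ν := by
          rw [← Real.rpow_add (by linarith), hν]; congr 1; ring
        have hup := h.hu.pos t ht0.le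
        calc eulerWeight (-1) ((n : ℝ) / 2) t * ((1 - 2 * -1 * t) * (g t * T t) * u t)
            = eulerWeight (-1) ((n : ℝ) / 2) t * ((1 - 2 * -1 * t) * (g t * T t)) * u t := by ring
          _ ≤ C * (1 + 2 * t) ^ ((n : ℝ) / 2 + 1 / 2 - A') * u t :=
              mul_le_mul_of_nonneg_right (hCb t ht0) hup.le
          _ ≤ C * (1 + 2 * t) ^ ((n : ℝ) / 2 + 1 / 2 - A') * (H * (1 + 2 * t) ^ ν) := by
              refine mul_le_mul_of_nonneg_left h2 ?_
              have : 0 < 1 + 2 * t := by linarith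
              positivity
          _ = _ := by rw [e]; ring
    have h3 : 0 ≤ C / (2 * (B' - A' + 1)) * H * (1 + 2 * s) ^ (B' - A' + 1) := by
      have : 0 < 1 + 2 * s := by linarith
      positivity
    linarith
  have hl := h.limJ.const_sub (J y)
  rw [sub_zero] at hl
  refine le_of_tendsto hl ?_
  filter_upwards [Ioo_mem_nhdsGT hy] with s hs using key s hs.1 hs.2.le

/-- The ratio of u to its barrier, kept in `J_le`, combines with u² to leave its inverse, which
decreases. No upper bound for u is needed to estimate E'. -/
theorem div_le (h : IsGreenData n A B g g₁ g₂ u u₁ u₂ T J) (hn : 2 ≤ n) {A' B' : ℝ}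
    (hA0 : 0 ≤ A') (hA : A' ≤ A) (hAN : A' ≤ (n : ℝ) / 2 + 1 / 2)
    (hB0 : 0 ≤ B') (hB : B' ≤ B) (hBN : B' < (n : ℝ) / 2 + 1 / 2) (hr : -1 < B' - A') :
    ∃ C : ℝ, 0 < C ∧ ∀ x, 1 ≤ x →
      J x / (eulerWeight (-1) ((n : ℝ) / 2 + 1) x * u x ^ 2)
        ≤ C * ((1 + 2 * x) ^ (-((n : ℝ) / 2 + 1 / 2) + B') / u x) * (1 + 2 * x) ^ (-A' - B') := by
  obtain ⟨C, hC, hCb⟩ := h.J_le hn hA0 hA hAN hB0 hB hBN hr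
  set ν : ℝ := -((n : ℝ) / 2 + 1 / 2) + B' with hν
  have h29 : (0 : ℝ) < (2 / 9) ^ ((n : ℝ) / 2 + 1) := by positivity
  refine ⟨C / (2 / 9) ^ ((n : ℝ) / 2 + 1), by positivity, fun x hx => ?_⟩
  have hx0 : 0 < x := by linarith
  have ht : 0 < 1 + 2 * x := by linarith
  have hup := h.hu.pos x hx0.le
  have hw := le_eulerWeight_neg (a := (n : ℝ) / 2 + 1) (by positivity) hx
  rw [div_le_iff₀ (h.hu.weight_pos hx0)]
  refine (hCb x hx0).trans ?_
  have e : (1 + 2 * x) ^ (B' - A' + 1) = (1 + 2 * x) ^ ν * (1 + 2 * x) ^ ν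
      * ((1 + 2 * x) ^ (-A' - B') * (1 + 2 * x) ^ (2 * ((n : ℝ) / 2 + 1))) := by
    rw [← Real.rpow_add ht, ← Real.rpow_add ht, ← Real.rpow_add ht, hν]; congr 1; ring
  have hb : (0 : ℝ) < (1 + 2 * x) ^ ν := Real.rpow_pos_of_pos ht _
  have hc : (0 : ℝ) < (1 + 2 * x) ^ (-A' - B') := Real.rpow_pos_of_pos ht _
  calc C * (u x / (1 + 2 * x) ^ ν) * (1 + 2 * x) ^ (B' - A' + 1)
      = C / (2 / 9) ^ ((n : ℝ) / 2 + 1) * ((1 + 2 * x) ^ ν / u x) * (1 + 2 * x) ^ (-A' - B')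
        * ((2 / 9) ^ ((n : ℝ) / 2 + 1) * (1 + 2 * x) ^ (2 * ((n : ℝ) / 2 + 1)) * u x ^ 2) := by
        rw [e]; field_simp
    _ ≤ _ := by
        refine mul_le_mul_of_nonneg_left (mul_le_mul_of_nonneg_right hw (by positivity)) ?_
        positivity

end IsGreenData

theorem tendsto_or_of_monotoneOn {P : ℝ → ℝ} (h : MonotoneOn P (Set.Ioi 0)) :
    (∃ L, Tendsto P atTop (𝓝 L)) ∨ Tendsto P atTop atTop := by
  by_cases hb : ∃ M, ∀ x, 1 ≤ x → P x ≤ M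
  · obtain ⟨M, hM⟩ := hb
    exact Or.inl (exists_tendsto_of_monotoneOn h one_pos hM)
  · push Not at hb
    refine Or.inr (tendsto_atTop.2 fun b => ?_)
    obtain ⟨x, hx1, hx⟩ := hb b
    have hx0 : 0 < x := one_pos.trans_le hx1
    filter_upwards [eventually_ge_atTop x] with y hy
      using hx.le.trans (h hx0 (hx0.trans_le hy) hy)

namespace IsGreenData

variable {n : ℕ} {A B : ℝ} {g g₁ g₂ u u₁ u₂ T J E : ℝ → ℝ}

theorem strictMonoOn (h : IsGreenData n A B g g₁ g₂ u u₁ u₂ T J)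
    (hE : ∀ x, 0 < x → HasDerivAt E (J x / (eulerWeight (-1) ((n : ℝ) / 2 + 1) x * u x ^ 2)) x) :
    StrictMonoOn E (Set.Ioi 0) :=
  strictMonoOn_Ioi_of_hasDerivAt hE fun _ hx => div_pos (h.J_pos hx) (h.hu.weight_pos hx)

/-- E' is controlled by the integrable power -A'-B' < -1. In the tail L-E the decreasing ratio
barrier/u is frozen at x, and multiplication by u leaves (1+2x)^(ν-σ) with a negative exponent. -/
theorem tendsto_of_one_lt (h : IsGreenData n A B g g₁ g₂ u u₁ u₂ T J) (hn : 2 ≤ n) {A' B' : ℝ}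
    (hE : ∀ x, 0 < x → HasDerivAt E (J x / (eulerWeight (-1) ((n : ℝ) / 2 + 1) x * u x ^ 2)) x)
    (hA0 : 0 ≤ A') (hA : A' ≤ A) (hAN : A' ≤ (n : ℝ) / 2 + 1 / 2)
    (hB0 : 0 ≤ B') (hB : B' ≤ B) (hBN : B' < (n : ℝ) / 2 + 1 / 2) (hr : -1 < B' - A')
    (hAB : 1 < A' + B') :
    ∃ L, Tendsto E atTop (𝓝 L) ∧ Tendsto (fun x => u x * (L - E x)) atTop (𝓝 0) := by
  have hn' : (2 : ℝ) ≤ n := by exact_mod_cast hn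
  have hα : (0 : ℝ) ≤ (n : ℝ) / 2 := by positivity
  obtain ⟨C, hC, hCb⟩ := h.div_le hn hA0 hA hAN hB0 hB hBN hr
  set ν : ℝ := -((n : ℝ) / 2 + 1 / 2) + B' with hν
  have hm := h.hu.monotoneOn_div_barrier hα (ν := ν) (by linarith) (sq_barrier hB0 hB)
  set σ : ℝ := A' + B' - 1 with hσ
  have hσ0 : 0 < σ := by linarith
  have hEm := (h.strictMonoOn hE).monotoneOn
  have hb : ∀ t : ℝ, 0 < t → (0 : ℝ) < (1 + 2 * t) ^ ν := fun t ht =>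
    Real.rpow_pos_of_pos (by linarith) _
  have key : ∀ x, 1 ≤ x → ∀ y, x ≤ y →
      E y ≤ E x + C / (2 * σ) * ((1 + 2 * x) ^ ν / u x) * (1 + 2 * x) ^ (-σ) := by
    intro x hx y hxy
    have hx0 : 0 < x := by linarith
    set H : ℝ := (1 + 2 * x) ^ ν / u x with hH
    have hHpos : 0 < H := div_pos (hb x hx0) (h.hu.pos x hx0.le)
    have hd : ∀ t, 0 < t → HasDerivAt (fun t : ℝ => -(C / (2 * σ) * H) * (1 + 2 * t) ^ (-σ))
        (C * H * (1 + 2 * t) ^ (-A' - B')) t := fun t ht => by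
      refine ((hasDerivAt_one_add_two_mul_rpow (-σ) (by linarith)).const_mul _).congr_deriv ?_
      rw [show -σ - 1 = -A' - B' by rw [hσ]; ring]
      field_simp
    have h1 := sub_le_sub_of_hasDerivAt_le hxy (fun t ht => hE t (hx0.trans_le ht.1))
      (fun t ht => hd t (hx0.trans_le ht.1)) fun t ht => by
        have ht0 := hx0.trans_le ht.1
        refine (hCb t (hx.trans ht.1)).trans ?_
        have h2 : u x / (1 + 2 * x) ^ ν ≤ u t / (1 + 2 * t) ^ ν := hm hx0.le ht0.le ht.1
        have h3 : (1 + 2 * t) ^ ν / u t ≤ H := by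
          rw [hH, ← inv_div (u t), ← inv_div (u x)]
          exact inv_anti₀ (div_pos (h.hu.pos x hx0.le) (hb x hx0)) h2
        have : 0 < 1 + 2 * t := by linarith
        gcongr
    have h3 : 0 ≤ C / (2 * σ) * H * (1 + 2 * y) ^ (-σ) := by
      have : 0 < 1 + 2 * y := by linarith
      positivity
    linarith
  obtain ⟨L, hL⟩ := exists_tendsto_of_monotoneOn hEm one_pos (key 1 le_rfl)
  refine ⟨L, hL, ?_⟩
  have hz : Tendsto (fun x : ℝ => C / (2 * σ) * (1 + 2 * x) ^ (ν - σ)) atTop (𝓝 0) := by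
    have := (tendsto_one_add_two_mul_rpow_atTop (s := ν - σ) (by linarith)).const_mul (C / (2 * σ))
    rwa [mul_zero] at this
  refine tendsto_of_tendsto_of_tendsto_of_le_of_le' tendsto_const_nhds hz ?_ ?_
  · filter_upwards [eventually_ge_atTop 1] with x hx
    have hx0 : 0 < x := by linarith
    exact mul_nonneg (h.hu.pos x hx0.le).le
      (sub_nonneg.2 (le_of_tendsto_of_monotoneOn hEm hL hx0))
  · filter_upwards [eventually_ge_atTop 1] with x hx
    have hx0 : 0 < x := by linarith
    have h1 : L ≤ E x + C / (2 * σ) * ((1 + 2 * x) ^ ν / u x) * (1 + 2 * x) ^ (-σ) := by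
      refine le_of_tendsto hL ?_
      filter_upwards [eventually_ge_atTop x] with y hy using key x hx y hy
    have hup := h.hu.pos x hx0.le
    rw [sub_eq_add_neg ν, Real.rpow_add (by linarith)]
    calc u x * (L - E x) ≤ u x * (C / (2 * σ) * ((1 + 2 * x) ^ ν / u x) * (1 + 2 * x) ^ (-σ)) :=
          mul_le_mul_of_nonneg_left (by linarith) hup.le
      _ = _ := by field_simp

/-- Without integrability, E' is of order at most (1+2x)^(-3/4), so E grows at most like
(1+2x)^(1/4). The bound u ≤ (1+2x)^(-1/2) outweighs this for every choice of L. -/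
theorem tendsto_of_le_barrier (h : IsGreenData n A B g g₁ g₂ u u₁ u₂ T J) (hn : 2 ≤ n) {A' B' : ℝ}
    (hE : ∀ x, 0 < x → HasDerivAt E (J x / (eulerWeight (-1) ((n : ℝ) / 2 + 1) x * u x ^ 2)) x)
    (hA0 : 0 ≤ A') (hA : A' ≤ A) (hAN : A' ≤ (n : ℝ) / 2 + 1 / 2)
    (hB0 : 0 ≤ B') (hB : B' ≤ B) (hBN : B' < (n : ℝ) / 2 + 1 / 2) (hr : -1 < B' - A')
    (hAB : 3 / 4 ≤ A' + B') (hκ : (n : ℝ) / 2 + 1 ≤ ((n : ℝ) / 2 + 1 / 2) ^ 2 - B ^ 2) (L : ℝ) :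
    Tendsto (fun x => u x * (L - E x)) atTop (𝓝 0) := by
  have hα : (0 : ℝ) ≤ (n : ℝ) / 2 := by positivity
  obtain ⟨C, hC, hCb⟩ := h.div_le hn hA0 hA hAN hB0 hB hBN hr
  have hEm := (h.strictMonoOn hE).monotoneOn
  have key : ∀ x, 1 ≤ x → E x ≤ E 1 + 2 * C * (1 + 2 * x) ^ (1 / 4 : ℝ) := by
    intro x hx
    have hd : ∀ t, 0 < t → HasDerivAt (fun t : ℝ => 2 * C * (1 + 2 * t) ^ (1 / 4 : ℝ))
        (C * (1 + 2 * t) ^ (1 / 4 - 1 : ℝ)) t := fun t ht => by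
      refine ((hasDerivAt_one_add_two_mul_rpow (1 / 4) (by linarith)).const_mul _).congr_deriv ?_
      ring
    have h1 := sub_le_sub_of_hasDerivAt_le hx (fun t ht => hE t (one_pos.trans_le ht.1))
      (fun t ht => hd t (one_pos.trans_le ht.1)) fun t ht => by
        have ht0 := one_pos.trans_le ht.1
        have h2 := h.hu.barrier_le hα (ν := -((n : ℝ) / 2 + 1 / 2) + B') (by linarith)
          (sq_barrier hB0 hB) ht0.le
        have h3 : (1 + 2 * t) ^ (-((n : ℝ) / 2 + 1 / 2) + B') / u t ≤ 1 :=
          (div_le_one (h.hu.pos t ht0.le)).2 h2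
        have h4 : (1 + 2 * t) ^ (-A' - B') ≤ (1 + 2 * t) ^ (1 / 4 - 1 : ℝ) :=
          Real.rpow_le_rpow_of_exponent_le (by linarith) (by linarith)
        have h5 : 0 < (1 + 2 * t) ^ (-A' - B') := Real.rpow_pos_of_pos (by linarith) _
        refine (hCb t ht.1).trans ?_
        rw [mul_assoc]
        refine mul_le_mul_of_nonneg_left ?_ hC.le
        refine (mul_le_of_le_one_left h5.le h3).trans h4
    have h3 : 0 ≤ 2 * C * (1 + 2 * (1 : ℝ)) ^ (1 / 4 : ℝ) := by positivity
    linarith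
  have hz : Tendsto (fun x : ℝ => (|L| + |E 1|) * (1 + 2 * x) ^ (-(1 / 2) : ℝ)
      + 2 * C * (1 + 2 * x) ^ (-(1 / 4) : ℝ)) atTop (𝓝 0) := by
    have := ((tendsto_one_add_two_mul_rpow_atTop (s := -(1 / 2)) (by norm_num)).const_mul (|L| + |E 1|)).add
      ((tendsto_one_add_two_mul_rpow_atTop (s := -(1 / 4)) (by norm_num)).const_mul (2 * C))
    simpa using this
  refine squeeze_zero_norm' ?_ hz
  filter_upwards [eventually_ge_atTop 1] with x hx
  have hx0 : 0 < x := by linarith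
  have h1 := key x hx
  have h2 : E 1 ≤ E x := hEm (Set.mem_Ioi.2 one_pos) hx0 hx
  have h3 := h.hu.le_barrier hα hκ hx0.le
  have hup := h.hu.pos x hx0.le
  have h4 : |L - E x| ≤ |L| + |E 1| + 2 * C * (1 + 2 * x) ^ (1 / 4 : ℝ) := by
    rw [abs_le]
    have := neg_abs_le L
    have := le_abs_self L
    have := neg_abs_le (E 1)
    have := le_abs_self (E 1)
    have : 0 < 2 * C * (1 + 2 * x) ^ (1 / 4 : ℝ) := by
      have : 0 < 1 + 2 * x := by linarith
      positivity
    constructor <;> linarith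
  rw [Real.norm_eq_abs, abs_mul, abs_of_pos hup]
  have e : (1 + 2 * x) ^ (-(1 / 4) : ℝ) = (1 + 2 * x) ^ (-(1 / 2) : ℝ) * (1 + 2 * x) ^ (1 / 4 : ℝ) := by
    rw [← Real.rpow_add (by linarith)]; norm_num
  calc u x * |L - E x| ≤ (1 + 2 * x) ^ (-(1 / 2) : ℝ)
        * (|L| + |E 1| + 2 * C * (1 + 2 * x) ^ (1 / 4 : ℝ)) := by gcongr
    _ = _ := by rw [e]; ring

/-- The constant of integration for which the solution of the fourth order equation decays. -/
theorem exists_decaying_constant (h : IsGreenData n A B g g₁ g₂ u u₁ u₂ T J) (hn : 2 ≤ n)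
    (hE : ∀ x, 0 < x → HasDerivAt E (J x / (eulerWeight (-1) ((n : ℝ) / 2 + 1) x * u x ^ 2)) x)
    (hA : 0 ≤ A) (hB : 0 ≤ B)
    (hκ : (n : ℝ) / 2 + 1 ≤ ((n : ℝ) / 2 + 1 / 2) ^ 2 - B ^ 2)
    (hAB : 3 / 4 ≤ min A (3 / 4) + min B 1) (hr : -1 < min B 1 - min A (3 / 4)) :
    ∃ L, Tendsto (fun x => u x * (L - E x)) atTop (𝓝 0) ∧
      (Tendsto E atTop (𝓝 L) ∨ Tendsto E atTop atTop) := by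
  have hn' : (2 : ℝ) ≤ n := by exact_mod_cast hn
  -- The cut at 3/4 is for the case A = 1, B = 0, where A' must be strictly below B'+1 = 1.
  have key := h.tendsto_of_le_barrier hn hE (A' := min A (3 / 4)) (B' := min B 1)
    (le_min hA (by norm_num)) (min_le_left _ _) ((min_le_right _ _).trans (by linarith))
    (le_min hB zero_le_one) (min_le_left _ _) ((min_le_right _ _).trans_lt (by linarith)) hr hAB hκ
  rcases tendsto_or_of_monotoneOn (h.strictMonoOn hE).monotoneOn with ⟨L, hL⟩ | hL
  · exact ⟨L, key L, Or.inl hL⟩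
  -- When E diverges, the constant of integration does not affect the order of L-E; 0 is an
  -- arbitrary choice.
  · exact ⟨0, key 0, Or.inr hL⟩

theorem exists_decaying_limit (h : IsGreenData n A B g g₁ g₂ u u₁ u₂ T J) (hn : 2 ≤ n)
    (hE : ∀ x, 0 < x → HasDerivAt E (J x / (eulerWeight (-1) ((n : ℝ) / 2 + 1) x * u x ^ 2)) x)
    (hA : 0 ≤ A) (hB : 0 < B) (hAB : 1 < A + B) :
    ∃ L, Tendsto E atTop (𝓝 L) ∧ Tendsto (fun x => u x * (L - E x)) atTop (𝓝 0) := by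
  have hn' : (2 : ℝ) ≤ n := by exact_mod_cast hn
  have h1 : 0 < min B (5 / 4) := lt_min hB (by norm_num)
  -- The cut A' ≤ 1 with B' > 0 ensures A' < B'+1. The cut 5/4 lies above 1, to keep A'+B' > 1, and
  -- below 3/2, the least value of α+1/2.
  refine h.tendsto_of_one_lt hn hE (A' := min A 1) (B' := min B (5 / 4))
    (le_min hA zero_le_one) (min_le_left _ _) ((min_le_right _ _).trans (by linarith))
    h1.le (min_le_left _ _) ((min_le_right _ _).trans_lt (by linarith)) ?_ ?_
  · linarith [min_le_right A 1]
  · rcases le_total A 1 with h2 | h2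
    · rw [min_eq_left h2]
      rcases le_total B (5 / 4) with h3 | h3
      · rwa [min_eq_left h3]
      · rw [min_eq_right h3]; linarith
    · rw [min_eq_right h2]; linarith

end IsGreenData

/-! ### Comparison of solutions at infinity. -/

/-- A form of l'Hôpital's rule: the increments of `f` are small compared to those of `k`. -/
theorem eventually_increment_le {f f' k k' : ℝ → ℝ} (hf : ∀ x, 0 < x → HasDerivAt f (f' x) x)
    (hk : ∀ x, 0 < x → HasDerivAt k (k' x) x) (hk0 : ∀ x, 0 < x → 0 < k' x)
    (h : Tendsto (fun x => f' x / k' x) atTop (𝓝 0)) {c : ℝ} (hc : 0 < c) :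
    ∃ x₀, 0 < x₀ ∧ ∀ x, x₀ ≤ x → ∀ y, x ≤ y → f y - f x ≤ c * (k y - k x) := by
  have h1 := h.eventually (gt_mem_nhds hc)
  obtain ⟨x₀, hx₀⟩ := eventually_atTop.1 (h1.and (eventually_gt_atTop 0))
  refine ⟨x₀, (hx₀ x₀ le_rfl).2, fun x hx y hxy => ?_⟩
  have h2 := sub_le_sub_of_hasDerivAt_le hxy (fun t ht => hf t (hx₀ t (hx.trans ht.1)).2)
    (fun t ht => (hk t (hx₀ t (hx.trans ht.1)).2).const_mul c) fun t ht => by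
      have h3 := hx₀ t (hx.trans ht.1)
      exact ((div_lt_iff₀ (hk0 t h3.2)).1 h3.1).le
  linarith

theorem isLittleO_of_tendsto_deriv {f f' k k' : ℝ → ℝ} (hf : ∀ x, 0 < x → HasDerivAt f (f' x) x)
    (hk : ∀ x, 0 < x → HasDerivAt k (k' x) x) (hf0 : ∀ x, 0 < x → 0 ≤ f' x)
    (hk0 : ∀ x, 0 < x → 0 < k' x) (h : Tendsto (fun x => f' x / k' x) atTop (𝓝 0))
    (hkt : Tendsto k atTop atTop) : f =o[atTop] k := by
  refine IsLittleO.of_bound fun c hc => ?_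
  obtain ⟨x₀, hx₀, hb⟩ := eventually_increment_le hf hk hk0 h (half_pos hc)
  have hfm := monotoneOn_Ioi_of_hasDerivAt hf hf0
  filter_upwards [eventually_ge_atTop x₀, hkt.eventually_ge_atTop 0,
    hkt.eventually_ge_atTop ((2 * |f x₀| + c * |k x₀|) / c)] with x hx hkx hkx'
  rw [Real.norm_eq_abs, Real.norm_eq_abs, abs_of_nonneg hkx]
  rw [div_le_iff₀ hc] at hkx'
  have h1 := hb x₀ le_rfl x hx
  have h2 := hfm hx₀ (hx₀.trans_le hx) hx
  have h3 := le_abs_self (f x₀)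
  have h4 := neg_abs_le (f x₀)
  have h5 := mul_le_mul_of_nonneg_left (neg_abs_le (k x₀)) hc.le
  have h6 : 0 ≤ c * |k x₀| := by positivity
  have h7 : 0 ≤ c * k x := by positivity
  rw [abs_le]
  constructor <;> nlinarith

/-- Comparison of primitives which differ by constants of integration, for derivatives of different
orders of magnitude. -/
theorem isLittleO_of_primitives {f f' k k' : ℝ → ℝ} {L a b : ℝ}
    (hf : ∀ x, 0 < x → HasDerivAt f (f' x) x)
    (hk : ∀ x, 0 < x → HasDerivAt k (k' x) x) (hf0 : ∀ x, 0 < x → 0 ≤ f' x)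
    (hk0 : ∀ x, 0 < x → 0 < k' x) (h : Tendsto (fun x => f' x / k' x) atTop (𝓝 0))
    (hL : Tendsto f atTop (𝓝 L) ∨ Tendsto f atTop atTop) (ha : a ≠ 0) :
    (fun x => L - f x) =o[atTop] fun x => b - a * k x := by
  have hkm := (strictMonoOn_Ioi_of_hasDerivAt hk hk0).monotoneOn
  have hfm := monotoneOn_Ioi_of_hasDerivAt hf hf0
  rcases tendsto_or_of_monotoneOn hkm with ⟨M, hM⟩ | hM
  · have hfL : Tendsto f atTop (𝓝 L) := by
      refine hL.resolve_right fun ht => ?_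
      obtain ⟨x₀, hx₀, hb⟩ := eventually_increment_le hf hk hk0 h one_pos
      obtain ⟨y, hy, hy'⟩ := ((ht.eventually_gt_atTop (f x₀ + (M - k x₀))).and
        (eventually_ge_atTop x₀)).exists
      have h1 := hb x₀ le_rfl y hy'
      have h2 := le_of_tendsto_of_monotoneOn hkm hM (hx₀.trans_le hy')
      linarith
    have hφ : Tendsto (fun x => L - f x) atTop (𝓝 0) := by simpa using hfL.const_sub L
    -- If the limit b - aM vanishes, both sides are tails of convergent primitives and their
    -- increments are compared. Otherwise the right side has a nonzero limit while L - f tends to 0.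
    by_cases hz : b - a * M = 0
    · have e : (fun x => b - a * k x) = fun x => a * (M - k x) := by
        ext x; linear_combination hz
      rw [e]
      refine IsLittleO.const_mul_right ha (IsLittleO.of_bound fun c hc => ?_)
      obtain ⟨x₀, hx₀, hb⟩ := eventually_increment_le hf hk hk0 h hc
      filter_upwards [eventually_ge_atTop x₀] with x hx
      have h1 := le_of_tendsto_of_monotoneOn hkm hM (hx₀.trans_le hx)
      have h2 := le_of_tendsto_of_monotoneOn hfm hfL (hx₀.trans_le hx)
      rw [Real.norm_of_nonneg (sub_nonneg.2 h2), Real.norm_of_nonneg (sub_nonneg.2 h1)]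
      refine le_of_tendsto_of_tendsto (hfL.sub_const (f x)) ((hM.sub_const (k x)).const_mul c) ?_
      filter_upwards [eventually_ge_atTop x] with y hy using hb x hx y hy
    · have hq : Tendsto (fun x => b - a * k x) atTop (𝓝 (b - a * M)) :=
        (hM.const_mul a).const_sub b
      have hd := hφ.div hq hz
      rw [zero_div] at hd
      refine (isLittleO_iff_tendsto' ?_).2 hd
      filter_upwards [hq.eventually_ne hz] with x hx hx0 using absurd hx0 hx
  · have h1 := isLittleO_of_tendsto_deriv hf hk hf0 hk0 h hM
    have hc : ∀ c : ℝ, (fun _ : ℝ => c) =o[atTop] k := fun c =>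
      isLittleO_const_left.2 (Or.inr (tendsto_norm_atTop_atTop.comp hM))
    have h2 : (fun x => L - f x) =o[atTop] k := (hc L).sub h1
    refine h2.trans_isBigO ?_
    have h3 : (fun _ : ℝ => b) =o[atTop] fun x => -a * k x :=
      (hc b).const_mul_right (neg_ne_zero.2 ha)
    have h4 := h3.right_isBigO_add
    have h5 : (fun x => -a * k x) =O[atTop] fun x => b - a * k x :=
      h4.congr_right fun x => by ring
    exact (isBigO_const_mul_left_iff (neg_ne_zero.2 ha)).1 h5

theorem exists_primitive_Ici {f : ℝ → ℝ} (hf : ContinuousOn f (Set.Ici 0)) :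
    ∃ F : ℝ → ℝ, (∀ x, 0 < x → HasDerivAt F (f x) x) ∧ Tendsto F (𝓝[>] 0) (𝓝 0) := by
  obtain ⟨F, hF⟩ := exists_primitive_Ioi (hf.mono Set.Ioi_subset_Ici_self)
  have hi : IntegrableOn f (Set.uIcc 0 1) := by
    rw [Set.uIcc_of_le zero_le_one]
    exact (hf.mono Set.Icc_subset_Ici_self).integrableOn_Icc
  have hc := intervalIntegral.continuousOn_primitive_interval hi
  refine ⟨fun x => ∫ t in (0 : ℝ)..x, f t, fun x hx => ?_, ?_⟩
  · have hsub : Set.uIcc 0 x ⊆ Set.Ici 0 := by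
      rw [Set.uIcc_of_le hx.le]; exact Set.Icc_subset_Ici_self
    exact intervalIntegral.integral_hasDerivAt_right (hf.mono hsub).intervalIntegrable
      ((hf.mono Set.Ioi_subset_Ici_self).stronglyMeasurableAtFilter isOpen_Ioi x hx)
      (hf.continuousAt (Ici_mem_nhds hx))
  · have := hc 0 Set.left_mem_uIcc
    rw [ContinuousWithinAt, intervalIntegral.integral_same, Set.uIcc_of_le zero_le_one] at this
    refine this.mono_left ?_
    rw [← nhdsWithin_Ioc_eq_nhdsGT one_pos]
    exact nhdsWithin_mono _ Set.Ioc_subset_Icc_self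

namespace IsGreenData

variable {n : ℕ} {A B : ℝ} {g g₁ g₂ u u₁ u₂ T J E K Q : ℝ → ℝ}

/-- K is the analogue of J with g in place of gT: it generates the bounded solution uQ whose W is a
multiple of the regular solution g. -/
theorem exists_regular (h : IsGreenData n A B g g₁ g₂ u u₁ u₂ T J) : ∃ K : ℝ → ℝ,
    (∀ x, 0 < x → HasDerivAt K
      (eulerWeight (-1) ((n : ℝ) / 2) x * ((1 - 2 * -1 * x) * g x * u x)) x) ∧
    Tendsto K (𝓝[>] 0) (𝓝 0) :=
  exists_primitive_Ici ((continuous_eulerWeight (by positivity) (-1)).continuousOn.mul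
    (((Continuous.continuousOn (by fun_prop)).mul h.hg.continuousOn).mul h.hu.continuousOn))

theorem dK_pos (h : IsGreenData n A B g g₁ g₂ u u₁ u₂ T J) {x : ℝ} (hx : 0 < x) :
    0 < eulerWeight (-1) ((n : ℝ) / 2) x * ((1 - 2 * -1 * x) * g x * u x) :=
  mul_pos (eulerWeight_pos (neg_weight_arg_pos hx) _) (mul_pos (mul_pos (by linarith)
    (h.hg.pos x hx.le)) (h.hu.pos x hx.le))

theorem K_pos (h : IsGreenData n A B g g₁ g₂ u u₁ u₂ T J)
    (hK : ∀ x, 0 < x → HasDerivAt K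
      (eulerWeight (-1) ((n : ℝ) / 2) x * ((1 - 2 * -1 * x) * g x * u x)) x)
    (hK0 : Tendsto K (𝓝[>] 0) (𝓝 0)) {x : ℝ} (hx : 0 < x) : 0 < K x := by
  have hm := strictMonoOn_Ioi_of_hasDerivAt hK fun x hx => h.dK_pos hx
  have h1 : 0 ≤ K (x / 2) := by
    refine le_of_tendsto hK0 ?_
    filter_upwards [Ioo_mem_nhdsGT (half_pos hx)] with y hy
      using hm.monotoneOn hy.1 (half_pos hx) hy.2.le
  exact h1.trans_lt (hm (half_pos hx) hx (half_lt_self hx))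

/-- The lower barriers (1+2x)^(-(α+1/2)) of g and u exactly compensate the weight times 1+2x, so K'
is bounded below by a positive constant. -/
theorem tendsto_K (h : IsGreenData n A B g g₁ g₂ u u₁ u₂ T J)
    (hK : ∀ x, 0 < x → HasDerivAt K
      (eulerWeight (-1) ((n : ℝ) / 2) x * ((1 - 2 * -1 * x) * g x * u x)) x) :
    Tendsto K atTop atTop := by
  have hα : (0 : ℝ) ≤ (n : ℝ) / 2 := by positivity
  set c : ℝ := (2 / 9) ^ ((n : ℝ) / 2) with hc
  have hc0 : 0 < c := by positivity
  set ν : ℝ := -((n : ℝ) / 2 + 1 / 2) with hν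
  have key : ∀ x, 1 ≤ x → c * x - c * 1 ≤ K x - K 1 := fun x hx =>
    sub_le_sub_of_hasDerivAt_le hx (fun t _ => ((hasDerivAt_id t).const_mul c))
      (fun t ht => hK t (one_pos.trans_le ht.1)) fun t ht => by
        have ht0 := one_pos.trans_le ht.1
        have hs : 0 < 1 + 2 * t := by linarith
        have h1 := le_eulerWeight_neg hα ht.1
        have h2 := h.hg.barrier_le hα (ν := ν) (by linarith)
          (by rw [hν, neg_add_cancel]; nlinarith [sq_nonneg A]) ht0.le
        have h3 := h.hu.barrier_le hα (ν := ν) (by linarith)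
          (by rw [hν, neg_add_cancel]; nlinarith [sq_nonneg B]) ht0.le
        have hb : (0 : ℝ) < (1 + 2 * t) ^ ν := Real.rpow_pos_of_pos hs _
        have e : (1 + 2 * t) ^ (2 * ((n : ℝ) / 2)) * ((1 + 2 * t) * (1 + 2 * t) ^ ν
            * (1 + 2 * t) ^ ν) = 1 := by
          rw [show (1 + 2 * t) * (1 + 2 * t) ^ ν = (1 + 2 * t) ^ (1 + ν) by
            rw [Real.rpow_add hs, Real.rpow_one], ← Real.rpow_add hs, ← Real.rpow_add hs,
            show 2 * ((n : ℝ) / 2) + (1 + ν + ν) = 0 by rw [hν]; ring, Real.rpow_zero]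
        have e2 : 1 - 2 * -1 * t = 1 + 2 * t := by ring
        rw [e2, mul_one]
        calc c = c * (1 + 2 * t) ^ (2 * ((n : ℝ) / 2)) * ((1 + 2 * t) * (1 + 2 * t) ^ ν
            * (1 + 2 * t) ^ ν) := by rw [mul_assoc, e, mul_one]
          _ ≤ _ := by
            refine mul_le_mul h1 ?_ (by positivity) ((by positivity : (0:ℝ) ≤ _).trans h1)
            exact mul_le_mul (mul_le_mul_of_nonneg_left h2 hs.le) h3 hb.le
              (mul_nonneg hs.le (hb.le.trans h2))
  refine tendsto_atTop_mono' atTop (f₁ := fun x => c * x + (K 1 - c)) ?_ ?_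
  · filter_upwards [eventually_ge_atTop 1] with x hx
    linarith [key x hx]
  · exact tendsto_atTop_add_const_right _ _ (tendsto_id.const_mul_atTop hc0)

/-- By construction J'/K' = T, which tends to 0, and K tends to infinity. -/
theorem tendsto_J_div_K (h : IsGreenData n A B g g₁ g₂ u u₁ u₂ T J)
    (hK : ∀ x, 0 < x → HasDerivAt K
      (eulerWeight (-1) ((n : ℝ) / 2) x * ((1 - 2 * -1 * x) * g x * u x)) x) :
    Tendsto (fun x => J x / K x) atTop (𝓝 0) := by
  refine (isLittleO_of_tendsto_deriv h.dJ hK (fun x hx => (h.dJ_pos hx).le)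
    (fun x hx => h.dK_pos hx) ?_ (h.tendsto_K hK)).tendsto_div_nhds_zero
  refine h.limT.congr' ?_
  filter_upwards [eventually_gt_atTop 0] with x hx
  rw [eq_div_iff (h.dK_pos hx).ne']
  ring

theorem isLittleO_quotient (h : IsGreenData n A B g g₁ g₂ u u₁ u₂ T J)
    (hE : ∀ x, 0 < x → HasDerivAt E (J x / (eulerWeight (-1) ((n : ℝ) / 2 + 1) x * u x ^ 2)) x)
    (hK : ∀ x, 0 < x → HasDerivAt K
      (eulerWeight (-1) ((n : ℝ) / 2) x * ((1 - 2 * -1 * x) * g x * u x)) x)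
    (hK0 : Tendsto K (𝓝[>] 0) (𝓝 0))
    (hQ : ∀ x, 0 < x → HasDerivAt Q (K x / (eulerWeight (-1) ((n : ℝ) / 2 + 1) x * u x ^ 2)) x)
    {L a b : ℝ} (hL : Tendsto E atTop (𝓝 L) ∨ Tendsto E atTop atTop) (ha : a ≠ 0) :
    (fun x => L - E x) =o[atTop] fun x => b - a * Q x := by
  refine isLittleO_of_primitives hE hQ
    (fun x hx => (div_pos (h.J_pos hx) (h.hu.weight_pos hx)).le)
    (fun x hx => div_pos (h.K_pos hK hK0 hx) (h.hu.weight_pos hx)) ?_ hL ha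
  refine (h.tendsto_J_div_K hK).congr' ?_
  filter_upwards [eventually_gt_atTop 0] with x hx
  rw [div_div_div_cancel_right₀ (h.hu.weight_pos hx).ne']

/-- The quotient `L - E` is dominated by any quotient of another solution by `u`. -/
theorem isBigO_quotient (h : IsGreenData n A B g g₁ g₂ u u₁ u₂ T J)
    (hE : ∀ x, 0 < x → HasDerivAt E (J x / (eulerWeight (-1) ((n : ℝ) / 2 + 1) x * u x ^ 2)) x)
    (hK : ∀ x, 0 < x → HasDerivAt K
      (eulerWeight (-1) ((n : ℝ) / 2) x * ((1 - 2 * -1 * x) * g x * u x)) x)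
    (hK0 : Tendsto K (𝓝[>] 0) (𝓝 0))
    (hQ : ∀ x, 0 < x → HasDerivAt Q (K x / (eulerWeight (-1) ((n : ℝ) / 2 + 1) x * u x ^ 2)) x)
    {L a b c : ℝ} (hL : Tendsto E atTop (𝓝 L) ∨ Tendsto E atTop atTop) (hc : c ≠ 0) :
    (fun x => L - E x) =O[atTop] fun x => c * (L - E x) + (b - a * Q x) := by
  -- One of the two terms always dominates the other, so they cannot cancel in the sum. The order is
  -- reversed only when a = 0 and either b = 0 or E diverges.
  have key : ((fun x => L - E x) =o[atTop] fun x => b - a * Q x) ∨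
      ((fun x => b - a * Q x) =o[atTop] fun x => L - E x) := by
    by_cases ha : a = 0
    · subst ha
      simp only [zero_mul, sub_zero]
      by_cases hb : b = 0
      · subst hb; exact Or.inr (isLittleO_zero _ _)
      · rcases hL with hL | hL
        · left
          rw [isLittleO_const_iff hb]
          simpa using hL.const_sub L
        · right
          refine isLittleO_const_left.2 (Or.inr ?_)
          have : Tendsto (fun x => E x - L) atTop atTop := tendsto_atTop_add_const_right _ _ hL
          refine (tendsto_norm_atTop_atTop.comp this).congr fun x => ?_
          simp [abs_sub_comm]
    · exact Or.inl (h.isLittleO_quotient hE hK hK0 hQ hL ha)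
  rcases key with h1 | h1
  · exact h1.isBigO.trans (h1.const_mul_left c).right_isBigO_add
  · have := (h1.const_mul_right hc).right_isBigO_add
    refine ((isBigO_const_mul_left_iff hc).1 this).congr_right fun x => by ring

/-- If a ≠ 0, b - aQ would be negligible against itself, although it has at most one zero because Q
is strictly monotone. Once a = 0, the constant b is dominated by a function tending to 0. -/
theorem eq_zero_of_isBigO (h : IsGreenData n A B g g₁ g₂ u u₁ u₂ T J)
    (hE : ∀ x, 0 < x → HasDerivAt E (J x / (eulerWeight (-1) ((n : ℝ) / 2 + 1) x * u x ^ 2)) x)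
    (hK : ∀ x, 0 < x → HasDerivAt K
      (eulerWeight (-1) ((n : ℝ) / 2) x * ((1 - 2 * -1 * x) * g x * u x)) x)
    (hK0 : Tendsto K (𝓝[>] 0) (𝓝 0))
    (hQ : ∀ x, 0 < x → HasDerivAt Q (K x / (eulerWeight (-1) ((n : ℝ) / 2 + 1) x * u x ^ 2)) x)
    {L a b : ℝ} (hL : Tendsto E atTop (𝓝 L))
    (hq : (fun x => b - a * Q x) =O[atTop] fun x => L - E x) : a = 0 ∧ b = 0 := by
  have ha : a = 0 := by
    by_contra ha
    have h1 := hq.trans_isLittleO (h.isLittleO_quotient hE hK hK0 hQ (b := b) (Or.inl hL) ha)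
    have hm := strictMonoOn_Ioi_of_hasDerivAt hQ
      fun x hx => div_pos (h.K_pos hK hK0 hx) (h.hu.weight_pos hx)
    refine isLittleO_irrefl' (Eventually.frequently ?_) h1
    have hz : ∀ x, 0 < x → ∀ y, 0 < y → b - a * Q x = 0 → b - a * Q y = 0 → x = y := by
      intro x hx y hy h2 h3
      exact hm.injOn hx hy (mul_left_cancel₀ ha (by linarith))
    by_cases hex : ∃ x, 0 < x ∧ b - a * Q x = 0
    · obtain ⟨x, hx, hx'⟩ := hex
      filter_upwards [eventually_gt_atTop x] with y hy
      rw [norm_ne_zero_iff]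
      exact fun h3 => hy.ne (hz x hx y (hx.trans hy) hx' h3)
    · filter_upwards [eventually_gt_atTop 0] with y hy
      rw [norm_ne_zero_iff]
      exact fun h3 => hex ⟨y, hy, h3⟩
  refine ⟨ha, ?_⟩
  subst ha
  simp only [zero_mul, sub_zero] at hq
  have h1 : Tendsto (fun x => L - E x) atTop (𝓝 0) := by simpa using hL.const_sub L
  have h2 := hq.trans_tendsto h1
  exact tendsto_nhds_unique tendsto_const_nhds h2

end IsGreenData

/-! ### Classification of the solutions on the half line. -/

theorem exists_const_Ioi {f g f' : ℝ → ℝ} (hf : ∀ x, 0 < x → HasDerivAt f (f' x) x)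
    (hg : ∀ x, 0 < x → HasDerivAt g (f' x) x) : ∃ c, ∀ x, 0 < x → f x = g x + c := by
  have key : ∀ a b, 0 < a → a ≤ b → f b - f a = g b - g a := fun a b ha hab =>
    le_antisymm
      (sub_le_sub_of_hasDerivAt_le hab (fun t ht => hf t (ha.trans_le ht.1))
        (fun t ht => hg t (ha.trans_le ht.1)) fun _ _ => le_rfl)
      (sub_le_sub_of_hasDerivAt_le hab (fun t ht => hg t (ha.trans_le ht.1))
        (fun t ht => hf t (ha.trans_le ht.1)) fun _ _ => le_rfl)
  refine ⟨f 1 - g 1, fun x hx => ?_⟩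
  rcases le_total 1 x with h | h
  · linarith [key 1 x one_pos h]
  · linarith [key x 1 hx h]

theorem IsEulerSystemOn.const_mul {ε c μ κ : ℝ} {U : Set ℝ} {f f₁ W W₁ : ℝ → ℝ}
    (h : IsEulerSystemOn ε c μ κ U f f₁ W W₁) (a : ℝ) :
    IsEulerSystemOn ε c μ κ U (fun x => a * f x) (fun x => a * f₁ x) (fun x => a * W x)
      (fun x => a * W₁ x) where
  d0 x hx := (h.d0 x hx).const_mul a
  d1 x hx := ((h.d1 x hx).const_mul a).congr_deriv (by ring)
  e0 x hx := (h.e0 x hx).const_mul a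
  e1 x hx := ((h.e1 x hx).const_mul a).congr_deriv (by ring)

theorem IsEulerSystemOn.sub {ε c μ κ : ℝ} {U : Set ℝ} {f f₁ W W₁ g g₁ Z Z₁ : ℝ → ℝ}
    (h : IsEulerSystemOn ε c μ κ U f f₁ W W₁) (h' : IsEulerSystemOn ε c μ κ U g g₁ Z Z₁) :
    IsEulerSystemOn ε c μ κ U (fun x => f x - g x) (fun x => f₁ x - g₁ x) (fun x => W x - Z x)
      (fun x => W₁ x - Z₁ x) where
  d0 x hx := (h.d0 x hx).sub (h'.d0 x hx)
  d1 x hx := ((h.d1 x hx).sub (h'.d1 x hx)).congr_deriv (by ring)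
  e0 x hx := (h.e0 x hx).sub (h'.e0 x hx)
  e1 x hx := ((h.e1 x hx).sub (h'.e1 x hx)).congr_deriv (by ring)

namespace IsGreenData

variable {n : ℕ} {A B : ℝ} {g g₁ g₂ u u₁ u₂ T J E K Q : ℝ → ℝ}

theorem isEulerSystemOn (h : IsGreenData n A B g g₁ g₂ u u₁ u₂ T J)
    (hE : ∀ x, 0 < x → HasDerivAt E (J x / (eulerWeight (-1) ((n : ℝ) / 2 + 1) x * u x ^ 2)) x)
    (L : ℝ) : ∃ f₁ W W₁, IsEulerSystemOn (-1) ((n : ℝ) / 2 + 1)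
      (((n : ℝ) / 2 + 1 / 2) ^ 2 - B ^ 2) (((n : ℝ) / 2 + 1 / 2) ^ 2 - A ^ 2) (Set.Ioi 0)
      (fun x => u x * (L - E x)) f₁ W W₁ := by
  have r1 := fun x (hx : 0 < x) => hasDerivAt_reduction (R := 0) (j := fun _ => -1)
    (neg_weight_arg_pos hx)
    (h.hg.d0 x (by linarith)) (h.hg.d1 x (by linarith)) (h.hg.ode x (by linarith))
    (h.hg.pos x hx.le).ne' (h.dT x hx) ((hasDerivAt_const x (-1 : ℝ)).congr_deriv (by ring))
  have r2 := fun x (hx : 0 < x) => hasDerivAt_reduction (φ := fun x => L - E x)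
    (R := -((1 - 2 * -1 * x) * (g x * T x)))
    (j := fun x => -J x) (neg_weight_arg_pos hx)
    (h.hu.d0 x (by linarith)) (h.hu.d1 x (by linarith)) (h.hu.ode x (by linarith))
    (h.hu.pos x hx.le).ne' (((hE x hx).const_sub L).congr_deriv (by ring))
    ((h.dJ x hx).neg.congr_deriv (by ring))
  exact ⟨_, _, _, fun x hx => (r2 x hx).1,
    fun x hx => (r2 x hx).2.congr_deriv (by congr 1; ring), fun x hx => (r1 x hx).1,
    fun x hx => (r1 x hx).2.congr_deriv (by congr 1; ring)⟩

/-- The singularity at `0` of the solution. -/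
theorem isBigO_sub (h : IsGreenData n A B g g₁ g₂ u u₁ u₂ T J) (hn : 2 ≤ n)
    (hE : ∀ x, 0 < x → HasDerivAt E (J x / (eulerWeight (-1) ((n : ℝ) / 2 + 1) x * u x ^ 2)) x)
    (L : ℝ) : (fun x => u x * (L - E x) - leadRatio n * singLead n x) =O[𝓝[>] 0]
      greenRemainder n := by
  obtain ⟨a, b, ha, hb, ha0, hb0, hf⟩ := frobenius_green (f := fun x => u x * (E x - L)) hn (-1)
    h.hg.an h.hg.one h.hu.an h.hu.one
    (eventually_pos_nhdsGT.mono fun x hx => h.dT x hx)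
    (Eventually.of_forall fun x => (rfl : g x * T x = g x * T x))
    (eventually_pos_nhdsGT.mono fun x hx => h.dJ x hx) h.limJ
    (eventually_pos_nhdsGT.mono fun x hx => (hE x hx).sub_const L)
    (Eventually.of_forall fun x => rfl)
  have h1 := sub_singLead_isBigO (C := -leadRatio n) hn ha hb (fun h2 => by rw [ha0 h2]; ring)
    (fun h2 => by rw [hb0 h2]; ring) hf
  exact h1.neg_left.congr_left fun x => by ring

/-- Near 0, g u < 2 gives K' ≤ 2w' for the weight w, hence K ≤ 2w. With u > 1/2 this yields Q' ≤ 8.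
-/
theorem isBigO_one_mul_Q (h : IsGreenData n A B g g₁ g₂ u u₁ u₂ T J)
    (hK : ∀ x, 0 < x → HasDerivAt K
      (eulerWeight (-1) ((n : ℝ) / 2) x * ((1 - 2 * -1 * x) * g x * u x)) x)
    (hK0 : Tendsto K (𝓝[>] 0) (𝓝 0))
    (hQ : ∀ x, 0 < x → HasDerivAt Q (K x / (eulerWeight (-1) ((n : ℝ) / 2 + 1) x * u x ^ 2)) x) :
    Q =O[𝓝[>] 0] fun _ => (1 : ℝ) := by
  have hle : 𝓝[>] (0 : ℝ) ≤ 𝓝 0 := nhdsWithin_le_nhds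
  have tg : Tendsto g (𝓝[>] 0) (𝓝 1) := h.hg.one ▸ h.hg.an.continuousAt.tendsto.mono_left hle
  have tu : Tendsto u (𝓝[>] 0) (𝓝 1) := h.hu.one ▸ h.hu.an.continuousAt.tendsto.mono_left hle
  have e1 : ∀ᶠ x in 𝓝[>] (0 : ℝ), g x * u x < 2 :=
    (tg.mul tu).eventually (gt_mem_nhds (by norm_num))
  have e2 : ∀ᶠ x in 𝓝[>] (0 : ℝ), 1 / 2 < u x := tu.eventually (lt_mem_nhds (by norm_num))
  obtain ⟨δ, hδ, hδ'⟩ := mem_nhdsGT_iff_exists_Ioo_subset.1 (e1.and e2)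
  have hδ0 : (0 : ℝ) < δ := hδ
  have hKw : ∀ x, 0 < x → x < δ → K x ≤ 2 * eulerWeight (-1) ((n : ℝ) / 2 + 1) x := by
    intro x hx hxδ
    have key : ∀ s, 0 < s → s ≤ x → K x - K s ≤ 2 * eulerWeight (-1) ((n : ℝ) / 2 + 1) x :=
      fun s hs hsx => by
        have h1 := sub_le_sub_of_hasDerivAt_le hsx (fun t ht => hK t (hs.trans_le ht.1))
          (fun t ht => (hasDerivAt_eulerWeight (neg_weight_arg_pos (hs.trans_le ht.1))
            ((n : ℝ) / 2)).const_mul 2) fun t ht => by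
            have ht0 := hs.trans_le ht.1
            have h2 := (hδ' ⟨ht0, ht.2.trans_lt hxδ⟩).1
            have hV := eulerWeight_pos (neg_weight_arg_pos ht0) ((n : ℝ) / 2)
            have h3 : g t * u t ≤ ((n : ℝ) / 2 + 1) * 2 := by
              have : (0 : ℝ) ≤ n := by positivity
              have h2' : g t * u t < 2 := h2
              linarith
            have h4 : 0 < 1 - 2 * -1 * t := by linarith
            calc eulerWeight (-1) ((n : ℝ) / 2) t * ((1 - 2 * -1 * t) * g t * u t)
                = (1 - 2 * -1 * t) * eulerWeight (-1) ((n : ℝ) / 2) t * (g t * u t) := by ring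
              _ ≤ (1 - 2 * -1 * t) * eulerWeight (-1) ((n : ℝ) / 2) t
                  * (((n : ℝ) / 2 + 1) * 2) := mul_le_mul_of_nonneg_left h3 (by positivity)
              _ = _ := by ring
        have := eulerWeight_pos (neg_weight_arg_pos hs) ((n : ℝ) / 2 + 1)
        linarith
    have hl := hK0.const_sub (K x)
    rw [sub_zero] at hl
    refine le_of_tendsto hl ?_
    filter_upwards [Ioo_mem_nhdsGT hx] with s hs using key s hs.1 hs.2.le
  have hδ2 : 0 < δ / 2 := half_pos hδ0
  have hb : ∀ x, 0 < x → x ≤ δ / 2 → Q (δ / 2) - Q x ≤ 8 * (δ / 2) - 8 * x := fun x hx hxδ =>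
    sub_le_sub_of_hasDerivAt_le hxδ (fun t ht => hQ t (hx.trans_le ht.1))
      (fun t _ => (hasDerivAt_id t).const_mul 8) fun t ht => by
        have ht0 := hx.trans_le ht.1
        have htδ : t < δ := by linarith [ht.2]
        have h1 := hKw t ht0 htδ
        have h2 : 1 / 2 < u t := (hδ' ⟨ht0, htδ⟩).2
        have hw := eulerWeight_pos (neg_weight_arg_pos ht0) ((n : ℝ) / 2 + 1)
        rw [div_le_iff₀ (h.hu.weight_pos ht0), mul_one]
        have h3 : 1 / 4 ≤ u t ^ 2 := by nlinarith
        nlinarith [mul_le_mul_of_nonneg_left h3 hw.le]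
  have hm := (strictMonoOn_Ioi_of_hasDerivAt hQ
    fun x hx => div_pos (h.K_pos hK hK0 hx) (h.hu.weight_pos hx)).monotoneOn
  refine IsBigO.of_bound (|Q (δ / 2)| + 4 * δ) ?_
  filter_upwards [Ioo_mem_nhdsGT hδ2] with x hx
  have h1 := hb x hx.1 hx.2.le
  have h2 := hm hx.1 hδ2 hx.2.le
  have h3 := hx.1
  rw [norm_one, mul_one, Real.norm_eq_abs, abs_le]
  have := neg_abs_le (Q (δ / 2))
  have := le_abs_self (Q (δ / 2))
  constructor <;> linarith

/-- The solutions with remainder size at `0`. -/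
theorem exists_eq_of_isBigO (h : IsGreenData n A B g g₁ g₂ u u₁ u₂ T J) (hn : 2 ≤ n)
    (hE : ∀ x, 0 < x → HasDerivAt E (J x / (eulerWeight (-1) ((n : ℝ) / 2 + 1) x * u x ^ 2)) x)
    (hK : ∀ x, 0 < x → HasDerivAt K
      (eulerWeight (-1) ((n : ℝ) / 2) x * ((1 - 2 * -1 * x) * g x * u x)) x)
    (hK0 : Tendsto K (𝓝[>] 0) (𝓝 0))
    (hQ : ∀ x, 0 < x → HasDerivAt Q (K x / (eulerWeight (-1) ((n : ℝ) / 2 + 1) x * u x ^ 2)) x)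
    {f f₁ W W₁ : ℝ → ℝ} (hf : IsEulerSystemOn (-1) ((n : ℝ) / 2 + 1)
      (((n : ℝ) / 2 + 1 / 2) ^ 2 - B ^ 2) (((n : ℝ) / 2 + 1 / 2) ^ 2 - A ^ 2) (Set.Ioi 0) f f₁ W W₁)
    (hO : f =O[𝓝[>] 0] greenRemainder n) :
    ∃ a b, ∀ x, 0 < x → f x = u x * (b - a * Q x) := by
  have hn' : (2 : ℝ) ≤ n := by exact_mod_cast hn
  -- Four integrations produce the four constants: m from the Wronskian of W and g, a from W/g, j₀
  -- from the Wronskian of f and u, and b from f/u.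
  obtain ⟨m, hm⟩ := exists_const_Ioi (g := fun _ => 0) (fun x hx => hasDerivAt_wronskian
    (a := -((((n : ℝ) / 2 + 1 / 2) ^ 2 - A ^ 2) * W x)) (neg_weight_arg_pos hx) (hf.e0 x hx)
    (hf.e1 x hx) (h.hg.d0 x (by linarith)) (h.hg.d1 x (by linarith))
    (by rw [mul_div_sub_add (neg_weight_arg_pos hx)]; ring) (h.hg.ode x (by linarith)))
    (fun x _ => (hasDerivAt_const x (0 : ℝ)).congr_deriv (by ring))
  obtain ⟨a, ha⟩ := exists_const_Ioi (g := fun x => -m * T x)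
    (fun x hx => hasDerivAt_quotient (α := (n : ℝ) / 2) (neg_weight_arg_pos hx) (hf.e0 x hx)
      (h.hg.d0 x (by linarith)) (h.hg.pos x hx.le).ne')
    (fun x hx => ((h.dT x hx).const_mul (-m)).congr_deriv (by
      rw [hm x hx]; ring))
  have hW : ∀ x, 0 < x → W x = g x * (a - m * T x) := fun x hx => by
    have := ha x hx
    rw [div_eq_iff (h.hg.pos x hx.le).ne'] at this
    rw [this]; ring
  obtain ⟨j₀, hj⟩ := exists_const_Ioi (g := fun x => m * J x - a * K x)
    (fun x hx => hasDerivAt_wronskian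
    (a := -((((n : ℝ) / 2 + 1 / 2) ^ 2 - B ^ 2) * f x + (1 - 2 * -1 * x) * W x))
    (neg_weight_arg_pos hx) (hf.d0 x hx)
    (hf.d1 x hx) (h.hu.d0 x (by linarith)) (h.hu.d1 x (by linarith))
    (by rw [mul_div_sub_add (neg_weight_arg_pos hx)]; ring) (h.hu.ode x (by linarith)))
    (fun x hx => (((h.dJ x hx).const_mul m).sub ((hK x hx).const_mul a)).congr_deriv (by
      rw [hW x hx]; ring))
  obtain ⟨P, hP⟩ := exists_primitive_Ioi (h.hu.continuousOn_div (continuousOn_const (c := (1 : ℝ))))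
  obtain ⟨b, hb⟩ := exists_const_Ioi (g := fun x => m * E x - a * Q x + j₀ * P x)
    (fun x hx => hasDerivAt_quotient (α := (n : ℝ) / 2) (neg_weight_arg_pos hx) (hf.d0 x hx)
      (h.hu.d0 x (by linarith)) (h.hu.pos x hx.le).ne')
    (fun x hx => ((((hE x hx).const_mul m).sub ((hQ x hx).const_mul a)).add
      ((hP x hx).const_mul j₀)).congr_deriv (by rw [hj x hx]; ring))
  have hfu : ∀ x, 0 < x → f x = u x * (m * E x - a * Q x + j₀ * P x + b) := fun x hx => by
    have := hb x hx
    rw [div_eq_iff (h.hu.pos x hx.le).ne'] at this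
    rw [this]; ring
  obtain ⟨A₀, B₀, hA₀, hB₀, hA₀', hPf⟩ := frobenius_of_quotient hn (-1) h.hu.an h.hu.one
    (eventually_pos_nhdsGT.mono fun x hx => hP x hx)
    (Eventually.of_forall fun x => (rfl : u x * P x = u x * P x))
  have hA₀ne : A₀ 0 ≠ 0 := by
    rw [hA₀']; exact div_ne_zero (by norm_num) (by linarith)
  have hu1 : u =O[𝓝[>] 0] fun _ => (1 : ℝ) :=
    (h.hu.an.continuousAt.tendsto.mono_left nhdsWithin_le_nhds).isBigO_one ℝ
  have hq : (fun x => u x * (b - a * Q x)) =O[𝓝[>] 0] greenRemainder n := by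
    have h1 : (fun x => b - a * Q x) =O[𝓝[>] 0] fun _ => (1 : ℝ) :=
      (isBigO_const_const b one_ne_zero _).sub ((h.isBigO_one_mul_Q hK hK0 hQ).const_mul_left a)
    have h2 := hu1.mul h1
    simp only [mul_one] at h2
    exact h2.trans (one_isBigO_greenRemainder n)
  -- m multiplies a solution with the Green's singularity and j₀ one of size x^(-n/2); the rest is
  -- bounded, so both constants vanish.
  have hz : m = 0 ∧ j₀ = 0 := by
    have := coeffs_eq_zero_of_isBigO (a := -m) (b := j₀) hn (leadRatio_pos hn).ne' hA₀ne
      (h.isBigO_sub hn hE 0) (tendsto_rpow_mul_of_frobenius hn hA₀ hB₀ hPf) (by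
        refine (hO.sub hq).congr' ?_ EventuallyEq.rfl
        filter_upwards [self_mem_nhdsWithin] with x hx
        rw [hfu x hx]; ring)
    exact ⟨neg_eq_zero.1 this.1, this.2⟩
  refine ⟨a, b, fun x hx => ?_⟩
  rw [hfu x hx, hz.1, hz.2]; ring

end IsGreenData

/-! ### Exponents at infinity and conclusion. -/

/-- The exponent at infinity of the first second order equation. -/
noncomputable def eulerA (n p : ℕ) (ℓ : ℝ) : ℝ := √((((n : ℝ) - 1 - 2 * p) / 2) ^ 2 - ℓ)

/-- The exponent at infinity of the second one. -/
noncomputable def eulerB (n p : ℕ) (ℓ : ℝ) : ℝ := √((((n : ℝ) + 1 - 2 * p) / 2) ^ 2 - ℓ)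

theorem eulerKappa_eq (n p : ℕ) {ℓ : ℝ} (hℓ : ℓ ≤ 0) :
    ((n : ℝ) / 2 + 1 / 2) ^ 2 - eulerA n p ℓ ^ 2 = eulerKappa n p ℓ := by
  rw [eulerA, Real.sq_sqrt (by nlinarith [sq_nonneg (((n : ℝ) - 1 - 2 * p) / 2)]), eulerKappa]
  ring

theorem eulerMu_eq (n p : ℕ) {ℓ : ℝ} (hℓ : ℓ ≤ 0) :
    ((n : ℝ) / 2 + 1 / 2) ^ 2 - eulerB n p ℓ ^ 2 = eulerMu n p ℓ := by
  rw [eulerB, Real.sq_sqrt (by nlinarith [sq_nonneg (((n : ℝ) + 1 - 2 * p) / 2)]), eulerMu]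
  ring

/-- For m = n-2p the exponents at ℓ = 0 are |m-1|/2 and |m+1|/2, with sum at least max(1,|m|). The
sum exceeds 1 if |m| ≥ 2, and a negative ℓ increases both exponents strictly. -/
theorem one_lt_eulerA_add_eulerB {n p : ℕ} {ℓ : ℝ} (hℓ : ℓ ≤ 0)
    (h : ℓ < 0 ∨ 2 ≤ |(n : ℤ) - 2 * (p : ℤ)|) :
    0 < eulerB n p ℓ ∧ 1 < eulerA n p ℓ + eulerB n p ℓ := by
  set m : ℝ := (n : ℝ) - 2 * p with hm
  have hsum : |m - 1| + |m + 1| ≥ 2 ∧ |m - 1| + |m + 1| ≥ 2 * |m| := by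
    constructor
    · have := neg_abs_le (m - 1); have := le_abs_self (m + 1); linarith
    · rcases abs_cases m with ⟨h1, -⟩ | ⟨h1, -⟩ <;> rw [h1]
      · have := le_abs_self (m - 1); have := le_abs_self (m + 1); linarith
      · have := neg_abs_le (m - 1); have := neg_abs_le (m + 1); linarith
  have eA : |((n : ℝ) - 1 - 2 * p) / 2| = |m - 1| / 2 := by
    rw [abs_div, abs_two, hm]; congr 2; ring
  have eB : |((n : ℝ) + 1 - 2 * p) / 2| = |m + 1| / 2 := by
    rw [abs_div, abs_two, hm]; congr 2; ring
  rcases h with h | h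
  · have hA : |m - 1| / 2 < eulerA n p ℓ := by
      rw [← eA, eulerA]; exact Real.lt_sqrt_of_sq_lt (by rw [sq_abs]; linarith)
    have hB : |m + 1| / 2 < eulerB n p ℓ := by
      rw [← eB, eulerB]; exact Real.lt_sqrt_of_sq_lt (by rw [sq_abs]; linarith)
    exact ⟨(by positivity : 0 ≤ |m + 1| / 2).trans_lt hB, by linarith [hsum.1]⟩
  · have hA : |m - 1| / 2 ≤ eulerA n p ℓ := by
      rw [← eA, eulerA]; exact Real.abs_le_sqrt (by linarith)
    have hB : |m + 1| / 2 ≤ eulerB n p ℓ := by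
      rw [← eB, eulerB]; exact Real.abs_le_sqrt (by linarith)
    have h2 : 2 ≤ |m| := by
      have : ((2 : ℤ) : ℝ) ≤ ((|(n : ℤ) - 2 * (p : ℤ)| : ℤ) : ℝ) := by exact_mod_cast h
      rw [Int.cast_abs] at this
      push_cast at this
      exact this
    refine ⟨?_, by linarith [hsum.2]⟩
    have : |m| ≤ |m + 1| + 1 := by
      have := abs_sub (m + 1) 1
      simpa using this
    linarith

/-- Only n = 2p, 2p+1, 2p-1 remain, with (A,B) equal to (1/2,1/2), (0,1), (1,0). The bound on μ uses
n ≥ 2. -/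
theorem eulerExponents_of_small {n p : ℕ} (hn : 2 ≤ n) {ℓ : ℝ} (hℓ : ℓ ≤ 0)
    (h : ¬ (ℓ < 0 ∨ 2 ≤ |(n : ℤ) - 2 * (p : ℤ)|)) :
    (n : ℝ) / 2 + 1 ≤ eulerMu n p ℓ ∧
    3 / 4 ≤ min (eulerA n p ℓ) (3 / 4) + min (eulerB n p ℓ) 1 ∧
    -1 < min (eulerB n p ℓ) 1 - min (eulerA n p ℓ) (3 / 4) := by
  push Not at h
  obtain rfl : ℓ = 0 := le_antisymm hℓ h.1
  have h2 := abs_lt.1 h.2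
  have hc : n = 2 * p ∨ n = 2 * p + 1 ∨ n + 1 = 2 * p := by omega
  rw [eulerA, eulerB, eulerMu]
  rcases hc with rfl | rfl | hc
  · have hp : (1 : ℝ) ≤ p := by
      have : 1 ≤ p := by omega
      exact_mod_cast this
    have e1 : ((((2 * p : ℕ) : ℝ) - 1 - 2 * p) / 2) ^ 2 - 0 = (1 / 2) ^ 2 := by push_cast; ring
    have e2 : ((((2 * p : ℕ) : ℝ) + 1 - 2 * p) / 2) ^ 2 - 0 = (1 / 2) ^ 2 := by push_cast; ring
    rw [e1, e2, Real.sqrt_sq (by norm_num)]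
    refine ⟨by push_cast; nlinarith, by norm_num, by norm_num⟩
  · have hp : (1 : ℝ) ≤ p := by
      have : 1 ≤ p := by omega
      exact_mod_cast this
    have e1 : ((((2 * p + 1 : ℕ) : ℝ) - 1 - 2 * p) / 2) ^ 2 - 0 = 0 ^ 2 := by push_cast; ring
    have e2 : ((((2 * p + 1 : ℕ) : ℝ) + 1 - 2 * p) / 2) ^ 2 - 0 = 1 ^ 2 := by push_cast; ring
    rw [e1, e2, Real.sqrt_sq (by norm_num), Real.sqrt_sq (by norm_num)]
    refine ⟨by push_cast; nlinarith, by norm_num, by norm_num⟩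
  · have hp : (2 : ℝ) ≤ p := by
      have : 2 ≤ p := by omega
      exact_mod_cast this
    have hc' : (n : ℝ) = 2 * p - 1 := by
      have : (n : ℝ) + 1 = 2 * p := by exact_mod_cast hc
      linarith
    have e1 : (((n : ℝ) - 1 - 2 * p) / 2) ^ 2 - 0 = 1 ^ 2 := by rw [hc']; ring
    have e2 : (((n : ℝ) + 1 - 2 * p) / 2) ^ 2 - 0 = 0 ^ 2 := by rw [hc']; ring
    rw [e1, e2, Real.sqrt_sq (by norm_num), Real.sqrt_sq (by norm_num), hc']
    refine ⟨by nlinarith, by norm_num, by norm_num⟩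

/-- The solution of fastest decay, in the variable `-z`. -/
theorem exists_fastest_pos {n p : ℕ} (hn : 2 ≤ n) {ℓ : ℝ} (hℓ : ℓ ≤ 0) {G : ℝ} (hG : G ≠ 0) :
    ∃ Φ : ℝ → ℝ,
      (∃ f₁ W W₁, IsEulerSystemOn (-1) ((n : ℝ) / 2 + 1) (eulerMu n p ℓ) (eulerKappa n p ℓ)
        (Set.Ioi 0) Φ f₁ W W₁) ∧
      (fun x => Φ x - G * singLead n x) =O[𝓝[>] 0] greenRemainder n ∧
      Tendsto Φ atTop (𝓝 0) ∧
      ∀ f f₁ W W₁, IsEulerSystemOn (-1) ((n : ℝ) / 2 + 1) (eulerMu n p ℓ) (eulerKappa n p ℓ)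
          (Set.Ioi 0) f f₁ W W₁ →
        (fun x => f x - G * singLead n x) =O[𝓝[>] 0] greenRemainder n →
        Φ =O[atTop] f ∧
        ((ℓ < 0 ∨ 2 ≤ |(n : ℤ) - 2 * (p : ℤ)|) → f =O[atTop] Φ → ∀ x, 0 < x → f x = Φ x) := by
  have hA : 0 ≤ eulerA n p ℓ := Real.sqrt_nonneg _
  have hB : 0 ≤ eulerB n p ℓ := Real.sqrt_nonneg _
  obtain ⟨g, g₁, g₂, u, u₁, u₂, T, J, h⟩ := exists_isGreenData hn hA hB
  obtain ⟨E, hE⟩ := exists_primitive_Ioi (h.hu.continuousOn_div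
    fun x hx => (h.dJ x hx).continuousAt.continuousWithinAt)
  obtain ⟨K, hK, hK0⟩ := h.exists_regular
  obtain ⟨Q, hQ⟩ := exists_primitive_Ioi (h.hu.continuousOn_div
    fun x hx => (hK x hx).continuousAt.continuousWithinAt)
  obtain ⟨L, hL0, hL, hL'⟩ : ∃ L, Tendsto (fun x => u x * (L - E x)) atTop (𝓝 0) ∧
      (Tendsto E atTop (𝓝 L) ∨ Tendsto E atTop atTop) ∧
      ((ℓ < 0 ∨ 2 ≤ |(n : ℤ) - 2 * (p : ℤ)|) → Tendsto E atTop (𝓝 L)) := by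
    by_cases hc : ℓ < 0 ∨ 2 ≤ |(n : ℤ) - 2 * (p : ℤ)|
    · obtain ⟨hB0, hAB⟩ := one_lt_eulerA_add_eulerB hℓ hc
      obtain ⟨L, h1, h2⟩ := h.exists_decaying_limit hn hE hA hB0 hAB
      exact ⟨L, h2, Or.inl h1, fun _ => h1⟩
    · obtain ⟨h1, h2, h3⟩ := eulerExponents_of_small hn hℓ hc
      obtain ⟨L, h4, h5⟩ := h.exists_decaying_constant hn hE hA hB
        (by rwa [eulerMu_eq n p hℓ]) h2 h3
      exact ⟨L, h4, h5, fun h6 => absurd h6 hc⟩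
  set D : ℝ := G / leadRatio n with hD
  have hlr := (leadRatio_pos hn).ne'
  have hD0 : D ≠ 0 := div_ne_zero hG hlr
  have hsys := h.isEulerSystemOn hE L
  have hsing : (fun x => D * (u x * (L - E x)) - G * singLead n x) =O[𝓝[>] 0]
      greenRemainder n := by
    refine ((h.isBigO_sub hn hE L).const_mul_left D).congr_left fun x => ?_
    rw [hD]; field_simp
  rw [eulerMu_eq n p hℓ, eulerKappa_eq n p hℓ] at hsys
  obtain ⟨f₁, W, W₁, hsys⟩ := hsys
  refine ⟨fun x => D * (u x * (L - E x)), ⟨_, _, _, hsys.const_mul D⟩, hsing, ?_, ?_⟩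
  · simpa using hL0.const_mul D
  · intro f f₁' W' W₁' hf hfs
    -- Subtracting two solutions with the same singularity leaves a solution of remainder size,
    -- hence u(b-aQ).
    have hdiff := hf.sub (hsys.const_mul D)
    rw [← eulerMu_eq n p hℓ, ← eulerKappa_eq n p hℓ] at hdiff
    obtain ⟨a, b, hab⟩ := h.exists_eq_of_isBigO hn hE hK hK0 hQ hdiff
      ((hfs.sub hsing).congr_left fun x => by ring)
    have hu0 : ∀ᶠ x in atTop, u x ≠ 0 := by
      filter_upwards [eventually_ge_atTop 0] with x hx using (h.hu.pos x hx).ne'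
    constructor
    · have h1 := ((isBigO_refl u atTop).mul
        (h.isBigO_quotient hE hK hK0 hQ (a := a) (b := b) hL hD0)).const_mul_left D
      refine h1.congr' EventuallyEq.rfl ?_
      filter_upwards [eventually_gt_atTop 0] with x hx
      linear_combination -hab x hx
    · intro hc hO x hx
      have h2 : (fun x => b - a * Q x) =O[atTop] fun x => L - E x := by
        have h3 := (isBigO_refl (fun x => (u x)⁻¹) atTop).mul
          (hO.sub (isBigO_refl (fun x => D * (u x * (L - E x))) atTop))
        have h4 : (fun x => b - a * Q x) =O[atTop] fun x => D * (L - E x) := by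
          refine h3.congr' ?_ ?_
          · filter_upwards [eventually_gt_atTop 0, hu0] with x hx hx0
            rw [hab x hx, inv_mul_cancel_left₀ hx0]
          · filter_upwards [hu0] with x hx0
            field_simp
        exact (isBigO_const_mul_right_iff hD0).1 h4
      obtain ⟨rfl, rfl⟩ := h.eq_zero_of_isBigO hE hK hK0 hQ (hL' hc) h2
      have := hab x hx
      simp only [zero_mul, sub_zero, mul_zero] at this
      linarith

theorem hasGreenSingularity_comp_neg (n : ℕ) (k : ℝ) (f : ℝ → ℝ) :
    HasGreenSingularity n k (𝓝[<] 0) f ↔ HasGreenSingularity n k (𝓝[>] 0) fun x => f (-x) := by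
  have hl : ∀ x, greenLeading n k (-x) = greenLeading n k x := fun x => by
    simp only [greenLeading, abs_neg]
  have hr : ∀ x, greenRemainder n (-x) = greenRemainder n x := fun x => by
    simp only [greenRemainder, abs_neg]
  have t1 : Tendsto (fun x : ℝ => -x) (𝓝[>] 0) (𝓝[<] 0) := by
    simpa using tendsto_neg_nhdsGT (a := (0 : ℝ))
  have t2 : Tendsto (fun x : ℝ => -x) (𝓝[<] 0) (𝓝[>] 0) := by
    simpa using tendsto_neg_nhdsLT (a := (0 : ℝ))
  constructor <;> intro h
  · refine (h.comp_tendsto t1).congr (fun x => ?_) fun x => ?_ <;> simp [hl, hr]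
  · refine (h.comp_tendsto t2).congr (fun x => ?_) fun x => ?_ <;> simp [hl, hr]

theorem mem_greenSolutionsNeg_iff {n p : ℕ} {k ℓ : ℝ} {f : ℝ → ℝ} :
    f ∈ greenSolutionsNeg n p k ℓ ↔
      (∃ f₁ W W₁, IsEulerSystemOn (-1) ((n : ℝ) / 2 + 1) (eulerMu n p ℓ) (eulerKappa n p ℓ)
        (Set.Ioi 0) (fun x => f (-x)) f₁ W W₁) ∧
      (fun x => f (-x) - greenCoeff n k * singLead n x) =O[𝓝[>] 0] greenRemainder n := by
  rw [greenSolutionsNeg, Set.mem_ofPred_eq, hasGreenSingularity_comp_neg, hasGreenSingularity_iff]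
  refine and_congr_left fun _ => ⟨fun h => ?_, fun ⟨f₁, W, W₁, h⟩ => ?_⟩
  · have h1 := exists_system_of_isFuchsSolutionOn isOpen_Iio
      (fun z (hz : z < 0) => hz.ne) (fun z (hz : z < 0) => (hz.trans one_pos).ne)
      (fun z (hz : z < 0) => (hz.trans one_half_pos).ne) h
    exact ⟨_, _, _, h1.comp_neg (V := Set.Ioi 0) fun x hx => Set.mem_Iio.2 (neg_lt_zero.2 hx)⟩
  · have h1 := h.comp_neg (V := Set.Iio 0) fun x hx => Set.mem_Ioi.2 (neg_pos.2 hx)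
    simp only [neg_neg] at h1
    exact isFuchsSolutionOn_of_system isOpen_Iio (fun z (hz : z < 0) => hz.ne)
      (fun z (hz : z < 0) => (hz.trans one_pos).ne) h1

theorem isBigO_atBot_iff {f g : ℝ → ℝ} :
    f =O[atBot] g ↔ (fun x => f (-x)) =O[atTop] fun x => g (-x) := by
  constructor <;> intro h
  · exact h.comp_tendsto tendsto_neg_atTop_atBot
  · refine (h.comp_tendsto tendsto_neg_atBot_atTop).congr (fun x => ?_) fun x => ?_ <;> simp

theorem exists_decaysFastestIn {n p : ℕ} (hn : 2 ≤ n) {k : ℝ} (hk : k ≠ 0) {ℓ : ℝ} (hℓ : ℓ ≤ 0) :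
    (∃ Φ : ℝ → ℝ, DecaysFastestIn (greenSolutionsNeg n p k ℓ) Φ) ∧
    (ℓ < 0 ∨ 2 ≤ |(n : ℤ) - 2 * (p : ℤ)| →
      ∀ Φ Ψ : ℝ → ℝ,
        DecaysFastestIn (greenSolutionsNeg n p k ℓ) Φ →
        DecaysFastestIn (greenSolutionsNeg n p k ℓ) Ψ →
        Set.EqOn Φ Ψ (Set.Iio 0)) := by
  obtain ⟨F, hF, hFs, hF0, hall⟩ := exists_fastest_pos (p := p) hn hℓ (greenCoeff_ne_zero hn hk)
  have hmem : (fun z => F (-z)) ∈ greenSolutionsNeg n p k ℓ := by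
    rw [mem_greenSolutionsNeg_iff]
    simp only [neg_neg]
    exact ⟨hF, hFs⟩
  constructor
  · refine ⟨fun z => F (-z), hmem, hF0.comp tendsto_neg_atBot_atTop, fun Ψ hΨ => ?_⟩
    rw [mem_greenSolutionsNeg_iff] at hΨ
    obtain ⟨⟨_, _, _, h1⟩, h2⟩ := hΨ
    rw [isBigO_atBot_iff]
    simpa only [neg_neg] using (hall _ _ _ _ h1 h2).1
  · intro hc
    -- A fastest-decaying solution is in particular dominated by the constructed one, and that
    -- domination already forces equality.
    have key : ∀ Φ, DecaysFastestIn (greenSolutionsNeg n p k ℓ) Φ → ∀ z, z < 0 → Φ z = F (-z) := by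
      intro Φ hΦ z hz
      obtain ⟨hΦ, -, hO⟩ := hΦ
      have h3 := isBigO_atBot_iff.1 (hO _ hmem)
      simp only [neg_neg] at h3
      rw [mem_greenSolutionsNeg_iff] at hΦ
      obtain ⟨⟨_, _, _, h1⟩, h2⟩ := hΦ
      have := (hall _ _ _ _ h1 h2).2 hc h3 (-z) (neg_pos.2 hz)
      simpa only [neg_neg] using this
    intro Φ Ψ hΦ hΨ z hz
    rw [key Φ hΦ z hz, key Ψ hΨ z hz]

theorem mainTheorem4 (n p : ℕ) (hn : 2 ≤ n) (hp : p ≤ n) (k : ℝ) (hk : k ≠ 0) (ℓ : ℝ) :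
    (ℓ ≤ 0 →
      (∃ Φ : ℝ → ℝ, DecaysFastestIn (greenSolutionsNeg n p k ℓ) Φ) ∧
      (ℓ < 0 ∨ 2 ≤ |(n : ℤ) - 2 * (p : ℤ)| →
        ∀ Φ Ψ : ℝ → ℝ,
          DecaysFastestIn (greenSolutionsNeg n p k ℓ) Φ →
          DecaysFastestIn (greenSolutionsNeg n p k ℓ) Ψ →
          Set.EqOn Φ Ψ (Set.Iio 0))) ∧
    (0 < ℓ ∨ (0 ≤ ℓ ∧ p ≠ 0 ∧ p ≠ n) →
      ∃ Φ : ℝ → ℝ,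
        IsPhiMinus n p k ℓ Φ ∧ HasFrobeniusFormAtZero n Φ ∧
        ∀ Ψ : ℝ → ℝ, IsPhiMinus n p k ℓ Ψ → Set.EqOn Ψ Φ (Set.Ioc 0 1)) :=
  ⟨fun hℓ => exists_decaysFastestIn hn hk hℓ, fun hℓ => exists_unique_phiMinus hn hp hk hℓ⟩
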